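/- Let $(M,g)$ be a smooth Hausdorff Riemannian manifold of dimension $n\ge 1$ with constant sectional curvature $\kappa\in\mathbb R$ (for instance a spaceform). Let $\gamma:\mathbb R\to M$ be a geodesic parametrized by arc length, let $(e_1,\dots,e_n)$ be the frame along $\gamma$ obtained by parallel transport of an orthonormal basis of $T_{\gamma(0)}M$ with $e_1(0)=\dot\gamma(0)$ (so $e_1=\dot\gamma$), and let $$\Phi(x^1,\dots,x^n)=\exp_{\gamma(x^1)}\Big(\sum_{k=2}^n x^k e_k(x^1)\Big)$$ be the normal exponential map, which defines the Fermi coordinates $(x^1,\vec x)$ along $\gamma=\{\vec x=0\}$. Let $\Gamma^k_{ij}$ be the Christoffel symbols of the metric $\Phi^*g$. (0) For every $s\in\mathbb R$ one has $\Phi(s,\vec 0)=\gamma(s)$, the map $\Phi$ and all $\Gamma^k_{ij}$ are smooth near $(s,\vec 0)$, and the differential of $\Phi$ at $(s,\vec 0)$ is bijective. (1) For all $m,p\in\{2,\dots,n\}$, all $a,b,i,j\in\{1,\dots,n\}$ and all $s\in\mathbb R$, $$\partial_1\partial_m\Gamma^i_{j1}(s,\vec 0)=0,\qquad \partial_p\partial_m\Gamma^i_{11}(s,\vec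 0)=0,\qquad \partial_1\partial_a\partial_b\Gamma^i_{11}(s,\vec 0)=0 .$$ (2) Let $d\ge 0$, let $\langle\cdot,\cdot\rangle$ be the Minkowski metric of signature $(-,+,\dots,+)$ on $\mathbb R^{1+d}$, $\Box$ its wave operator, $\ell:\mathbb R^{1+d}\to\mathbb R$ linear, and $\sigma=\langle D\ell,D\ell\rangle$. For $u=(u^1,\vec u)$ put $\varphi=(\ell+u^1,\vec u)$. Then for every $K$ there are $C,\delta>0$ such that, for every $x$ with $|\ell(x)|\le K$, every $u:\mathbb R^{1+d}\to\mathbb R^n$ that is $C^2$ near $x$ with $|u(x)|\le\delta$, and every $i$, at $x$ the left side of the wave map equation equals $$\begin{aligned}\Box\varphi^i+\Gamma^i_{jk}(\varphi)\langle D\varphi^j,D\varphi^k\rangle={}&\Box u^i+\sum_{m\ge2}\partial_m\Gamma^i_{11}u^m\sigma+2\sum_{m\ge 2}\partial_m\Gamma^i_{11}u^m\langle Du^1,D\ell\rangle+2\sum_{m,p\ge2}\partial_m\Gamma^i_{p1}u^m\langle Du^p,D\ell\rangle\\&+\sum_{m\ge2}\sum_{j,k\ge 1}\partial_m\Gamma^i_{jk}u^m\langle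 Du^j,Du^k\rangle+\sum_{m,p\ge2}\sum_{j\ge1}\partial_m\partial_p\Gamma^i_{j1}u^mu^p\langle Du^j,D\ell\rangle\\&+\tfrac16\sum_{m,p,q\ge2}\partial_m\partial_p\partial_q\Gamma^i_{11}u^mu^pu^q\,\sigma+\mathcal R^i,\qquad |\mathcal R^i|\le C\big(|u|^4+|Du|^4\big),\end{aligned}$$ where the derivatives of $\Gamma$ on the right are taken at $(\ell(x),\vec 0)$. Thus the only quadratic terms are of the forms $\vec u\cdot\langle D\vec u,D\ell\rangle$ and $\vec u\cdot\langle Du^1,D\ell\rangle$, and the undifferentiated $u^1$ does not occur in the terms up to third order. -/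

import Mathlib

open scoped Manifold ContDiff

noncomputable section

namespace FermiWaveMap

/-- Coordinate space `ℝ^{n+1}`. Coordinate `0` is written `x¹` in mathematical notation, and the
coordinates `m.succ` with `m : Fin n` are `x², …, x^{n+1}`. -/
abbrev Coord (n : ℕ) : Type := EuclideanSpace ℝ (Fin (n + 1))

/-- The `i`-th coordinate vector. -/
def basisVec {n : ℕ} (i : Fin (n + 1)) : Coord n := EuclideanSpace.single i (1 : ℝ)

/-- The partial derivative `∂_i f` at `x`. -/
def pd {n : ℕ} (i : Fin (n + 1)) (f : Coord n → ℝ) (x : Coord n) : ℝ :=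
  fderiv ℝ f x (basisVec i)

section Coordinates

variable {n : ℕ}

/-- The Christoffel symbol `Γ^k_{ij}` of a metric with components `G`. -/
def christoffel (G : Coord n → Matrix (Fin (n + 1)) (Fin (n + 1)) ℝ)
    (k i j : Fin (n + 1)) (y : Coord n) : ℝ :=
  (1 / 2) * ∑ l, (G y)⁻¹ k l *
    (pd i (fun z => G z j l) y + pd j (fun z => G z i l) y - pd l (fun z => G z i j) y)

/-- The component `l` of `R(∂_i, ∂_j) ∂_k`, where
`R(X,Y)Z = ∇_X ∇_Y Z - ∇_Y ∇_X Z - ∇_[X,Y] Z`. -/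
def riemann (G : Coord n → Matrix (Fin (n + 1)) (Fin (n + 1)) ℝ)
    (l i j k : Fin (n + 1)) (y : Coord n) : ℝ :=
  pd i (christoffel G l j k) y - pd j (christoffel G l i k) y
    + ∑ m, (christoffel G l i m y * christoffel G m j k y
      - christoffel G l j m y * christoffel G m i k y)

/-- The bilinear form `⟨v, w⟩` given by `G` at `y`. -/
def pairing (G : Coord n → Matrix (Fin (n + 1)) (Fin (n + 1)) ℝ)
    (y v w : Coord n) : ℝ :=
  ∑ i, ∑ j, G y i j * v i * w j

/-- `⟨R(v,w)w, v⟩` at `y`. -/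
def curvatureForm (G : Coord n → Matrix (Fin (n + 1)) (Fin (n + 1)) ℝ)
    (y v w : Coord n) : ℝ :=
  ∑ i, ∑ j, ∑ k, ∑ l, ∑ q, G y l q * riemann G l i j k y * v i * w j * w k * v q

end Coordinates

section Manifold

variable {n : ℕ} {M : Type*} [TopologicalSpace M] [ChartedSpace (Coord n) M]
  [IsManifold (𝓡 (n + 1)) ∞ M]

/-- Smooth Riemannian metrics on `M`. -/
abbrev Metric (n : ℕ) (M : Type*) [TopologicalSpace M] [ChartedSpace (Coord n) M]
    [IsManifold (𝓡 (n + 1)) ∞ M] : Type _ :=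
  Bundle.ContMDiffRiemannianMetric (𝓡 (n + 1)) ∞ (Coord n)
    (fun x : M => TangentSpace (𝓡 (n + 1)) x)

/-- The components `⟨∂_i ψ, ∂_j ψ⟩_g` of the pull-back of `g` under `ψ`. -/
def pullbackMetric (g : Metric n M) (ψ : Coord n → M) (y : Coord n) :
    Matrix (Fin (n + 1)) (Fin (n + 1)) ℝ :=
  Matrix.of fun i j =>
    g.inner (ψ y) (mfderiv 𝓘(ℝ, Coord n) (𝓡 (n + 1)) ψ y (basisVec i))
      (mfderiv 𝓘(ℝ, Coord n) (𝓡 (n + 1)) ψ y (basisVec j))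

/-- The components of `g` in the chart of `M` around `x₀`. -/
def chartMetric (g : Metric n M) (x₀ : M) : Coord n → Matrix (Fin (n + 1)) (Fin (n + 1)) ℝ :=
  pullbackMetric g (extChartAt (𝓡 (n + 1)) x₀).symm

/-- All sectional curvatures of `g` equal `κ`. For dependent `v, w` both sides vanish. -/
def HasConstantCurvature (g : Metric n M) (κ : ℝ) : Prop :=
  ∀ x₀ : M, ∀ y ∈ (extChartAt (𝓡 (n + 1)) x₀).target, ∀ v w : Coord n,
    curvatureForm (chartMetric g x₀) y v w =
      κ * (pairing (chartMetric g x₀) y v v * pairing (chartMetric g x₀) y w w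
        - pairing (chartMetric g x₀) y v w ^ 2)

/-- The velocity of a curve. -/
def velocity (c : ℝ → M) (t : ℝ) : TangentSpace (𝓡 (n + 1)) (c t) :=
  mfderiv 𝓘(ℝ, ℝ) (𝓡 (n + 1)) c t (1 : ℝ)

/-- The components in the chart around `x₀` of the vector `v` at `x`. -/
def chartComp (x₀ : M) {x : M} (v : TangentSpace (𝓡 (n + 1)) x) : Coord n :=
  mfderiv (𝓡 (n + 1)) 𝓘(ℝ, Coord n) (extChartAt (𝓡 (n + 1)) x₀) x v

/-- The vector field `V` along the smooth curve `c` is parallel on the open set `s`: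
`dV^k/dt + Γ^k_{ij} (dc^i/dt) V^j = 0` in charts. -/
def IsParallelOn (g : Metric n M) (c : ℝ → M) (V : ∀ t, TangentSpace (𝓡 (n + 1)) (c t))
    (s : Set ℝ) : Prop :=
  ∀ t ∈ s, ∀ x₀ : M, c t ∈ (extChartAt (𝓡 (n + 1)) x₀).source → ∀ k : Fin (n + 1),
    HasDerivAt (fun τ => chartComp x₀ (V τ) k)
      (-∑ i, ∑ j, christoffel (chartMetric g x₀) k i j (extChartAt (𝓡 (n + 1)) x₀ (c t))
        * chartComp x₀ (velocity c t) i * chartComp x₀ (V t) j) t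

/-- `c` is a geodesic on the open set `s`: it is smooth and its velocity is parallel. -/
def IsGeodesicOn (g : Metric n M) (c : ℝ → M) (s : Set ℝ) : Prop :=
  ContMDiffOn 𝓘(ℝ, ℝ) (𝓡 (n + 1)) ∞ c s ∧ IsParallelOn g c (velocity c) s

open Classical in
/-- The exponential map: the value at time `1` of the geodesic that starts at `p` with
velocity `v`, where that geodesic lives up to time `1` (always, if `g` is complete). -/
def geodesicExp (g : Metric n M) (p : M) (v : TangentSpace (𝓡 (n + 1)) p) : M :=
  if h : ∃ c : ℝ → M, (∃ ε > 0, IsGeodesicOn g c (Set.Ioo (-ε) (1 + ε))) ∧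
      (⟨c 0, velocity c 0⟩ : TangentBundle (𝓡 (n + 1)) M) = ⟨p, v⟩
  then h.choose 1 else p

/-- `e` is the frame along `γ` obtained by parallel transport of an orthonormal basis at `γ 0`
whose first vector is the velocity of `γ`. -/
structure IsParallelFrame (g : Metric n M) (γ : ℝ → M)
    (e : Fin (n + 1) → ∀ t, TangentSpace (𝓡 (n + 1)) (γ t)) : Prop where
  first : ∀ t, e 0 t = velocity γ t
  parallel : ∀ i, IsParallelOn g γ (e i) Set.univ
  orthonormal : ∀ i j, g.inner (γ 0) (e i 0) (e j 0) = if i = j then 1 else 0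

/-- The normal exponential map in the frame `e`; its inverse gives the Fermi coordinates
(geodesic normal coordinates) along `γ`. -/
def fermiMap (g : Metric n M) (γ : ℝ → M)
    (e : Fin (n + 1) → ∀ t, TangentSpace (𝓡 (n + 1)) (γ t)) (x : Coord n) : M :=
  geodesicExp g (γ (x 0)) (∑ m : Fin n, x m.succ • e m.succ (x 0))

/-- The Christoffel symbol `Γ^k_{ij}` in Fermi coordinates along `γ`. -/
def fermiChristoffel (g : Metric n M) (γ : ℝ → M)
    (e : Fin (n + 1) → ∀ t, TangentSpace (𝓡 (n + 1)) (γ t)) (k i j : Fin (n + 1)) :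
    Coord n → ℝ :=
  christoffel (pullbackMetric g (fermiMap g γ e)) k i j

end Manifold

/-- The point `(s, 0, …, 0)`, which represents `γ s` in Fermi coordinates. -/
def axis (n : ℕ) (s : ℝ) : Coord n := s • basisVec 0

section Minkowski

/-- The Minkowski product `⟨Df, Dh⟩` at `x` on `ℝ^{1+d}`, where coordinate `0` is time. -/
def minkD {d : ℕ} (f h : Coord d → ℝ) (x : Coord d) : ℝ :=
  -(pd 0 f x * pd 0 h x) + ∑ a : Fin d, pd a.succ f x * pd a.succ h x

/-- The wave operator on `ℝ^{1+d}`. -/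
def box {d : ℕ} (f : Coord d → ℝ) (x : Coord d) : ℝ :=
  -pd 0 (pd 0 f) x + ∑ a : Fin d, pd a.succ (pd a.succ f) x

variable {n d : ℕ}

/-- Component `i` of the wave map operator `□φ^i + Γ^i_{jk}(φ) ⟨Dφ^j, Dφ^k⟩`; the map `φ` is a
wave map if it vanishes for all `i`. -/
def waveMapOp (Γ : Fin (n + 1) → Fin (n + 1) → Fin (n + 1) → Coord n → ℝ)
    (φ : Coord d → Coord n) (i : Fin (n + 1)) (x : Coord d) : ℝ :=
  box (fun z => φ z i) x
    + ∑ j, ∑ k, Γ i j k (φ x) * minkD (fun z => φ z j) (fun z => φ z k) x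

/-- The terms linear in `u`: the sum over `m ≥ 2` of `∂_m Γ^i_{11}(ℓ,0) u^m ⟨Dℓ,Dℓ⟩`. -/
def linearPart (Γ : Fin (n + 1) → Fin (n + 1) → Fin (n + 1) → Coord n → ℝ)
    (ℓ : Coord d →L[ℝ] ℝ) (u : Coord d → Coord n) (i : Fin (n + 1)) (x : Coord d) : ℝ :=
  ∑ m : Fin n, pd m.succ (Γ i 0 0) (axis n (ℓ x)) * u x m.succ * minkD ℓ ℓ x

/-- Quadratic terms, of the form `u^m ⟨Du^1, Dℓ⟩` and `u^m ⟨Du^p, Dℓ⟩` with `m, p ≥ 2`. -/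
def quadraticPart (Γ : Fin (n + 1) → Fin (n + 1) → Fin (n + 1) → Coord n → ℝ)
    (ℓ : Coord d →L[ℝ] ℝ) (u : Coord d → Coord n) (i : Fin (n + 1)) (x : Coord d) : ℝ :=
  2 * ∑ m : Fin n, pd m.succ (Γ i 0 0) (axis n (ℓ x)) * u x m.succ
        * minkD (fun z => u z 0) ℓ x
    + 2 * ∑ m : Fin n, ∑ p : Fin n, pd m.succ (Γ i p.succ 0) (axis n (ℓ x)) * u x m.succ
        * minkD (fun z => u z p.succ) ℓ x

/-- Cubic terms; the undifferentiated factors are among the `u^m` with `m ≥ 2`. -/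
def cubicPart (Γ : Fin (n + 1) → Fin (n + 1) → Fin (n + 1) → Coord n → ℝ)
    (ℓ : Coord d →L[ℝ] ℝ) (u : Coord d → Coord n) (i : Fin (n + 1)) (x : Coord d) : ℝ :=
  ∑ m : Fin n, ∑ j, ∑ k, pd m.succ (Γ i j k) (axis n (ℓ x)) * u x m.succ
        * minkD (fun z => u z j) (fun z => u z k) x
    + ∑ m : Fin n, ∑ p : Fin n, ∑ j, pd m.succ (pd p.succ (Γ i j 0)) (axis n (ℓ x))
        * u x m.succ * u x p.succ * minkD (fun z => u z j) ℓ x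
    + (1 / 6) * ∑ m : Fin n, ∑ p : Fin n, ∑ q : Fin n,
        pd m.succ (pd p.succ (pd q.succ (Γ i 0 0))) (axis n (ℓ x))
          * u x m.succ * u x p.succ * u x q.succ * minkD ℓ ℓ x

end Minkowski

end FermiWaveMap

end

/-! In constant curvature, by the Jacobi equation, the inner products of two Jacobi fields along a
geodesic, of their covariant derivatives and of the velocity solve a linear system of ordinary
differential equations that does not see the manifold otherwise, so they are determined by their
initial values. The coordinate fields of `Φ` are Jacobi fields along the geodesics normal to `γ`,
and the initial values depend neither on the base point nor on the sign of the normal direction. So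
the components of the metric in Fermi coordinates do not depend on `x¹` and are even in `x⃗`, and
the Christoffel symbols do not depend on `x¹` and are odd in `x⃗`: on the axis they vanish together
with their `x¹`-derivatives and all their derivatives of even order, which leaves only the stated
terms in the Taylor expansion of the wave map equation. -/

open scoped Manifold ContDiff

noncomputable section

namespace FermiWaveMap

section Superposition

variable {K : Type*} [TopologicalSpace K] [CompactSpace K]

section Application

variable {E F : Type*} [NormedAddCommGroup E] [NormedSpace ℝ E] [NormedAddCommGroup F]
  [NormedSpace ℝ F]

/-- The bilinear map which applies a continuous family of operators to a continuous family of
vectors, pointwise. -/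
def pointwiseApply (K : Type*) [TopologicalSpace K] [CompactSpace K] (E F : Type*)
    [NormedAddCommGroup E] [NormedSpace ℝ E] [NormedAddCommGroup F] [NormedSpace ℝ F] :
    C(K, E →L[ℝ] F) →L[ℝ] C(K, E) →L[ℝ] C(K, F) :=
  LinearMap.mkContinuous₂
    (LinearMap.mk₂ ℝ (fun (A : C(K, E →L[ℝ] F)) (α : C(K, E)) =>
        (⟨fun x => A x (α x), A.continuous.clm_apply α.continuous⟩ : C(K, F)))
      (fun _ _ _ => by ext; simp) (fun _ _ _ => by ext; simp)
      (fun _ _ _ => by ext; simp) (fun _ _ _ => by ext; simp)) 1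
    (fun A α => by
      rw [one_mul]
      refine (ContinuousMap.norm_le _ (by positivity)).2 fun x => ?_
      exact (A x).le_of_opNorm_le_of_le (A.norm_coe_le_norm x) (α.norm_coe_le_norm x))

@[simp] lemma pointwiseApply_apply (A : C(K, E →L[ℝ] F)) (α : C(K, E)) (x : K) :
    pointwiseApply K E F A α x = A x (α x) := rfl

lemma hasFDerivAt_superposition {f : C(E, F)} {f' : C(E, E →L[ℝ] F)}
    (hf : ∀ x, HasFDerivAt f (f' x) x) (α : C(K, E)) :
    HasFDerivAt (fun β : C(K, E) => f.comp β) (pointwiseApply K E F (f'.comp α)) α := by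
  rw [hasFDerivAt_iff_isLittleO, Asymptotics.isLittleO_iff]
  intro ε hε
  have hcont : ContinuousAt (fun β : C(K, E) => f'.comp β) α :=
    (ContinuousMap.continuous_postcomp f').continuousAt
  obtain ⟨δ, hδ, hclose⟩ := (Metric.continuousAt_iff (f := fun β => f'.comp β) (a := α)).1
    (by exact hcont) ε hε
  filter_upwards [Metric.ball_mem_nhds α hδ] with β hβ
  refine (ContinuousMap.norm_le _ (by positivity)).2 fun x => ?_
  have hsegment : ∀ y ∈ segment ℝ (α x) (β x), ‖f' y - f' (α x)‖ ≤ ε := by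
    intro y hy
    rw [segment_eq_image'] at hy
    obtain ⟨θ, hθ, rfl⟩ := hy
    have hnear : dist (α + θ • (β - α)) α < δ := by
      rw [dist_eq_norm, add_sub_cancel_left, norm_smul, Real.norm_of_nonneg hθ.1]
      exact (mul_le_of_le_one_left (norm_nonneg _) hθ.2).trans_lt (mem_ball_iff_norm.1 hβ)
    simpa [dist_eq_norm] using (ContinuousMap.dist_apply_le_dist x).trans (hclose hnear).le
  have hmean := (convex_segment (α x) (β x)).norm_image_sub_le_of_norm_hasFDerivWithin_le'
    (fun y _ => (hf y).hasFDerivWithinAt) hsegment (left_mem_segment ℝ _ _)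
    (right_mem_segment ℝ _ _)
  exact (by simpa using hmean : _ ≤ ε * ‖β x - α x‖).trans
    (by gcongr; exact (β - α).norm_coe_le_norm x)

end Application

universe u

variable {E F : Type u} [NormedAddCommGroup E] [NormedSpace ℝ E] [NormedAddCommGroup F]
  [NormedSpace ℝ F]

lemma contDiff_superposition {f : C(E, F)} (hf : ContDiff ℝ ∞ f) :
    ContDiff ℝ ∞ (fun β : C(K, E) => f.comp β) := by
  refine contDiff_infty.2 fun k => ?_
  induction k generalizing F with
  | zero => exact contDiff_zero.2 (ContinuousMap.continuous_postcomp f)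
  | succ k ih =>
    have hf' : ContDiff ℝ ∞ (fderiv ℝ f) := hf.fderiv_right (m := ∞) (by simp)
    let f' : C(E, E →L[ℝ] F) := ⟨fderiv ℝ f, hf'.continuous⟩
    exact contDiff_succ_iff_hasFDerivAt.2 ⟨fun α => pointwiseApply K E F (f'.comp α),
      by exact (pointwiseApply K E F).contDiff.comp (ih (f := f') hf'),
      hasFDerivAt_superposition (f' := f') fun x => (hf.differentiable (by simp) x).hasFDerivAt⟩

end Superposition

section Volterra

open Set intervalIntegral

open scoped Nat

variable {a b : ℝ} {E : Type*} [NormedAddCommGroup E]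

lemma continuous_IccExtend (hab : a ≤ b) (α : C(Icc a b, E)) :
    Continuous (IccExtend hab α) :=
  α.continuous.Icc_extend'

variable [NormedSpace ℝ E]

/-- The Volterra operator, which maps a curve `α` to its primitive `t ↦ ∫ τ in t₀..t, α τ`. The
integrand is extended from `[a, b]` to the line by constants. -/
def volterra (t₀ : Icc a b) : C(Icc a b, E) →L[ℝ] C(Icc a b, E) :=
  have hab : a ≤ b := t₀.2.1.trans t₀.2.2
  LinearMap.mkContinuous
    { toFun := fun α => ⟨fun t => ∫ τ in (t₀ : ℝ)..t, IccExtend hab α τ,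
        (continuous_primitive (fun _ _ => (continuous_IccExtend hab α).intervalIntegrable _ _)
          _).comp continuous_subtype_val⟩
      map_add' := fun α β => by
        ext t
        exact integral_add ((continuous_IccExtend hab α).intervalIntegrable _ _)
          ((continuous_IccExtend hab β).intervalIntegrable _ _)
      map_smul' := fun c α => by
        ext t
        exact integral_smul c _ } (b - a)
    (fun α => by
      refine (ContinuousMap.norm_le _
        (mul_nonneg (sub_nonneg.2 hab) (norm_nonneg _))).2 fun t => ?_
      rw [mul_comm]
      refine (norm_integral_le_of_norm_le_const (C := ‖α‖)
        fun τ _ => α.norm_coe_le_norm _).trans ?_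
      gcongr
      exact abs_sub_le_of_le_of_le t.2.1 t.2.2 t₀.2.1 t₀.2.2)

lemma volterra_apply (t₀ : Icc a b) (α : C(Icc a b, E)) (t : Icc a b) :
    volterra t₀ α t = ∫ τ in (t₀ : ℝ)..t, IccExtend (t₀.2.1.trans t₀.2.2) α τ := rfl

lemma hasDerivAt_of_eq_const_add_volterra [CompleteSpace E] {t₀ : Icc a b} {z : E}
    {α β : C(Icc a b, E)} (h : α = ContinuousMap.const _ z + volterra t₀ β) {t : ℝ}
    (ht : t ∈ Ioo a b) :
    HasDerivAt (IccExtend (t₀.2.1.trans t₀.2.2) α) (IccExtend (t₀.2.1.trans t₀.2.2) β t) t := by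
  have hprim : HasDerivAt
      (fun s => z + ∫ τ in (t₀ : ℝ)..s, IccExtend (t₀.2.1.trans t₀.2.2) β τ) _ t :=
    ((continuous_IccExtend _ β).integral_hasStrictDerivAt t₀ t).hasDerivAt.const_add z
  refine hprim.congr_of_eventuallyEq ?_
  filter_upwards [Ioo_mem_nhds ht.1 ht.2] with s hs
  rw [IccExtend_of_mem _ _ ⟨hs.1.le, hs.2.le⟩, h]
  rfl

lemma norm_volterra_comp_pow_apply_le (t₀ : Icc a b) (A : C(Icc a b, E →L[ℝ] E))
    (β : C(Icc a b, E)) (k : ℕ) (t : Icc a b) :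
    ‖(((volterra t₀).comp (pointwiseApply _ E E A)) ^ k) β t‖ ≤
      (‖A‖ * |(t : ℝ) - t₀|) ^ k / k ! * ‖β‖ := by
  induction k generalizing t with
  | zero => simpa using β.norm_coe_le_norm t
  | succ k ih =>
    rw [pow_succ', mul_apply_eq_comp, ContinuousLinearMap.comp_apply, volterra_apply,
      norm_intervalIntegral_eq]
    set α := (((volterra t₀).comp (pointwiseApply _ E E A)) ^ k) β
    calc ‖∫ τ in uIoc (t₀ : ℝ) t, IccExtend _ (pointwiseApply _ E E A α) τ‖
        ≤ ∫ τ in uIoc (t₀ : ℝ) t, ‖A‖ ^ (k + 1) / k ! * ‖β‖ * |τ - t₀| ^ k := by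
          refine MeasureTheory.norm_integral_le_of_norm_le
            (Continuous.integrableOn_uIoc (by fun_prop))
            ((MeasureTheory.ae_restrict_mem measurableSet_uIoc).mono fun τ hτ => ?_)
          have hmem : τ ∈ Icc a b := uIcc_subset_Icc t₀.2 t.2 (uIoc_subset_uIcc hτ)
          rw [IccExtend_of_mem _ _ hmem]
          calc ‖A ⟨τ, hmem⟩ (α ⟨τ, hmem⟩)‖
              ≤ ‖A‖ * ((‖A‖ * |τ - t₀|) ^ k / k ! * ‖β‖) :=
                (A _).le_of_opNorm_le_of_le (A.norm_coe_le_norm _) (ih ⟨τ, hmem⟩)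
            _ = _ := by ring
      _ = (‖A‖ * |(t : ℝ) - t₀|) ^ (k + 1) / (k + 1)! * ‖β‖ := by
          rw [MeasureTheory.integral_const_mul, integral_pow_abs_sub_uIoc, Nat.factorial_succ]
          push_cast
          field_simp
          ring

/-- Volterra operators are quasi-nilpotent. -/
lemma isUnit_one_sub_volterra_comp [CompleteSpace E] (t₀ : Icc a b) (A : C(Icc a b, E →L[ℝ] E)) :
    IsUnit (1 - (volterra t₀).comp (pointwiseApply _ E E A)) := by
  set V := (volterra t₀).comp (pointwiseApply _ E E A)
  have hab : a ≤ b := t₀.2.1.trans t₀.2.2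
  obtain ⟨k, hk⟩ := ((FloorSemiring.tendsto_pow_div_factorial_atTop
    (‖A‖ * (b - a))).eventually_lt_const one_pos).exists
  have hnorm : ‖V ^ k‖ < 1 := by
    refine (ContinuousLinearMap.opNorm_le_bound _ ?_ fun β => ?_).trans_lt hk
    · have := sub_nonneg.2 hab
      positivity
    refine (ContinuousMap.norm_le _ ?_).2 fun t => ?_
    · have := sub_nonneg.2 hab
      positivity
    refine (norm_volterra_comp_pow_apply_le t₀ A β k t).trans ?_
    gcongr
    exact abs_sub_le_of_le_of_le t.2.1 t.2.2 t₀.2.1 t₀.2.2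
  have hfactor : (1 - V) * ∑ i ∈ Finset.range k, V ^ i = 1 - V ^ k := mul_neg_geom_sum V k
  have hcomm : Commute (1 - V) (∑ i ∈ Finset.range k, V ^ i) :=
    Commute.sum_right _ _ _ fun i _ =>
      (Commute.one_left _).sub_left ((Commute.refl V).pow_right i)
  have hpow : IsUnit (1 - V ^ k) :=
    isUnit_one_sub_of_norm_lt_one (R := C(Icc a b, E) →L[ℝ] C(Icc a b, E)) hnorm
  exact (hcomm.isUnit_mul_iff.1 (hfactor ▸ hpow)).1

end Volterra

section Flow

open Set Topology

universe u

variable {a b : ℝ} {E : Type u} [NormedAddCommGroup E] [NormedSpace ℝ E]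

/-- The nonlinear operator `α ↦ α - ∫ f ∘ α`. The integral curves of `f` are the curves which it
maps to a constant, namely to their value at time `t₀`. -/
def integralDefect (t₀ : Icc a b) (f : C(E, E)) (α : C(Icc a b, E)) : C(Icc a b, E) :=
  α - volterra t₀ (f.comp α)

lemma integralDefect_eq_const_iff {t₀ : Icc a b} {f : C(E, E)} {α : C(Icc a b, E)} {z : E} :
    integralDefect t₀ f α = ContinuousMap.const _ z ↔
      α = ContinuousMap.const _ z + volterra t₀ (f.comp α) := sub_eq_iff_eq_add

lemma contDiff_integralDefect (t₀ : Icc a b) {f : C(E, E)} (hf : ContDiff ℝ ∞ f) :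
    ContDiff ℝ ∞ (integralDefect t₀ f) :=
  contDiff_id.sub ((volterra t₀).contDiff.comp (contDiff_superposition hf))

lemma contDiff_bump_smul [HasContDiffBump E] {F : Type*} [NormedAddCommGroup F]
    [NormedSpace ℝ F] {z₀ : E} (χ : ContDiffBump z₀) {f : E → F}
    (hf : ∀ z ∈ Metric.closedBall z₀ χ.rOut, ContDiffAt ℝ ∞ f z) :
    ContDiff ℝ ∞ (fun z => χ z • f z) := by
  rw [contDiff_iff_contDiffAt]
  intro z
  by_cases hz : z ∈ Metric.closedBall z₀ χ.rOut
  · exact χ.contDiffAt.smul (hf z hz)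
  · refine (contDiffAt_const (c := (0 : F))).congr_of_eventuallyEq ?_
    filter_upwards [Metric.isClosed_closedBall.isOpen_compl.mem_nhds hz] with w hw
    rw [χ.zero_of_le_dist (by simpa using hw : χ.rOut < dist w z₀).le, zero_smul]

variable [CompleteSpace E]

lemma exists_equiv_hasFDerivAt_integralDefect (t₀ : Icc a b) {f : C(E, E)}
    (hf : ContDiff ℝ ∞ f) (α : C(Icc a b, E)) :
    ∃ L : C(Icc a b, E) ≃L[ℝ] C(Icc a b, E),
      HasFDerivAt (integralDefect t₀ f) (L : C(Icc a b, E) →L[ℝ] C(Icc a b, E)) α := by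
  let f' : C(E, E →L[ℝ] E) := ⟨fderiv ℝ f, hf.continuous_fderiv (by simp)⟩
  obtain ⟨u, hu⟩ := isUnit_one_sub_volterra_comp t₀ (f'.comp α)
  refine ⟨ContinuousLinearEquiv.ofUnit u, ?_⟩
  have hfα : HasFDerivAt (fun β : C(Icc a b, E) => f.comp β)
      (pointwiseApply _ E E (f'.comp α)) α :=
    hasFDerivAt_superposition (f' := f') (fun x => (hf.differentiable (by simp) x).hasFDerivAt) α
  have hdefect := (hasFDerivAt_id α).sub ((volterra t₀).hasFDerivAt.comp α hfα)
  exact hdefect.congr_fderiv hu.symm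

/-- The solutions are the preimages of constants under the integral defect, which is a local
diffeomorphism by quasi-nilpotency of the Volterra operator. -/
theorem exists_contDiffAt_solution {t₀ : Icc a b} {f : C(E, E)} (hf : ContDiff ℝ ∞ f) {z₀ : E}
    {α₀ : C(Icc a b, E)} (hα₀ : α₀ = ContinuousMap.const _ z₀ + volterra t₀ (f.comp α₀)) :
    ∃ S : E → C(Icc a b, E), S z₀ = α₀ ∧ ∀ᶠ z in 𝓝 z₀, ContDiffAt ℝ ∞ S z ∧
      S z = ContinuousMap.const _ z + volterra t₀ (f.comp (S z)) := by
  have hT := contDiff_integralDefect t₀ hf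
  obtain ⟨L, hL⟩ := exists_equiv_hasFDerivAt_integralDefect t₀ hf α₀
  let T := hT.contDiffAt.toOpenPartialHomeomorph _ hL (by simp)
  let const : E →L[ℝ] C(Icc a b, E) := ContinuousLinearMap.const ℝ (Icc a b)
  have hz₀ : const z₀ = T α₀ := (integralDefect_eq_const_iff.2 hα₀).symm
  refine ⟨T.symm ∘ const, ?_, ?_⟩
  · rw [Function.comp_apply, hz₀]
    exact T.left_inv (hT.contDiffAt.mem_toOpenPartialHomeomorph_source hL (by simp))
  have htarget : ∀ᶠ z in 𝓝 z₀, const z ∈ T.target := by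
    refine const.continuous.continuousAt (T.open_target.mem_nhds ?_)
    rw [hz₀]
    exact hT.contDiffAt.image_mem_toOpenPartialHomeomorph_target hL (by simp)
  filter_upwards [htarget] with z hz
  obtain ⟨L', hL'⟩ := exists_equiv_hasFDerivAt_integralDefect t₀ hf (T.symm (const z))
  exact ⟨(T.contDiffAt_symm hz hL' hT.contDiffAt).comp z const.contDiff.contDiffAt,
    integralDefect_eq_const_iff.1 (T.right_inv hz)⟩

theorem exists_smooth_flow_near_zero [HasContDiffBump E] {f : E → E} {z₀ : E} (hz₀ : f z₀ = 0)
    {U : Set E} (hU : U ∈ 𝓝 z₀) (hf : ∀ z ∈ U, ContDiffAt ℝ ∞ f z) (t₀ : Icc a b) :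
    ∃ S : E → ℝ → E, ∀ᶠ z in 𝓝 z₀, S z t₀ = z ∧ ∀ t ∈ Ioo a b,
      S z t ∈ U ∧ HasDerivAt (S z) (f (S z t)) t ∧ ContDiffAt ℝ ∞ (fun w => S w t) z := by
  have hab : a ≤ b := t₀.2.1.trans t₀.2.2
  obtain ⟨ρ, hρ, hball⟩ := Metric.nhds_basis_closedBall.mem_iff.1 hU
  let χ : ContDiffBump z₀ := ⟨ρ / 2, ρ, half_pos hρ, half_lt_self hρ⟩
  have hcut : ContDiff ℝ ∞ (fun z => χ z • f z) := contDiff_bump_smul χ fun z hz => hf z (hball hz)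
  let fχ : C(E, E) := ⟨fun z => χ z • f z, hcut.continuous⟩
  have hconst : ContinuousMap.const (Icc a b) z₀ =
      ContinuousMap.const _ z₀ + volterra t₀ (fχ.comp (ContinuousMap.const _ z₀)) := by
    have hzero : fχ.comp (ContinuousMap.const (Icc a b) z₀) = 0 := by
      ext
      simp [fχ, hz₀]
    rw [hzero, map_zero, add_zero]
  obtain ⟨S, hSz₀, hS⟩ := exists_contDiffAt_solution (f := fχ) hcut hconst
  have hclose : ∀ᶠ z in 𝓝 z₀, dist (S z) (S z₀) < ρ / 2 :=
    Metric.continuousAt_iff'.1 hS.self_of_nhds.1.continuousAt _ (half_pos hρ)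
  refine ⟨fun z => IccExtend hab (S z), ?_⟩
  filter_upwards [hS, hclose] with z ⟨hsmooth, hsol⟩ hz
  refine ⟨?_, fun t ht => ?_⟩
  · rw [IccExtend_val, hsol]
    simp [volterra_apply]
  have hdist : dist (IccExtend hab (S z) t) z₀ < ρ / 2 := by
    rw [hSz₀] at hz
    exact (ContinuousMap.dist_apply_le_dist (f := S z) (g := ContinuousMap.const _ z₀) _).trans_lt
      hz
  have hderiv := hasDerivAt_of_eq_const_add_volterra hsol ht
  have hχ : IccExtend hab (fχ.comp (S z)) t = f (IccExtend hab (S z) t) := by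
    change χ (IccExtend hab (S z) t) • f _ = _
    rw [χ.one_of_mem_closedBall hdist.le, one_smul]
    rfl
  refine ⟨hball (hdist.le.trans (half_le_self hρ.le)), hχ ▸ hderiv, ?_⟩
  exact (ContinuousMap.evalCLM ℝ (projIcc a b hab t)).contDiff.contDiffAt.comp z hsmooth

end Flow

section Connection

open Topology

variable {E F H : Type*} [NormedAddCommGroup E] [NormedSpace ℝ E]
  [NormedAddCommGroup F] [NormedSpace ℝ F] [NormedAddCommGroup H] [NormedSpace ℝ H]

lemma fderiv_apply_apply_const {A : E → E →L[ℝ] E →L[ℝ] H} {y : E}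
    (hA : DifferentiableAt ℝ A y) (u v w : E) :
    fderiv ℝ (fun p => A p v w) y u = fderiv ℝ A y u v w := by
  rw [((hA.hasFDerivAt.clm_apply (hasFDerivAt_const v y)).clm_apply (hasFDerivAt_const w y)).fderiv]
  simp

lemma fderiv_apply_apply_comp {A : E → E →L[ℝ] E →L[ℝ] H} {Φ X Y : F → E} {q : F}
    (hA : DifferentiableAt ℝ A (Φ q)) (hΦ : DifferentiableAt ℝ Φ q)
    (hX : DifferentiableAt ℝ X q) (hY : DifferentiableAt ℝ Y q) (a : F) :
    fderiv ℝ (fun p => A (Φ p) (X p) (Y p)) q a =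
      fderiv ℝ A (Φ q) (fderiv ℝ Φ q a) (X q) (Y q) + A (Φ q) (fderiv ℝ X q a) (Y q)
        + A (Φ q) (X q) (fderiv ℝ Y q a) := by
  have hAΦ : HasFDerivAt (fun p => A (Φ p)) ((fderiv ℝ A (Φ q)).comp (fderiv ℝ Φ q)) q :=
    HasFDerivAt.comp (g := A) q hA.hasFDerivAt hΦ.hasFDerivAt
  rw [((hAΦ.clm_apply hX.hasFDerivAt).clm_apply hY.hasFDerivAt).fderiv]
  simp only [add_apply, ContinuousLinearMap.comp_apply, ContinuousLinearMap.flip_apply]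
  abel

lemma contDiffAt_apply_apply_comp {A : E → E →L[ℝ] E →L[ℝ] H} {Φ X Y : F → E} {q : F}
    (hA : ContDiffAt ℝ ∞ A (Φ q)) (hΦ : ContDiffAt ℝ ∞ Φ q)
    (hX : ContDiffAt ℝ ∞ X q) (hY : ContDiffAt ℝ ∞ Y q) :
    ContDiffAt ℝ ∞ (fun p => A (Φ p) (X p) (Y p)) q :=
  ((hA.comp q hΦ).clm_apply hX).clm_apply hY

lemma contDiffAt_fderiv_apply {V : F → H} {q : F} (hV : ContDiffAt ℝ ∞ V q) (a : F) :
    ContDiffAt ℝ ∞ (fun p => fderiv ℝ V p a) q :=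
  (hV.fderiv_right (m := ∞) (by simp)).clm_apply contDiffAt_const

lemma fderiv_fderiv_apply {V : F → H} {q : F} (hV : ContDiffAt ℝ ∞ V q) (a b : F) :
    fderiv ℝ (fun p => fderiv ℝ V p a) q b = fderiv ℝ (fderiv ℝ V) q b a := by
  rw [(((hV.fderiv_right (m := ∞) (by simp)).differentiableAt (by simp)).hasFDerivAt.clm_apply
    (hasFDerivAt_const a q)).fderiv]
  simp

lemma fderiv_fderiv_comm {V : F → H} {q : F} (hV : ContDiffAt ℝ ∞ V q) (a b : F) :
    fderiv ℝ (fderiv ℝ V) q a b = fderiv ℝ (fderiv ℝ V) q b a :=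
  (hV.isSymmSndFDerivAt (by simpa using ENat.LEInfty.out)) a b

/-- The curvature `R(v, w) z` of the connection with Christoffel symbols `Γ`. -/
def curv (Γ : E → E →L[ℝ] E →L[ℝ] E) (y v w z : E) : E :=
  fderiv ℝ Γ y v w z - fderiv ℝ Γ y w v z + Γ y v (Γ y w z) - Γ y w (Γ y v z)

/-- The covariant derivative in direction `a` of the vector field `V` along the map `Φ`, for the
connection with Christoffel symbols `Γ`. -/
def cov (Γ : E → E →L[ℝ] E →L[ℝ] E) (Φ : F → E) (a : F) (V : F → E) (q : F) : E :=
  fderiv ℝ V q a + Γ (Φ q) (fderiv ℝ Φ q a) (V q)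

variable {Γ : E → E →L[ℝ] E →L[ℝ] E} {Φ V W : F → E} {q : F}

lemma curv_skew_left (y v w z : E) : curv Γ y v w z = -curv Γ y w v z := by
  simp only [curv]
  abel

lemma contDiffAt_cov (hΓ : ContDiffAt ℝ ∞ Γ (Φ q)) (hΦ : ContDiffAt ℝ ∞ Φ q)
    (hV : ContDiffAt ℝ ∞ V q) (a : F) : ContDiffAt ℝ ∞ (cov Γ Φ a V) q :=
  (contDiffAt_fderiv_apply hV a).add
    (contDiffAt_apply_apply_comp hΓ hΦ (contDiffAt_fderiv_apply hΦ a) hV)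

lemma cov_congr (h : V =ᶠ[𝓝 q] W) (a : F) : cov Γ Φ a V q = cov Γ Φ a W q := by
  simp only [cov, h.fderiv_eq, h.self_of_nhds]

lemma cov_fderiv_comm (hΓ : ∀ v w, Γ (Φ q) v w = Γ (Φ q) w v) (hΦ : ContDiffAt ℝ ∞ Φ q)
    (a b : F) :
    cov Γ Φ a (fun p => fderiv ℝ Φ p b) q = cov Γ Φ b (fun p => fderiv ℝ Φ p a) q := by
  simp only [cov]
  rw [fderiv_fderiv_apply hΦ, fderiv_fderiv_apply hΦ, fderiv_fderiv_comm hΦ, hΓ]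

lemma fderiv_cov (hΓ : ContDiffAt ℝ ∞ Γ (Φ q)) (hΦ : ContDiffAt ℝ ∞ Φ q)
    (hV : ContDiffAt ℝ ∞ V q) (a b : F) :
    fderiv ℝ (cov Γ Φ b V) q a = fderiv ℝ (fderiv ℝ V) q a b +
      (fderiv ℝ Γ (Φ q) (fderiv ℝ Φ q a) (fderiv ℝ Φ q b) (V q) +
        Γ (Φ q) (fderiv ℝ (fderiv ℝ Φ) q a b) (V q) +
        Γ (Φ q) (fderiv ℝ Φ q b) (fderiv ℝ V q a)) := by
  have hΦb := contDiffAt_fderiv_apply hΦ b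
  have hadd : fderiv ℝ (cov Γ Φ b V) q = fderiv ℝ (fun p => fderiv ℝ V p b) q +
      fderiv ℝ (fun p => Γ (Φ p) (fderiv ℝ Φ p b) (V p)) q :=
    fderiv_add ((contDiffAt_fderiv_apply hV b).differentiableAt (by simp))
      ((contDiffAt_apply_apply_comp hΓ hΦ hΦb hV).differentiableAt (by simp))
  rw [hadd, add_apply, fderiv_fderiv_apply hV,
    fderiv_apply_apply_comp (hΓ.differentiableAt (by simp)) (hΦ.differentiableAt (by simp))
      (hΦb.differentiableAt (by simp)) (hV.differentiableAt (by simp)), fderiv_fderiv_apply hΦ]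

lemma cov_cov_sub (hΓ : ContDiffAt ℝ ∞ Γ (Φ q)) (hΦ : ContDiffAt ℝ ∞ Φ q)
    (hV : ContDiffAt ℝ ∞ V q) (a b : F) :
    cov Γ Φ a (cov Γ Φ b V) q - cov Γ Φ b (cov Γ Φ a V) q =
      curv Γ (Φ q) (fderiv ℝ Φ q a) (fderiv ℝ Φ q b) (V q) := by
  have hcov : ∀ a b : F, cov Γ Φ a (cov Γ Φ b V) q = fderiv ℝ (cov Γ Φ b V) q a +
      (Γ (Φ q) (fderiv ℝ Φ q a) (fderiv ℝ V q b) +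
        Γ (Φ q) (fderiv ℝ Φ q a) (Γ (Φ q) (fderiv ℝ Φ q b) (V q))) := fun a b => by
    simp only [cov, map_add]
  rw [hcov, hcov, fderiv_cov hΓ hΦ hV, fderiv_cov hΓ hΦ hV, fderiv_fderiv_comm hV a b,
    fderiv_fderiv_comm hΦ a b, curv]
  abel

end Connection

lemma pair_symm_of_skew_of_cyclic {α : Type*} {R : α → α → α → α → ℝ}
    (hskew : ∀ v w z u, R v w z u = -R w v z u) (hskew' : ∀ v w z u, R v w z u = -R v w u z)
    (hcyclic : ∀ v w z u, R v w z u + R w z v u + R z v w u = 0) (v w z u : α) :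
    R v w z u = R z u v w := by
  grind

section LeviCivita

open Topology

variable {E F : Type*} [NormedAddCommGroup E] [NormedSpace ℝ E]
  [NormedAddCommGroup F] [NormedSpace ℝ F]

/-- `Γ` is the Levi-Civita connection, in the form of its Christoffel symbols, of the smooth
Riemannian metric `G` on the open set `U` of a vector space. -/
structure IsLeviCivitaOn (G : E → E →L[ℝ] E →L[ℝ] ℝ) (Γ : E → E →L[ℝ] E →L[ℝ] E)
    (U : Set E) : Prop where
  isOpen : IsOpen U
  metric_contDiffAt : ∀ y ∈ U, ContDiffAt ℝ ∞ G y
  conn_contDiffAt : ∀ y ∈ U, ContDiffAt ℝ ∞ Γ y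
  metric_symm : ∀ y ∈ U, ∀ v w, G y v w = G y w v
  metric_pos : ∀ y ∈ U, ∀ v, v ≠ 0 → 0 < G y v v
  conn_symm : ∀ y ∈ U, ∀ v w, Γ y v w = Γ y w v
  compat : ∀ y ∈ U, ∀ u v w,
    fderiv ℝ G y u v w = G y (Γ y u v) w + G y v (Γ y u w)

namespace IsLeviCivitaOn

variable {G : E → E →L[ℝ] E →L[ℝ] ℝ} {Γ : E → E →L[ℝ] E →L[ℝ] E} {U : Set E}

lemma differentiableAt_metric (h : IsLeviCivitaOn G Γ U) {y : E} (hy : y ∈ U) :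
    DifferentiableAt ℝ G y :=
  (h.metric_contDiffAt y hy).differentiableAt (by simp)

lemma fderiv_metric_cov (h : IsLeviCivitaOn G Γ U) {Φ V W : F → E} {q : F} (hq : Φ q ∈ U)
    (hΦ : ContDiffAt ℝ ∞ Φ q) (hV : ContDiffAt ℝ ∞ V q) (hW : ContDiffAt ℝ ∞ W q) (a : F) :
    fderiv ℝ (fun p => G (Φ p) (V p) (W p)) q a =
      G (Φ q) (cov Γ Φ a V q) (W q) + G (Φ q) (V q) (cov Γ Φ a W q) := by
  rw [fderiv_apply_apply_comp (h.differentiableAt_metric hq)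
    (hΦ.differentiableAt (by simp)) (hV.differentiableAt (by simp))
    (hW.differentiableAt (by simp)), h.compat _ hq]
  simp only [cov, map_add, add_apply]
  ring

lemma fderiv_conn_symm (h : IsLeviCivitaOn G Γ U) {y : E} (hy : y ∈ U) (u v w : E) :
    fderiv ℝ Γ y u v w = fderiv ℝ Γ y u w v := by
  have hΓ := (h.conn_contDiffAt y hy).differentiableAt (by simp)
  have hsymm : (fun p => Γ p v w) =ᶠ[𝓝 y] fun p => Γ p w v := by
    filter_upwards [h.isOpen.mem_nhds hy] with p hp using h.conn_symm p hp v w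
  rw [← fderiv_apply_apply_const hΓ, ← fderiv_apply_apply_const hΓ, hsymm.fderiv_eq]

lemma curv_bianchi (h : IsLeviCivitaOn G Γ U) {y : E} (hy : y ∈ U) (u v w : E) :
    curv Γ y u v w + curv Γ y v w u + curv Γ y w u v = 0 := by
  simp only [curv]
  rw [h.fderiv_conn_symm hy u w v, h.fderiv_conn_symm hy v w u, h.fderiv_conn_symm hy w v u,
    h.conn_symm y hy w v, h.conn_symm y hy v u, h.conn_symm y hy w u]
  abel

lemma fderiv_fderiv_metric (h : IsLeviCivitaOn G Γ U) {y : E} (hy : y ∈ U) (v w z u : E) :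
    fderiv ℝ (fderiv ℝ fun p => G p z u) y v w =
      G y (cov Γ id v (cov Γ id w fun _ => z) y) u + G y (Γ y w z) (Γ y v u) +
        (G y (Γ y v z) (Γ y w u) + G y z (cov Γ id v (cov Γ id w fun _ => u) y)) := by
  have hconst : ∀ (p : E) (a x : E), cov Γ id a (fun _ => x) p = Γ p a x := fun p a x => by
    simp [cov]
  have hcov : ∀ x : E, ContDiffAt ℝ ∞ (cov Γ id w fun _ => x) y := fun x =>
    contDiffAt_cov (h.conn_contDiffAt y hy) contDiffAt_id contDiffAt_const w
  have hG : ContDiffAt ℝ ∞ (fun p => G p z u) y :=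
    contDiffAt_apply_apply_comp (Φ := id) (h.metric_contDiffAt y hy) contDiffAt_id
      contDiffAt_const contDiffAt_const
  have hfirst : (fun p => fderiv ℝ (fun p => G p z u) p w) =ᶠ[𝓝 y]
      (fun p => G (id p) (cov Γ id w (fun _ => z) p) u) +
        fun p => G (id p) z (cov Γ id w (fun _ => u) p) := by
    filter_upwards [h.isOpen.mem_nhds hy] with p hp
    exact h.fderiv_metric_cov (Φ := id) hp contDiffAt_id contDiffAt_const contDiffAt_const w
  have hdiff : ∀ {V W : E → E}, ContDiffAt ℝ ∞ V y → ContDiffAt ℝ ∞ W y →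
      DifferentiableAt ℝ (fun p => G (id p) (V p) (W p)) y := fun hV hW =>
    (contDiffAt_apply_apply_comp (h.metric_contDiffAt y hy) contDiffAt_id hV hW).differentiableAt
      (by simp)
  rw [← fderiv_fderiv_apply hG, hfirst.fderiv_eq,
    fderiv_add (hdiff (hcov z) contDiffAt_const) (hdiff contDiffAt_const (hcov u)), add_apply,
    h.fderiv_metric_cov (by exact hy) contDiffAt_id (hcov z) contDiffAt_const,
    h.fderiv_metric_cov (by exact hy) contDiffAt_id contDiffAt_const (hcov u)]
  simp only [hconst, id]

lemma metric_curv_skew_right (h : IsLeviCivitaOn G Γ U) {y : E} (hy : y ∈ U) (v w z u : E) :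
    G y (curv Γ y v w z) u = -G y z (curv Γ y v w u) := by
  have hcurv : ∀ x : E, curv Γ y v w x = cov Γ id v (cov Γ id w fun _ => x) y -
      cov Γ id w (cov Γ id v fun _ => x) y := fun x => by
    simpa using (cov_cov_sub (Φ := id) (V := fun _ => x) (h.conn_contDiffAt y hy) contDiffAt_id
      contDiffAt_const v w).symm
  have hsecond := fderiv_fderiv_comm (contDiffAt_apply_apply_comp (Φ := id)
    (h.metric_contDiffAt y hy) contDiffAt_id (contDiffAt_const (c := z))
    (contDiffAt_const (c := u))) v w
  simp only [id] at hsecond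
  rw [h.fderiv_fderiv_metric hy, h.fderiv_fderiv_metric hy] at hsecond
  simp only [hcurv, map_sub, sub_apply]
  linarith

lemma metric_curv_pair_symm (h : IsLeviCivitaOn G Γ U) {y : E} (hy : y ∈ U) (v w z u : E) :
    G y (curv Γ y v w z) u = G y (curv Γ y z u v) w := by
  refine pair_symm_of_skew_of_cyclic (R := fun v w z u => G y (curv Γ y v w z) u)
    (fun v w z u => ?_) (fun v w z u => ?_) (fun v w z u => ?_) v w z u
  · rw [curv_skew_left, map_neg, neg_apply]
  · rw [h.metric_curv_skew_right hy, h.metric_symm y hy]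
  · simpa using congrArg (fun x => G y x u) (h.curv_bianchi hy v w z)

lemma eq_zero_of_metric (h : IsLeviCivitaOn G Γ U) {y : E} (hy : y ∈ U) {v : E}
    (hv : ∀ w, G y v w = 0) : v = 0 := by
  by_contra hne
  exact (h.metric_pos y hy v hne).ne' (hv v)

section ChangeOfCoordinates

variable {G₁ : E → E →L[ℝ] E →L[ℝ] ℝ} {Γ₁ : E → E →L[ℝ] E →L[ℝ] E} {U₁ : Set E} {ψ : E → E}

lemma fderiv_metric_of_isometry (h₁ : IsLeviCivitaOn G₁ Γ₁ U₁) {y : E}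
    (hG : DifferentiableAt ℝ G y) (hψy : ψ y ∈ U₁) (hψ : ContDiffAt ℝ ∞ ψ y)
    (hiso : ∀ᶠ p in 𝓝 y, ∀ v w, G p v w = G₁ (ψ p) (fderiv ℝ ψ p v) (fderiv ℝ ψ p w))
    (u v w : E) :
    fderiv ℝ G y u v w =
      G₁ (ψ y) (fderiv ℝ (fderiv ℝ ψ) y u v + Γ₁ (ψ y) (fderiv ℝ ψ y u) (fderiv ℝ ψ y v))
        (fderiv ℝ ψ y w) +
      G₁ (ψ y) (fderiv ℝ ψ y v)
        (fderiv ℝ (fderiv ℝ ψ) y u w + Γ₁ (ψ y) (fderiv ℝ ψ y u) (fderiv ℝ ψ y w)) := by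
  have hpull : (fun p => G p v w) =ᶠ[𝓝 y]
      fun p => G₁ (ψ p) (fderiv ℝ ψ p v) (fderiv ℝ ψ p w) := by
    filter_upwards [hiso] with p hp using hp v w
  rw [← fderiv_apply_apply_const hG, hpull.fderiv_eq,
    h₁.fderiv_metric_cov hψy hψ (contDiffAt_fderiv_apply hψ v) (contDiffAt_fderiv_apply hψ w)]
  simp only [cov, fderiv_fderiv_apply hψ]

/-- The difference of the two sides is symmetric in `v, w` and, paired with a third vector, skew in
the last two arguments; hence it vanishes. -/
lemma fderiv_conn_of_isometry (h : IsLeviCivitaOn G Γ U) (h₁ : IsLeviCivitaOn G₁ Γ₁ U₁) {y : E}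
    (hy : y ∈ U) (hψy : ψ y ∈ U₁) (hψ : ContDiffAt ℝ ∞ ψ y)
    (hsurj : Function.Surjective (fderiv ℝ ψ y))
    (hiso : ∀ᶠ p in 𝓝 y, ∀ v w, G p v w = G₁ (ψ p) (fderiv ℝ ψ p v) (fderiv ℝ ψ p w))
    (v w : E) :
    fderiv ℝ ψ y (Γ y v w) =
      Γ₁ (ψ y) (fderiv ℝ ψ y v) (fderiv ℝ ψ y w) + fderiv ℝ (fderiv ℝ ψ) y v w := by
  set D : E → E → E := fun v w => fderiv ℝ ψ y (Γ y v w) -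
    (Γ₁ (ψ y) (fderiv ℝ ψ y v) (fderiv ℝ ψ y w) + fderiv ℝ (fderiv ℝ ψ) y v w) with hD
  set T : E → E → E → ℝ := fun u v w => G₁ (ψ y) (D u v) (fderiv ℝ ψ y w) with hT
  have hsymm : ∀ u v w, T u v w = T v u w := by
    intro u v w
    simp only [hT, hD]
    rw [h.conn_symm y hy u v, h₁.conn_symm _ hψy, fderiv_fderiv_comm hψ u v]
  have hskew : ∀ u v w, T u v w = -T u w v := by
    intro u v w
    have hcompat := h₁.fderiv_metric_of_isometry (h.differentiableAt_metric hy) hψy hψ hiso u v w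
    rw [h.compat y hy, hiso.self_of_nhds, hiso.self_of_nhds,
      h₁.metric_symm _ hψy (fderiv ℝ ψ y v), h₁.metric_symm _ hψy (fderiv ℝ ψ y v)] at hcompat
    simp only [hT, hD, map_sub, map_add, sub_apply, add_apply] at hcompat ⊢
    linarith
  refine sub_eq_zero.1 (h₁.eq_zero_of_metric hψy fun x => ?_)
  obtain ⟨u, rfl⟩ := hsurj x
  change T v w u = 0
  linarith [hsymm v w u, hskew w v u, hsymm w u v, hskew u w v, hsymm u v w, hskew v u w]

lemma hasDerivAt_parallel_of_isometry (h : IsLeviCivitaOn G Γ U) (h₁ : IsLeviCivitaOn G₁ Γ₁ U₁)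
    {c V : ℝ → E} {t : ℝ} {c' : E}
    (hy : c t ∈ U) (hψy : ψ (c t) ∈ U₁) (hψ : ContDiffAt ℝ ∞ ψ (c t))
    (hsurj : Function.Surjective (fderiv ℝ ψ (c t)))
    (hiso : ∀ᶠ p in 𝓝 (c t), ∀ v w, G p v w = G₁ (ψ p) (fderiv ℝ ψ p v) (fderiv ℝ ψ p w))
    (hc : HasDerivAt c c' t) (hV : HasDerivAt V (-Γ (c t) c' (V t)) t) :
    HasDerivAt (fun τ => fderiv ℝ ψ (c τ) (V τ))
      (-Γ₁ (ψ (c t)) (fderiv ℝ ψ (c t) c') (fderiv ℝ ψ (c t) (V t))) t := by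
  have hψ' : HasDerivAt (fun τ => fderiv ℝ ψ (c τ)) (fderiv ℝ (fderiv ℝ ψ) (c t) c') t :=
    ((hψ.fderiv_right (m := ∞) (by simp)).differentiableAt
      (by simp)).hasFDerivAt.comp_hasDerivAt t hc
  convert hψ'.clm_apply hV using 1
  rw [map_neg, h.fderiv_conn_of_isometry h₁ hy hψy hψ hsurj hiso]
  abel

end ChangeOfCoordinates

end IsLeviCivitaOn

end LeviCivita

section JacobiSystem

open Set

/-- The linear system satisfied in curvature `κ`, along a geodesic with velocity `T` and
`⟨T, T⟩ = ρ`, by `f = ⟨J, K⟩`, `p = f'` and `h = ⟨J', K'⟩`, where `J` and `K` are Jacobi fields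
orthogonal to `T` at time `0` and `θ = ⟨J', T⟩ ⟨K', T⟩`. -/
structure IsJacobiSystem (κ ρ θ : ℝ) (f p h : ℝ → ℝ) : Prop where
  hasDerivAt_fst : ∀ t ∈ Icc (0 : ℝ) 1, HasDerivAt f (p t) t
  hasDerivAt_snd : ∀ t ∈ Icc (0 : ℝ) 1,
    HasDerivAt p (2 * h t - 2 * κ * (ρ * f t - θ * t ^ 2)) t
  hasDerivAt_trd : ∀ t ∈ Icc (0 : ℝ) 1, HasDerivAt h (-κ * (ρ * p t - 2 * θ * t)) t

lemma IsJacobiSystem.eqOn {κ ρ θ : ℝ} {f p h f₁ p₁ h₁ : ℝ → ℝ} (hs : IsJacobiSystem κ ρ θ f p h)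
    (hs₁ : IsJacobiSystem κ ρ θ f₁ p₁ h₁) (hf : f 0 = f₁ 0) (hp : p 0 = p₁ 0) (hh : h 0 = h₁ 0) :
    EqOn f f₁ (Icc 0 1) := by
  let L : ℝ × ℝ × ℝ →L[ℝ] ℝ × ℝ × ℝ := LinearMap.toContinuousLinearMap
    { toFun := fun x => (x.2.1, 2 * x.2.2 - 2 * κ * (ρ * x.1), -κ * (ρ * x.2.1))
      map_add' := fun x y => by ext <;> simp <;> ring
      map_smul' := fun c x => by ext <;> simp <;> ring }
  have hL : ∀ x, L x = (x.2.1, 2 * x.2.2 - 2 * κ * (ρ * x.1), -κ * (ρ * x.2.1)) := fun _ => rfl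
  set D : ℝ → ℝ × ℝ × ℝ := fun t => (f t - f₁ t, p t - p₁ t, h t - h₁ t) with hD
  have hD' : ∀ t ∈ Icc (0 : ℝ) 1, HasDerivAt D (L (D t)) t := by
    intro t ht
    have := ((hs.hasDerivAt_fst t ht).sub (hs₁.hasDerivAt_fst t ht)).prodMk
      (((hs.hasDerivAt_snd t ht).sub (hs₁.hasDerivAt_snd t ht)).prodMk
        ((hs.hasDerivAt_trd t ht).sub (hs₁.hasDerivAt_trd t ht)))
    refine this.congr_deriv ?_
    rw [hL, hD]
    ext <;> simp only <;> ring
  have hzero : EqOn D (fun _ => 0) (Icc 0 1) :=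
    ODE_solution_unique (v := fun _ => L) (fun _ => L.lipschitz)
      (fun t ht => (hD' t ht).continuousAt.continuousWithinAt)
      (fun t ht => (hD' t (Ico_subset_Icc_self ht)).hasDerivWithinAt) continuousOn_const
      (fun t _ => by simpa using (hasDerivAt_const t (0 : ℝ × ℝ × ℝ)).hasDerivWithinAt)
      (by simp [hD, hf, hp, hh])
  exact fun t ht => sub_eq_zero.1 (congrArg Prod.fst (hzero ht))

lemma eq_of_hasDerivAt_zero {f : ℝ → ℝ} {a b : ℝ} (hf : ∀ t ∈ Icc a b, HasDerivAt f 0 t) {t : ℝ}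
    (ht : t ∈ Icc a b) : f t = f a :=
  constant_of_has_deriv_right_zero (fun s hs => (hf s hs).continuousAt.continuousWithinAt)
    (fun s hs => (hf s (Ico_subset_Icc_self hs)).hasDerivWithinAt) t ht

end JacobiSystem

section JacobiFields

open Topology Set

variable {E F : Type*} [NormedAddCommGroup E] [NormedSpace ℝ E]
  [NormedAddCommGroup F] [NormedSpace ℝ F]

/-- All sectional curvatures of the metric `G` with Christoffel symbols `Γ` are equal to `κ`
on `U`. -/
def HasConstantCurvatureOn (G : E → E →L[ℝ] E →L[ℝ] ℝ) (Γ : E → E →L[ℝ] E →L[ℝ] E) (κ : ℝ)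
    (U : Set E) : Prop :=
  ∀ y ∈ U, ∀ v w, G y (curv Γ y v w w) v = κ * (G y v v * G y w w - G y v w ^ 2)

/-- The velocity field of a family of curves `t ↦ Φ (t, ξ)`. -/
def velocityField (Φ : ℝ × F → E) (q : ℝ × F) : E := fderiv ℝ Φ q (1, 0)

/-- The variation field in direction `a` of a family of curves, a Jacobi field if the curves are
geodesics. -/
def jacobiField (Φ : ℝ × F → E) (a : F) (q : ℝ × F) : E := fderiv ℝ Φ q (0, a)

/-- The covariant derivative of the variation field along the curves. -/
def jacobiFieldDeriv (Γ : E → E →L[ℝ] E →L[ℝ] E) (Φ : ℝ × F → E) (a : F) (q : ℝ × F) : E :=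
  cov Γ Φ (1, 0) (jacobiField Φ a) q

/-- The inner product of two vector fields along the curve with parameter `ξ`. -/
def innerAlong (G : E → E →L[ℝ] E →L[ℝ] ℝ) (Φ : ℝ × F → E) (ξ : F) (V W : ℝ × F → E) (t : ℝ) : ℝ :=
  G (Φ (t, ξ)) (V (t, ξ)) (W (t, ξ))

/-- Near `[0, 1] × {ξ}`, `Φ` is a smooth family of geodesics in `U`. -/
def IsGeodesicFamilyAt (Γ : E → E →L[ℝ] E →L[ℝ] E) (U : Set E) (Φ : ℝ × F → E) (ξ : F) : Prop :=
  ∀ t ∈ Icc (0 : ℝ) 1, Φ (t, ξ) ∈ U ∧ (∀ᶠ p in 𝓝 (t, ξ), ContDiffAt ℝ ∞ Φ p) ∧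
    ∀ᶠ p in 𝓝 (t, ξ), cov Γ Φ (1, 0) (velocityField Φ) p = 0

variable {G : E → E →L[ℝ] E →L[ℝ] ℝ} {Γ : E → E →L[ℝ] E →L[ℝ] E} {U : Set E} {Φ : ℝ × F → E}
  {ξ : F} {t : ℝ}

lemma hasDerivAt_slice {f : ℝ × F → E} (hf : DifferentiableAt ℝ f (t, ξ)) :
    HasDerivAt (fun τ => f (τ, ξ)) (fderiv ℝ f (t, ξ) (1, 0)) t :=
  hf.hasFDerivAt.comp_hasDerivAt (f := fun τ : ℝ => (τ, ξ)) t
    ((hasDerivAt_id t).prodMk (hasDerivAt_const t ξ))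

namespace IsGeodesicFamilyAt

variable (hΦ : IsGeodesicFamilyAt Γ U Φ ξ) (ht : t ∈ Icc (0 : ℝ) 1)
include hΦ ht

lemma contDiffAt : ContDiffAt ℝ ∞ Φ (t, ξ) :=
  (hΦ t ht).2.1.self_of_nhds

lemma contDiffAt_velocityField : ContDiffAt ℝ ∞ (velocityField Φ) (t, ξ) :=
  contDiffAt_fderiv_apply (hΦ.contDiffAt ht) _

lemma contDiffAt_jacobiField (a : F) : ContDiffAt ℝ ∞ (jacobiField Φ a) (t, ξ) :=
  contDiffAt_fderiv_apply (hΦ.contDiffAt ht) _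

lemma cov_velocityField : cov Γ Φ (1, 0) (velocityField Φ) (t, ξ) = 0 :=
  (hΦ t ht).2.2.self_of_nhds

end IsGeodesicFamilyAt

namespace IsLeviCivitaOn

variable (h : IsLeviCivitaOn G Γ U)
include h

lemma metric_curv_of_hasConstantCurvatureOn {κ : ℝ} (hκ : HasConstantCurvatureOn G Γ κ U) {y : E}
    (hy : y ∈ U) (v w u : E) :
    G y (curv Γ y v w w) u = κ * (G y v u * G y w w - G y v w * G y u w) := by
  have hadd : curv Γ y (v + u) w w = curv Γ y v w w + curv Γ y u w w := by
    simp only [curv, map_add, add_apply]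
    abel
  have hsymm : G y (curv Γ y u w w) v = G y (curv Γ y v w w) u := by
    rw [h.metric_curv_pair_symm hy, curv_skew_left, h.metric_curv_skew_right hy v w w u,
      map_neg, neg_apply, h.metric_symm y hy w, curv_skew_left, map_neg, neg_apply]
  have hpolar := hκ y hy (v + u) w
  simp only [hadd, map_add, add_apply, h.metric_symm y hy u v] at hpolar
  linarith [hκ y hy v w, hκ y hy u w]

variable (hΦ : IsGeodesicFamilyAt Γ U Φ ξ) (ht : t ∈ Icc (0 : ℝ) 1)
include hΦ ht

lemma contDiffAt_jacobiFieldDeriv (a : F) : ContDiffAt ℝ ∞ (jacobiFieldDeriv Γ Φ a) (t, ξ) :=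
  contDiffAt_cov (h.conn_contDiffAt _ (hΦ t ht).1) (hΦ.contDiffAt ht)
    (hΦ.contDiffAt_jacobiField ht a) _

lemma cov_jacobiFieldDeriv (a : F) :
    cov Γ Φ (1, 0) (jacobiFieldDeriv Γ Φ a) (t, ξ) =
      -curv Γ (Φ (t, ξ)) (jacobiField Φ a (t, ξ)) (velocityField Φ (t, ξ))
        (velocityField Φ (t, ξ)) := by
  obtain ⟨hq, hsmooth, hgeo⟩ := hΦ t ht
  have hcomm : jacobiFieldDeriv Γ Φ a =ᶠ[𝓝 (t, ξ)] cov Γ Φ (0, a) (velocityField Φ) := by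
    filter_upwards [hsmooth, (hΦ.contDiffAt ht).continuousAt.eventually_mem
      (h.isOpen.mem_nhds hq)] with p hp hpU using cov_fderiv_comm (h.conn_symm _ hpU) hp _ _
  have hzero : cov Γ Φ (0, a) (cov Γ Φ (1, 0) (velocityField Φ)) (t, ξ) = 0 := by
    rw [cov_congr (W := fun _ => 0) hgeo]
    simp [cov]
  have hcurv := cov_cov_sub (h.conn_contDiffAt _ hq) (hΦ.contDiffAt ht)
    (hΦ.contDiffAt_velocityField ht) (1, 0) (0, a)
  rw [hzero, sub_zero] at hcurv
  rw [cov_congr hcomm, ← curv_skew_left]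
  exact hcurv

lemma hasDerivAt_innerAlong {V W : ℝ × F → E} (hV : ContDiffAt ℝ ∞ V (t, ξ))
    (hW : ContDiffAt ℝ ∞ W (t, ξ)) :
    HasDerivAt (innerAlong G Φ ξ V W)
      (innerAlong G Φ ξ (cov Γ Φ (1, 0) V) W t + innerAlong G Φ ξ V (cov Γ Φ (1, 0) W) t) t := by
  have hq := (hΦ t ht).1
  simp only [innerAlong]
  rw [← h.fderiv_metric_cov hq (hΦ.contDiffAt ht) hV hW]
  exact hasDerivAt_slice ((contDiffAt_apply_apply_comp (h.metric_contDiffAt _ hq)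
    (hΦ.contDiffAt ht) hV hW).differentiableAt (by simp))

lemma innerAlong_comm (V W : ℝ × F → E) : innerAlong G Φ ξ V W t = innerAlong G Φ ξ W V t :=
  h.metric_symm _ (hΦ t ht).1 _ _

lemma innerAlong_velocityField_eq :
    innerAlong G Φ ξ (velocityField Φ) (velocityField Φ) t =
      innerAlong G Φ ξ (velocityField Φ) (velocityField Φ) 0 := by
  refine eq_of_hasDerivAt_zero (fun s hs => ?_) ht
  have hder := h.hasDerivAt_innerAlong hΦ hs (hΦ.contDiffAt_velocityField hs)
    (hΦ.contDiffAt_velocityField hs)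
  refine hder.congr_deriv ?_
  simp [innerAlong, hΦ.cov_velocityField hs]

variable {κ : ℝ} (hκ : HasConstantCurvatureOn G Γ κ U)
include hκ

lemma innerAlong_cov_jacobiFieldDeriv (a : F) (V : ℝ × F → E) :
    innerAlong G Φ ξ (cov Γ Φ (1, 0) (jacobiFieldDeriv Γ Φ a)) V t =
      -κ * (innerAlong G Φ ξ (velocityField Φ) (velocityField Φ) 0 *
          innerAlong G Φ ξ (jacobiField Φ a) V t -
        innerAlong G Φ ξ (jacobiField Φ a) (velocityField Φ) t *
          innerAlong G Φ ξ V (velocityField Φ) t) := by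
  rw [← h.innerAlong_velocityField_eq hΦ ht]
  simp only [innerAlong]
  rw [h.cov_jacobiFieldDeriv hΦ ht, map_neg, neg_apply,
    h.metric_curv_of_hasConstantCurvatureOn hκ (hΦ t ht).1]
  ring

lemma innerAlong_jacobiFieldDeriv_velocityField (a : F) :
    innerAlong G Φ ξ (jacobiFieldDeriv Γ Φ a) (velocityField Φ) t =
      innerAlong G Φ ξ (jacobiFieldDeriv Γ Φ a) (velocityField Φ) 0 := by
  refine eq_of_hasDerivAt_zero (fun s hs => ?_) ht
  have hder := h.hasDerivAt_innerAlong hΦ hs (h.contDiffAt_jacobiFieldDeriv hΦ hs a)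
    (hΦ.contDiffAt_velocityField hs)
  rw [h.innerAlong_cov_jacobiFieldDeriv hΦ hs hκ, h.innerAlong_velocityField_eq hΦ hs] at hder
  refine hder.congr_deriv ?_
  simp only [innerAlong, hΦ.cov_velocityField hs, map_zero]
  ring

lemma innerAlong_jacobiField_velocityField {a : F}
    (ha : innerAlong G Φ ξ (jacobiField Φ a) (velocityField Φ) 0 = 0) :
    innerAlong G Φ ξ (jacobiField Φ a) (velocityField Φ) t =
      innerAlong G Φ ξ (jacobiFieldDeriv Γ Φ a) (velocityField Φ) 0 * t := by
  set α := innerAlong G Φ ξ (jacobiFieldDeriv Γ Φ a) (velocityField Φ) 0 with hα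
  have hconst := eq_of_hasDerivAt_zero
    (f := fun s => innerAlong G Φ ξ (jacobiField Φ a) (velocityField Φ) s - α * s)
    (fun s hs => ?_) ht
  · simp only [ha, mul_zero, sub_zero] at hconst
    linarith
  · have hder := (h.hasDerivAt_innerAlong hΦ hs (hΦ.contDiffAt_jacobiField hs a)
      (hΦ.contDiffAt_velocityField hs)).sub ((hasDerivAt_id s).const_mul α)
    refine hder.congr_deriv ?_
    rw [hα, ← h.innerAlong_jacobiFieldDeriv_velocityField hΦ hs hκ a]
    simp [innerAlong, hΦ.cov_velocityField hs, jacobiFieldDeriv]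

omit ht

lemma isJacobiSystem {a b : F}
    (ha : innerAlong G Φ ξ (jacobiField Φ a) (velocityField Φ) 0 = 0)
    (hb : innerAlong G Φ ξ (jacobiField Φ b) (velocityField Φ) 0 = 0) :
    IsJacobiSystem κ (innerAlong G Φ ξ (velocityField Φ) (velocityField Φ) 0)
      (innerAlong G Φ ξ (jacobiFieldDeriv Γ Φ a) (velocityField Φ) 0 *
        innerAlong G Φ ξ (jacobiFieldDeriv Γ Φ b) (velocityField Φ) 0)
      (innerAlong G Φ ξ (jacobiField Φ a) (jacobiField Φ b))
      (fun t => innerAlong G Φ ξ (jacobiFieldDeriv Γ Φ a) (jacobiField Φ b) t +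
        innerAlong G Φ ξ (jacobiField Φ a) (jacobiFieldDeriv Γ Φ b) t)
      (innerAlong G Φ ξ (jacobiFieldDeriv Γ Φ a) (jacobiFieldDeriv Γ Φ b)) where
  hasDerivAt_fst t ht := h.hasDerivAt_innerAlong hΦ ht (hΦ.contDiffAt_jacobiField ht a)
    (hΦ.contDiffAt_jacobiField ht b)
  hasDerivAt_snd t ht := by
    have hder := (h.hasDerivAt_innerAlong hΦ ht (h.contDiffAt_jacobiFieldDeriv hΦ ht a)
      (hΦ.contDiffAt_jacobiField ht b)).add (h.hasDerivAt_innerAlong hΦ ht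
        (hΦ.contDiffAt_jacobiField ht a) (h.contDiffAt_jacobiFieldDeriv hΦ ht b))
    refine hder.congr_deriv ?_
    rw [h.innerAlong_comm hΦ ht _ (cov Γ Φ (1, 0) (jacobiFieldDeriv Γ Φ b)),
      h.innerAlong_cov_jacobiFieldDeriv hΦ ht hκ, h.innerAlong_cov_jacobiFieldDeriv hΦ ht hκ,
      h.innerAlong_jacobiField_velocityField hΦ ht hκ ha,
      h.innerAlong_jacobiField_velocityField hΦ ht hκ hb,
      h.innerAlong_comm hΦ ht (jacobiField Φ b) (jacobiField Φ a)]
    change _ + innerAlong G Φ ξ (jacobiFieldDeriv Γ Φ a) (jacobiFieldDeriv Γ Φ b) t +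
      (innerAlong G Φ ξ (jacobiFieldDeriv Γ Φ a) (jacobiFieldDeriv Γ Φ b) t + _) = _
    ring
  hasDerivAt_trd t ht := by
    refine (h.hasDerivAt_innerAlong hΦ ht (h.contDiffAt_jacobiFieldDeriv hΦ ht a)
      (h.contDiffAt_jacobiFieldDeriv hΦ ht b)).congr_deriv ?_
    rw [h.innerAlong_comm hΦ ht _ (cov Γ Φ (1, 0) (jacobiFieldDeriv Γ Φ b)),
      h.innerAlong_cov_jacobiFieldDeriv hΦ ht hκ, h.innerAlong_cov_jacobiFieldDeriv hΦ ht hκ,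
      h.innerAlong_jacobiField_velocityField hΦ ht hκ ha,
      h.innerAlong_jacobiField_velocityField hΦ ht hκ hb,
      h.innerAlong_jacobiFieldDeriv_velocityField hΦ ht hκ a,
      h.innerAlong_jacobiFieldDeriv_velocityField hΦ ht hκ b,
      h.innerAlong_comm hΦ ht (jacobiField Φ b) (jacobiFieldDeriv Γ Φ a)]
    ring

end IsLeviCivitaOn

/-- The products at time `0` that determine the inner product of two Jacobi fields: `⟨T, T⟩`,
`⟨J', T⟩ ⟨K', T⟩`, `⟨J, K⟩`, `⟨J', K⟩ + ⟨J, K'⟩` and `⟨J', K'⟩`, for `J` and `K` in directions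
`a` and `b` and velocity `T`. -/
def jacobiData (G : E → E →L[ℝ] E →L[ℝ] ℝ) (Γ : E → E →L[ℝ] E →L[ℝ] E) (Φ : ℝ × F → E) (a b ξ : F) :
    ℝ × ℝ × ℝ × ℝ × ℝ :=
  (innerAlong G Φ ξ (velocityField Φ) (velocityField Φ) 0,
    innerAlong G Φ ξ (jacobiFieldDeriv Γ Φ a) (velocityField Φ) 0 *
      innerAlong G Φ ξ (jacobiFieldDeriv Γ Φ b) (velocityField Φ) 0,
    innerAlong G Φ ξ (jacobiField Φ a) (jacobiField Φ b) 0,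
    innerAlong G Φ ξ (jacobiFieldDeriv Γ Φ a) (jacobiField Φ b) 0 +
      innerAlong G Φ ξ (jacobiField Φ a) (jacobiFieldDeriv Γ Φ b) 0,
    innerAlong G Φ ξ (jacobiFieldDeriv Γ Φ a) (jacobiFieldDeriv Γ Φ b) 0)

theorem IsLeviCivitaOn.innerAlong_jacobiField_eq {κ : ℝ} (h : IsLeviCivitaOn G Γ U)
    (hκ : HasConstantCurvatureOn G Γ κ U) {a b ξ₁ ξ₂ : F}
    (hgeo : ∀ ξ ∈ ({ξ₁, ξ₂} : Set F), IsGeodesicFamilyAt Γ U Φ ξ)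
    (ha : ∀ ξ ∈ ({ξ₁, ξ₂} : Set F), innerAlong G Φ ξ (jacobiField Φ a) (velocityField Φ) 0 = 0)
    (hb : ∀ ξ ∈ ({ξ₁, ξ₂} : Set F), innerAlong G Φ ξ (jacobiField Φ b) (velocityField Φ) 0 = 0)
    (hdata : jacobiData G Γ Φ a b ξ₁ = jacobiData G Γ Φ a b ξ₂) :
    innerAlong G Φ ξ₁ (jacobiField Φ a) (jacobiField Φ b) 1 =
      innerAlong G Φ ξ₂ (jacobiField Φ a) (jacobiField Φ b) 1 := by
  have hsys : ∀ ξ ∈ ({ξ₁, ξ₂} : Set F), _ := fun ξ hξ =>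
    h.isJacobiSystem (hgeo ξ hξ) hκ (ha ξ hξ) (hb ξ hξ)
  obtain ⟨hρ, hθ, hf, hp, hh⟩ : _ ∧ _ ∧ _ ∧ _ ∧ _ := by
    simpa only [jacobiData, Prod.mk.injEq] using hdata
  have hsys₁ := hsys ξ₁ (by simp)
  rw [hρ, hθ] at hsys₁
  exact hsys₁.eqOn (hsys ξ₂ (by simp)) hf hp hh (right_mem_Icc.2 zero_le_one)

end JacobiFields

section Coordinates

variable {n : ℕ}

lemma basisVec_apply (i j : Fin (n + 1)) : (basisVec i : Coord n) j = if j = i then 1 else 0 := by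
  simp [basisVec]

lemma sum_smul_basisVec (v : Coord n) : ∑ i, v i • basisVec i = v := by
  ext j
  simp [basisVec_apply, Finset.sum_apply]

lemma apply_eq_sum_of_isLinearMap {f : Coord n → ℝ} (hf : IsLinearMap ℝ f) (v : Coord n) :
    f v = ∑ i, v i * f (basisVec i) := by
  conv_lhs => rw [← sum_smul_basisVec v]
  refine (map_sum (hf.mk' f) (fun i => v i • basisVec i) Finset.univ).trans ?_
  exact Finset.sum_congr rfl fun i _ => hf.map_smul _ _

lemma apply_eq_sum_of_trilinear {T : Coord n → Coord n → Coord n → ℝ}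
    (h₁ : ∀ w z, IsLinearMap ℝ fun v => T v w z) (h₂ : ∀ v z, IsLinearMap ℝ fun w => T v w z)
    (h₃ : ∀ v w, IsLinearMap ℝ (T v w)) (v w z : Coord n) :
    T v w z =
      ∑ i, ∑ j, ∑ k, T (basisVec i) (basisVec j) (basisVec k) * v i * w j * z k := by
  rw [apply_eq_sum_of_isLinearMap (h₁ w z) v]
  refine Finset.sum_congr rfl fun i _ => ?_
  rw [apply_eq_sum_of_isLinearMap (h₂ _ z) w, Finset.mul_sum]
  refine Finset.sum_congr rfl fun j _ => ?_
  rw [apply_eq_sum_of_isLinearMap (h₃ _ _) z, Finset.mul_sum, Finset.mul_sum]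
  exact Finset.sum_congr rfl fun k _ => by ring

lemma sum_sum_sum_sum_rotate {ι : Type*} [Fintype ι] (f : ι → ι → ι → ι → ℝ) :
    ∑ i, ∑ j, ∑ k, ∑ l, f i j k l = ∑ l, ∑ i, ∑ j, ∑ k, f i j k l :=
  calc ∑ i, ∑ j, ∑ k, ∑ l, f i j k l = ∑ i, ∑ j, ∑ l, ∑ k, f i j k l :=
        Finset.sum_congr rfl fun _ _ => Finset.sum_congr rfl fun _ _ => Finset.sum_comm
    _ = ∑ i, ∑ l, ∑ j, ∑ k, f i j k l := Finset.sum_congr rfl fun _ _ => Finset.sum_comm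
    _ = _ := Finset.sum_comm

lemma contDiffAt_det {ι : Type*} [Fintype ι] [DecidableEq ι] {E : Type*} [NormedAddCommGroup E]
    [NormedSpace ℝ E] {A : E → Matrix ι ι ℝ} {y : E} {m : WithTop ℕ∞}
    (hA : ∀ i j, ContDiffAt ℝ m (fun z => A z i j) y) : ContDiffAt ℝ m (fun z => (A z).det) y := by
  simp only [Matrix.det_apply]
  exact ContDiffAt.sum fun σ _ => (contDiffAt_prod fun i _ => hA _ _).const_smul _

lemma contDiffAt_matrix_inv {ι : Type*} [Fintype ι] [DecidableEq ι] {E : Type*}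
    [NormedAddCommGroup E] [NormedSpace ℝ E] {A : E → Matrix ι ι ℝ} {y : E} {m : WithTop ℕ∞}
    (hA : ∀ i j, ContDiffAt ℝ m (fun z => A z i j) y) (hdet : (A y).det ≠ 0) (i j : ι) :
    ContDiffAt ℝ m (fun z => (A z)⁻¹ i j) y := by
  have hinv : (fun z => (A z)⁻¹ i j) = fun z => (A z).det⁻¹ * (A z).adjugate i j := by
    funext z
    simp [Matrix.inv_def, Ring.inverse_eq_inv']
  rw [hinv]
  refine ((contDiffAt_det hA).inv hdet).mul ?_
  simp only [Matrix.adjugate_apply]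
  refine contDiffAt_det fun k l => ?_
  simp only [Matrix.updateRow_apply]
  split_ifs
  · exact contDiffAt_const
  · exact hA _ _

/-- The bilinear form with the matrix `Gm y` at the point `y`. -/
def formOf (Gm : Coord n → Matrix (Fin (n + 1)) (Fin (n + 1)) ℝ) (y : Coord n) :
    Coord n →L[ℝ] Coord n →L[ℝ] ℝ :=
  ∑ i, ∑ j, Gm y i j • (EuclideanSpace.proj i : Coord n →L[ℝ] ℝ).smulRight
    (EuclideanSpace.proj j : Coord n →L[ℝ] ℝ)

/-- The Christoffel symbols of the metric with components `Gm`, assembled into a bilinear map. -/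
def connOf (Gm : Coord n → Matrix (Fin (n + 1)) (Fin (n + 1)) ℝ) (y : Coord n) :
    Coord n →L[ℝ] Coord n →L[ℝ] Coord n :=
  ∑ k, ∑ i, ∑ j, christoffel Gm k i j y • (EuclideanSpace.proj i : Coord n →L[ℝ] ℝ).smulRight
    ((EuclideanSpace.proj j : Coord n →L[ℝ] ℝ).smulRight (basisVec k))

variable {Gm : Coord n → Matrix (Fin (n + 1)) (Fin (n + 1)) ℝ}

lemma formOf_apply (y v w : Coord n) : formOf Gm y v w = pairing Gm y v w := by
  simp [formOf, pairing, mul_assoc]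

lemma pairing_eq_of_apply_basisVec {E : Type*} [NormedAddCommGroup E] [NormedSpace ℝ E]
    {y : Coord n} {B : E →L[ℝ] E →L[ℝ] ℝ} {D : Coord n →L[ℝ] E}
    (hB : ∀ i j, Gm y i j = B (D (basisVec i)) (D (basisVec j))) (v w : Coord n) :
    pairing Gm y v w = B (D v) (D w) := by
  conv_rhs => rw [← sum_smul_basisVec v, ← sum_smul_basisVec w]
  simp only [pairing, hB, map_sum, map_smul, sum_apply, smul_apply, smul_eq_mul, Finset.mul_sum]
  rw [Finset.sum_comm]
  exact Finset.sum_congr rfl fun _ _ => Finset.sum_congr rfl fun _ _ => by ring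

lemma formOf_basisVec (y : Coord n) (i j : Fin (n + 1)) :
    formOf Gm y (basisVec i) (basisVec j) = Gm y i j := by
  simp [formOf_apply, pairing, basisVec_apply]

lemma connOf_apply (y v w : Coord n) (k : Fin (n + 1)) :
    connOf Gm y v w k = ∑ i, ∑ j, christoffel Gm k i j y * v i * w j := by
  simp [connOf, basisVec_apply, Finset.sum_apply, mul_assoc]

lemma connOf_basisVec (y : Coord n) (i j k : Fin (n + 1)) :
    connOf Gm y (basisVec i) (basisVec j) k = christoffel Gm k i j y := by
  simp [connOf_apply, basisVec_apply]

lemma contDiffAt_pd {f : Coord n → ℝ} {y : Coord n} (hf : ContDiffAt ℝ ∞ f y) (i : Fin (n + 1)) :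
    ContDiffAt ℝ ∞ (pd i f) y :=
  contDiffAt_fderiv_apply hf _

lemma contDiffAt_christoffel {y : Coord n}
    (hG : ∀ i j, ContDiffAt ℝ ∞ (fun z => Gm z i j) y) (hdet : (Gm y).det ≠ 0)
    (k i j : Fin (n + 1)) : ContDiffAt ℝ ∞ (christoffel Gm k i j) y :=
  contDiffAt_const.mul <| ContDiffAt.sum fun l _ => (contDiffAt_matrix_inv hG hdet k l).mul
    (((contDiffAt_pd (hG j l) i).add (contDiffAt_pd (hG i l) j)).sub (contDiffAt_pd (hG i j) l))

/-- `Gm` holds the components of a smooth Riemannian metric on the open set `U`. -/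
structure IsMetricOn (Gm : Coord n → Matrix (Fin (n + 1)) (Fin (n + 1)) ℝ) (U : Set (Coord n)) :
    Prop where
  isOpen : IsOpen U
  contDiffAt : ∀ y ∈ U, ∀ i j, ContDiffAt ℝ ∞ (fun z => Gm z i j) y
  symm : ∀ y ∈ U, ∀ i j, Gm y i j = Gm y j i
  pos : ∀ y ∈ U, ∀ v, v ≠ 0 → 0 < pairing Gm y v v

namespace IsMetricOn

variable {U : Set (Coord n)} {y : Coord n}

lemma det_ne_zero (h : IsMetricOn Gm U) (hy : y ∈ U) : (Gm y).det ≠ 0 := by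
  intro hdet
  obtain ⟨v, hv, hker⟩ := Matrix.exists_mulVec_eq_zero_iff.2 hdet
  have hpairing : pairing Gm y (WithLp.toLp 2 v) (WithLp.toLp 2 v) =
      ∑ i, v i * (Gm y).mulVec v i := by
    simp only [pairing, Matrix.mulVec, dotProduct, Finset.mul_sum]
    exact Finset.sum_congr rfl fun i _ => Finset.sum_congr rfl fun j _ => by ring
  have hpos := h.pos y hy (WithLp.toLp 2 v) (by simpa using hv)
  simp [hpairing, hker] at hpos

lemma pd_symm (h : IsMetricOn Gm U) (hy : y ∈ U) (l i j : Fin (n + 1)) :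
    pd l (fun z => Gm z i j) y = pd l (fun z => Gm z j i) y := by
  have hsymm : (fun z => Gm z i j) =ᶠ[nhds y] fun z => Gm z j i := by
    filter_upwards [h.isOpen.mem_nhds hy] with z hz using h.symm z hz i j
  rw [pd, pd, hsymm.fderiv_eq]

lemma pairing_symm (h : IsMetricOn Gm U) (hy : y ∈ U) (v w : Coord n) :
    pairing Gm y v w = pairing Gm y w v := by
  simp only [pairing]
  rw [Finset.sum_comm]
  refine Finset.sum_congr rfl fun i _ => Finset.sum_congr rfl fun j _ => ?_
  rw [h.symm y hy]
  ring

lemma christoffel_symm (h : IsMetricOn Gm U) (hy : y ∈ U) (k i j : Fin (n + 1)) :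
    christoffel Gm k i j y = christoffel Gm k j i y := by
  simp only [christoffel, h.pd_symm hy _ i j]
  congr 1
  exact Finset.sum_congr rfl fun l _ => by ring

lemma sum_mul_christoffel (h : IsMetricOn Gm U) (hy : y ∈ U) (i j k : Fin (n + 1)) :
    ∑ l, Gm y k l * christoffel Gm l i j y = 1 / 2 * (pd i (fun z => Gm z j k) y +
      pd j (fun z => Gm z i k) y - pd k (fun z => Gm z i j) y) := by
  set b : Fin (n + 1) → ℝ := fun q =>
    pd i (fun z => Gm z j q) y + pd j (fun z => Gm z i q) y - pd q (fun z => Gm z i j) y with hb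
  have hchr : (fun l => christoffel Gm l i j y) = (Gm y)⁻¹.mulVec ((1 / 2 : ℝ) • b) := by
    funext l
    simp only [christoffel, hb, Matrix.mulVec_smul, Pi.smul_apply, smul_eq_mul]
    rfl
  calc ∑ l, Gm y k l * christoffel Gm l i j y
      = (Gm y).mulVec ((Gm y)⁻¹.mulVec ((1 / 2 : ℝ) • b)) k := by
        rw [← hchr]
        rfl
    _ = 1 / 2 * b k := by
        rw [Matrix.mulVec_mulVec, Matrix.mul_nonsing_inv _ (h.det_ne_zero hy).isUnit,
          Matrix.one_mulVec, Pi.smul_apply, smul_eq_mul]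

lemma formOf_connOf_basisVec (h : IsMetricOn Gm U) (hy : y ∈ U) (i j k : Fin (n + 1)) :
    formOf Gm y (connOf Gm y (basisVec i) (basisVec j)) (basisVec k) =
      1 / 2 * (pd i (fun z => Gm z j k) y +
      pd j (fun z => Gm z i k) y - pd k (fun z => Gm z i j) y) := by
  rw [← h.sum_mul_christoffel hy, formOf_apply, pairing]
  simp only [connOf_basisVec, basisVec_apply, mul_ite, mul_one, mul_zero, Finset.sum_ite_eq',
    Finset.mem_univ, if_true]
  exact Finset.sum_congr rfl fun l _ => by rw [h.symm y hy]

lemma contDiffAt_formOf (h : IsMetricOn Gm U) (hy : y ∈ U) : ContDiffAt ℝ ∞ (formOf Gm) y :=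
  ContDiffAt.sum fun i _ => ContDiffAt.sum fun j _ =>
    (ContinuousLinearMap.toSpanSingleton ℝ _).contDiff.contDiffAt.comp y (h.contDiffAt y hy i j)

lemma contDiffAt_connOf (h : IsMetricOn Gm U) (hy : y ∈ U) : ContDiffAt ℝ ∞ (connOf Gm) y :=
  ContDiffAt.sum fun k _ => ContDiffAt.sum fun i _ => ContDiffAt.sum fun j _ =>
    (ContinuousLinearMap.toSpanSingleton ℝ _).contDiff.contDiffAt.comp y
      (contDiffAt_christoffel (h.contDiffAt y hy) (h.det_ne_zero hy) k i j)

lemma fderiv_formOf_basisVec (h : IsMetricOn Gm U) (hy : y ∈ U) (i j k : Fin (n + 1)) :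
    fderiv ℝ (formOf Gm) y (basisVec i) (basisVec j) (basisVec k) =
      formOf Gm y (connOf Gm y (basisVec i) (basisVec j)) (basisVec k) +
        formOf Gm y (basisVec j) (connOf Gm y (basisVec i) (basisVec k)) := by
  have hpd : fderiv ℝ (formOf Gm) y (basisVec i) (basisVec j) (basisVec k) =
      pd i (fun z => Gm z j k) y := by
    rw [← fderiv_apply_apply_const ((h.contDiffAt_formOf hy).differentiableAt (by simp))]
    simp only [formOf_basisVec, pd]
  have hsymm : formOf Gm y (basisVec j) (connOf Gm y (basisVec i) (basisVec k)) =
      formOf Gm y (connOf Gm y (basisVec i) (basisVec k)) (basisVec j) := by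
    rw [formOf_apply, formOf_apply, h.pairing_symm hy]
  rw [hpd, hsymm, h.formOf_connOf_basisVec hy, h.formOf_connOf_basisVec hy, h.pd_symm hy i k j]
  ring

lemma fderiv_formOf (h : IsMetricOn Gm U) (hy : y ∈ U) (u v w : Coord n) :
    fderiv ℝ (formOf Gm) y u v w =
      formOf Gm y (connOf Gm y u v) w + formOf Gm y v (connOf Gm y u w) := by
  rw [apply_eq_sum_of_trilinear (T := fun u v w => fderiv ℝ (formOf Gm) y u v w),
    apply_eq_sum_of_trilinear (T := fun u v w =>
      formOf Gm y (connOf Gm y u v) w + formOf Gm y v (connOf Gm y u w))]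
  · simp only [h.fderiv_formOf_basisVec hy]
  all_goals
    refine fun _ _ => ⟨fun _ _ => ?_, fun _ _ => ?_⟩ <;>
    simp only [map_add, map_smul, add_apply, smul_apply, smul_eq_mul] <;> ring

lemma isLeviCivitaOn (h : IsMetricOn Gm U) : IsLeviCivitaOn (formOf Gm) (connOf Gm) U where
  isOpen := h.isOpen
  metric_contDiffAt _ hy := h.contDiffAt_formOf hy
  conn_contDiffAt _ hy := h.contDiffAt_connOf hy
  metric_symm y hy v w := by rw [formOf_apply, formOf_apply, h.pairing_symm hy]
  metric_pos y hy v hv := by simpa only [formOf_apply] using h.pos y hy v hv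
  conn_symm y hy v w := by
    ext k
    rw [connOf_apply, connOf_apply, Finset.sum_comm]
    refine Finset.sum_congr rfl fun i _ => Finset.sum_congr rfl fun j _ => ?_
    rw [h.christoffel_symm hy]
    ring
  compat _ hy := h.fderiv_formOf hy

lemma curv_basisVec (h : IsMetricOn Gm U) (hy : y ∈ U) (l i j k : Fin (n + 1)) :
    curv (connOf Gm) y (basisVec i) (basisVec j) (basisVec k) l = riemann Gm l i j k y := by
  have hconn := (h.contDiffAt_connOf hy).differentiableAt (by simp)
  have hpd : ∀ i j, fderiv ℝ (connOf Gm) y (basisVec i) (basisVec j) (basisVec k) l =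
      pd i (christoffel Gm l j k) y := fun i j => by
    have hproj : christoffel Gm l j k = fun z => connOf Gm z (basisVec j) (basisVec k) l := by
      simp only [connOf_basisVec]
    have hfun : DifferentiableAt ℝ (fun z => connOf Gm z (basisVec j) (basisVec k)) y :=
      (hconn.clm_apply (differentiableAt_const _)).clm_apply (differentiableAt_const _)
    rw [pd, hproj, ← fderiv_apply_apply_const hconn]
    exact (congrArg (· (basisVec i))
      ((EuclideanSpace.proj l : Coord n →L[ℝ] ℝ).hasFDerivAt.comp y hfun.hasFDerivAt).fderiv).symm
  have hmul : ∀ i (v : Coord n), connOf Gm y (basisVec i) v l =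
      ∑ m, christoffel Gm l i m y * v m := fun i v => by
    simp [connOf_apply, basisVec_apply]
  simp only [curv, PiLp.add_apply, PiLp.sub_apply, hpd, hmul, connOf_basisVec, riemann,
    Finset.sum_sub_distrib]
  ring

lemma curv_apply (h : IsMetricOn Gm U) (hy : y ∈ U) (v w z : Coord n) (l : Fin (n + 1)) :
    curv (connOf Gm) y v w z l = ∑ i, ∑ j, ∑ k, riemann Gm l i j k y * v i * w j * z k := by
  rw [apply_eq_sum_of_trilinear (T := fun v w z => curv (connOf Gm) y v w z l)]
  · simp only [h.curv_basisVec hy]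
  all_goals
    refine fun _ _ => ⟨fun _ _ => ?_, fun _ _ => ?_⟩ <;>
    simp only [curv, map_add, map_smul, add_apply, smul_apply, PiLp.add_apply, PiLp.sub_apply,
      PiLp.smul_apply, smul_eq_mul] <;> ring

lemma curvatureForm_eq (h : IsMetricOn Gm U) (hy : y ∈ U) (v w : Coord n) :
    curvatureForm Gm y v w = formOf Gm y (curv (connOf Gm) y v w w) v := by
  rw [formOf_apply, pairing]
  simp only [h.curv_apply hy, curvatureForm, Finset.mul_sum, Finset.sum_mul]
  rw [sum_sum_sum_sum_rotate]
  refine Finset.sum_congr rfl fun l _ => ?_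
  rw [sum_sum_sum_sum_rotate]
  exact Finset.sum_congr rfl fun q _ => Finset.sum_congr rfl fun i _ =>
    Finset.sum_congr rfl fun j _ => Finset.sum_congr rfl fun k _ => by ring

end IsMetricOn

end Coordinates

section Charts

open Topology Set

variable {n : ℕ} {M : Type*} [TopologicalSpace M] [ChartedSpace (Coord n) M]

/-- The tangent vector with components `v` at the point with coordinates `y`, in the chart around
`x₀`. -/
def chartVec (x₀ : M) (y v : Coord n) :
    TangentSpace (𝓡 (n + 1)) ((extChartAt (𝓡 (n + 1)) x₀).symm y) :=
  mfderiv 𝓘(ℝ, Coord n) (𝓡 (n + 1)) (extChartAt (𝓡 (n + 1)) x₀).symm y v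

lemma chartComp_smul (x₀ : M) {x : M} (c : ℝ) (v : TangentSpace (𝓡 (n + 1)) x) :
    chartComp x₀ (c • v) = c • chartComp x₀ v :=
  map_smul _ c v

lemma chartComp_congr_point (x₁ : M) {x x' : M} (h : x' = x) (v : Coord n) :
    chartComp x₁ (x := x') v = chartComp x₁ (x := x) v := by
  subst h
  rfl

/-- The change of coordinates from the chart around `x₀` to the chart around `x₁`. -/
def chartChange (x₀ x₁ : M) (y : Coord n) : Coord n :=
  extChartAt (𝓡 (n + 1)) x₁ ((extChartAt (𝓡 (n + 1)) x₀).symm y)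

lemma chartChange_extChartAt {x₀ x₁ x : M} (hx : x ∈ (extChartAt (𝓡 (n + 1)) x₀).source) :
    chartChange x₀ x₁ (extChartAt (𝓡 (n + 1)) x₀ x) = extChartAt (𝓡 (n + 1)) x₁ x := by
  rw [chartChange, (extChartAt (𝓡 (n + 1)) x₀).left_inv hx]

variable [IsManifold (𝓡 (n + 1)) ∞ M]

section SmoothMaps

variable {E : Type*} [NormedAddCommGroup E] [NormedSpace ℝ E] {ψ : E → M} {x₀ : M} {y : E}

lemma contMDiffAt_chart_symm {y : Coord n} (hy : y ∈ (extChartAt (𝓡 (n + 1)) x₀).target) :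
    ContMDiffAt 𝓘(ℝ, Coord n) (𝓡 (n + 1)) ∞ (extChartAt (𝓡 (n + 1)) x₀).symm y :=
  (contMDiffOn_extChartAt_symm x₀).contMDiffAt (extChartAt_target_mem_nhds' hy)

lemma contMDiffAt_chart {x : M} (hx : x ∈ (extChartAt (𝓡 (n + 1)) x₀).source) :
    ContMDiffAt (𝓡 (n + 1)) 𝓘(ℝ, Coord n) ∞ (extChartAt (𝓡 (n + 1)) x₀) x :=
  contMDiffAt_extChartAt' (by rwa [← extChartAt_source (𝓡 (n + 1))])

lemma chartComp_mfderiv (hψ : MDifferentiableAt 𝓘(ℝ, E) (𝓡 (n + 1)) ψ y)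
    (hy : ψ y ∈ (extChartAt (𝓡 (n + 1)) x₀).source) (v : E) :
    chartComp x₀ (mfderiv 𝓘(ℝ, E) (𝓡 (n + 1)) ψ y v) =
      fderiv ℝ (fun z => extChartAt (𝓡 (n + 1)) x₀ (ψ z)) y v := by
  have hcomp := mfderiv_comp (I'' := 𝓘(ℝ, Coord n)) y
    ((contMDiffAt_chart hy).mdifferentiableAt (by simp)) hψ
  rw [mfderiv_eq_fderiv] at hcomp
  exact (congrArg (fun L : E →L[ℝ] Coord n => L v) hcomp).symm

lemma differentiableAt_chart_comp (hψ : MDifferentiableAt 𝓘(ℝ, E) (𝓡 (n + 1)) ψ y)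
    (hy : ψ y ∈ (extChartAt (𝓡 (n + 1)) x₀).source) :
    DifferentiableAt ℝ (fun z => extChartAt (𝓡 (n + 1)) x₀ (ψ z)) y :=
  (((contMDiffAt_chart hy).mdifferentiableAt (by simp)).comp y hψ).differentiableAt

lemma contDiffAt_chart_comp (hψ : ContMDiffAt 𝓘(ℝ, E) (𝓡 (n + 1)) ∞ ψ y)
    (hy : ψ y ∈ (extChartAt (𝓡 (n + 1)) x₀).source) :
    ContDiffAt ℝ ∞ (fun z => extChartAt (𝓡 (n + 1)) x₀ (ψ z)) y :=
  ((contMDiffAt_chart hy).comp y hψ).contDiffAt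

end SmoothMaps

lemma chartComp_chartVec {x₀ : M} {y : Coord n} (hy : y ∈ (extChartAt (𝓡 (n + 1)) x₀).target)
    (v : Coord n) : chartComp x₀ (chartVec x₀ y v) = v := by
  have hid : (fun z => extChartAt (𝓡 (n + 1)) x₀ ((extChartAt (𝓡 (n + 1)) x₀).symm z)) =ᶠ[𝓝 y]
      id := by
    filter_upwards [extChartAt_target_mem_nhds' hy] with z hz using
      (extChartAt (𝓡 (n + 1)) x₀).right_inv hz
  refine (chartComp_mfderiv ((contMDiffAt_chart_symm hy).mdifferentiableAt (by simp))
    ((extChartAt (𝓡 (n + 1)) x₀).map_target hy) v).trans ?_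
  rw [hid.fderiv_eq, fderiv_id]
  rfl

lemma chartVec_chartComp {x₀ x : M} (hx : x ∈ (extChartAt (𝓡 (n + 1)) x₀).source)
    (v : TangentSpace (𝓡 (n + 1)) x) :
    (chartVec x₀ (extChartAt (𝓡 (n + 1)) x₀ x) (chartComp x₀ v) : Coord n) = (v : Coord n) := by
  have hcomp := mfderiv_comp (I := 𝓡 (n + 1)) (I'' := 𝓡 (n + 1)) x
    ((contMDiffAt_chart_symm ((extChartAt (𝓡 (n + 1)) x₀).map_source hx)).mdifferentiableAt
      (by simp)) ((contMDiffAt_chart hx).mdifferentiableAt (by simp))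
  have hid : ((extChartAt (𝓡 (n + 1)) x₀).symm ∘ (extChartAt (𝓡 (n + 1)) x₀)) =ᶠ[𝓝 x] id := by
    filter_upwards [extChartAt_source_mem_nhds' hx] with z hz using
      (extChartAt (𝓡 (n + 1)) x₀).left_inv hz
  rw [hid.mfderiv_eq, mfderiv_id] at hcomp
  exact (congrArg (fun L : Coord n →L[ℝ] Coord n => L v) hcomp).symm

lemma chartComp_injective {x₀ x : M} (hx : x ∈ (extChartAt (𝓡 (n + 1)) x₀).source)
    {v w : TangentSpace (𝓡 (n + 1)) x} (h : chartComp x₀ v = chartComp x₀ w) : v = w := by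
  have hv := chartVec_chartComp hx v
  rw [h, chartVec_chartComp hx w] at hv
  exact hv.symm

lemma chartComp_surjective {x₀ x : M} (hx : x ∈ (extChartAt (𝓡 (n + 1)) x₀).source) (w : Coord n) :
    ∃ v : TangentSpace (𝓡 (n + 1)) x, chartComp x₀ v = w :=
  ⟨(chartVec x₀ (extChartAt (𝓡 (n + 1)) x₀ x) w : Coord n),
    (chartComp_congr_point x₀ ((extChartAt (𝓡 (n + 1)) x₀).left_inv hx) _).symm.trans
      (chartComp_chartVec ((extChartAt (𝓡 (n + 1)) x₀).map_source hx) w)⟩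

lemma formOf_chartMetric (g : Metric n M) (x₀ : M) (y v w : Coord n) :
    formOf (chartMetric g x₀) y v w =
      g.inner ((extChartAt (𝓡 (n + 1)) x₀).symm y) (chartVec x₀ y v) (chartVec x₀ y w) := by
  set D : Coord n →L[ℝ] Coord n :=
    mfderiv 𝓘(ℝ, Coord n) (𝓡 (n + 1)) (extChartAt (𝓡 (n + 1)) x₀).symm y
  set B : Coord n →L[ℝ] Coord n →L[ℝ] ℝ := g.inner ((extChartAt (𝓡 (n + 1)) x₀).symm y)
  change formOf (chartMetric g x₀) y v w = B (D v) (D w)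
  rw [formOf_apply]
  exact pairing_eq_of_apply_basisVec (fun _ _ => rfl) v w

lemma inner_congr_point (g : Metric n M) {x x' : M} (h : x' = x) (v w : Coord n) :
    g.inner x' (v : TangentSpace (𝓡 (n + 1)) x') (w : TangentSpace (𝓡 (n + 1)) x') =
      g.inner x (v : TangentSpace (𝓡 (n + 1)) x) (w : TangentSpace (𝓡 (n + 1)) x) := by
  subst h
  rfl

lemma inner_eq_formOf (g : Metric n M) {x₀ x : M} (hx : x ∈ (extChartAt (𝓡 (n + 1)) x₀).source)
    (v w : TangentSpace (𝓡 (n + 1)) x) :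
    g.inner x v w = formOf (chartMetric g x₀) (extChartAt (𝓡 (n + 1)) x₀ x)
      (chartComp x₀ v) (chartComp x₀ w) := by
  rw [formOf_chartMetric]
  refine Eq.trans ?_ (inner_congr_point g ((extChartAt (𝓡 (n + 1)) x₀).left_inv hx) _ _).symm
  rw [chartVec_chartComp hx v, chartVec_chartComp hx w]

lemma pullbackMetric_eq_formOf (g : Metric n M) {x₀ : M} {ψ : Coord n → M} {y : Coord n}
    (hψ : MDifferentiableAt 𝓘(ℝ, Coord n) (𝓡 (n + 1)) ψ y)
    (hy : ψ y ∈ (extChartAt (𝓡 (n + 1)) x₀).source) (i j : Fin (n + 1)) :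
    pullbackMetric g ψ y i j = formOf (chartMetric g x₀) (extChartAt (𝓡 (n + 1)) x₀ (ψ y))
      (fderiv ℝ (fun z => extChartAt (𝓡 (n + 1)) x₀ (ψ z)) y (basisVec i))
      (fderiv ℝ (fun z => extChartAt (𝓡 (n + 1)) x₀ (ψ z)) y (basisVec j)) := by
  rw [← chartComp_mfderiv hψ hy, ← chartComp_mfderiv hψ hy, ← inner_eq_formOf g hy]
  rfl

lemma contMDiffAt_chartVec {x₀ : M} {y : Coord n}
    (hy : y ∈ (extChartAt (𝓡 (n + 1)) x₀).target) (v : Coord n) :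
    ContMDiffAt 𝓘(ℝ, Coord n) (𝓡 (n + 1)).tangent ∞
      (fun z => (⟨(extChartAt (𝓡 (n + 1)) x₀).symm z, chartVec x₀ z v⟩ :
        TangentBundle (𝓡 (n + 1)) M)) y := by
  have hopen : IsOpen (extChartAt (𝓡 (n + 1)) x₀).target := isOpen_extChartAt_target x₀
  have hconst : ContMDiff 𝓘(ℝ, Coord n) 𝓘(ℝ, Coord n).tangent ∞
      (fun z => (⟨z, v⟩ : TangentBundle 𝓘(ℝ, Coord n) (Coord n))) :=
    contMDiff_vectorSpace_iff_contDiff.2 contDiff_const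
  have hpush := ((contMDiffOn_extChartAt_symm (n := ∞) (I := 𝓡 (n + 1))
    x₀).contMDiffOn_tangentMapWithin (m := ∞) (by simp) hopen.uniqueMDiffOn).comp
      (s := (extChartAt (𝓡 (n + 1)) x₀).target) hconst.contMDiffOn (fun z hz => hz)
  refine (hpush.contMDiffAt (hopen.mem_nhds hy)).congr_of_eventuallyEq ?_
  filter_upwards [hopen.mem_nhds hy] with z hz
  simp only [Function.comp_apply, tangentMapWithin, mfderivWithin_of_isOpen hopen hz]
  rfl

lemma contDiffAt_chartMetric (g : Metric n M) {x₀ : M} {y : Coord n}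
    (hy : y ∈ (extChartAt (𝓡 (n + 1)) x₀).target) (i j : Fin (n + 1)) :
    ContDiffAt ℝ ∞ (fun z => chartMetric g x₀ z i j) y := by
  have hinner : ContMDiffAt 𝓘(ℝ, Coord n) ((𝓡 (n + 1)).prod 𝓘(ℝ)) ∞
      (fun z => Bundle.TotalSpace.mk' ℝ (E := Bundle.Trivial M ℝ)
        ((extChartAt (𝓡 (n + 1)) x₀).symm z)
        (g.inner ((extChartAt (𝓡 (n + 1)) x₀).symm z) (chartVec x₀ z (basisVec i))
          (chartVec x₀ z (basisVec j)))) y := by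
    apply ContMDiffAt.clm_bundle_apply₂ (F₁ := Coord n) (F₂ := Coord n)
    · exact g.contMDiff.contMDiffAt.comp y (contMDiffAt_chart_symm hy)
    · exact contMDiffAt_chartVec hy _
    · exact contMDiffAt_chartVec hy _
  simp only [Bundle.contMDiffAt_totalSpace] at hinner
  exact hinner.2.contDiffAt

lemma isMetricOn_chartMetric (g : Metric n M) (x₀ : M) :
    IsMetricOn (chartMetric g x₀) (extChartAt (𝓡 (n + 1)) x₀).target where
  isOpen := isOpen_extChartAt_target x₀
  contDiffAt _ hy := contDiffAt_chartMetric g hy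
  symm _ _ _ _ := g.symm _ _ _
  pos y hy v hv := by
    rw [← formOf_apply, formOf_chartMetric]
    refine g.pos _ _ fun hzero => hv ?_
    rw [← chartComp_chartVec hy v, hzero]
    exact map_zero _

lemma isLeviCivitaOn_chart (g : Metric n M) (x₀ : M) :
    IsLeviCivitaOn (formOf (chartMetric g x₀)) (connOf (chartMetric g x₀))
      (extChartAt (𝓡 (n + 1)) x₀).target :=
  (isMetricOn_chartMetric g x₀).isLeviCivitaOn

lemma HasConstantCurvature.hasConstantCurvatureOn {g : Metric n M} {κ : ℝ}
    (hg : HasConstantCurvature g κ) (x₀ : M) :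
    HasConstantCurvatureOn (formOf (chartMetric g x₀)) (connOf (chartMetric g x₀)) κ
      (extChartAt (𝓡 (n + 1)) x₀).target := fun y hy v w => by
  rw [← (isMetricOn_chartMetric g x₀).curvatureForm_eq hy, hg x₀ y hy]
  simp only [formOf_apply]

section ChartChange

variable {x₀ x₁ x : M}

lemma fderiv_chartChange {y : Coord n} (hy : y ∈ (extChartAt (𝓡 (n + 1)) x₀).target)
    (hy₁ : (extChartAt (𝓡 (n + 1)) x₀).symm y ∈ (extChartAt (𝓡 (n + 1)) x₁).source) (v : Coord n) :
    fderiv ℝ (chartChange x₀ x₁) y v = chartComp x₁ (chartVec x₀ y v) :=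
  (chartComp_mfderiv ((contMDiffAt_chart_symm hy).mdifferentiableAt (by simp)) hy₁ v).symm

variable (hx : x ∈ (extChartAt (𝓡 (n + 1)) x₀).source)
  (hx₁ : x ∈ (extChartAt (𝓡 (n + 1)) x₁).source)
include hx hx₁

lemma contDiffAt_chartChange :
    ContDiffAt ℝ ∞ (chartChange x₀ x₁) (extChartAt (𝓡 (n + 1)) x₀ x) :=
  contDiffAt_chart_comp (contMDiffAt_chart_symm ((extChartAt (𝓡 (n + 1)) x₀).map_source hx))
    (by rwa [(extChartAt (𝓡 (n + 1)) x₀).left_inv hx])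

lemma chartComp_eq_fderiv_chartChange (v : TangentSpace (𝓡 (n + 1)) x) :
    chartComp x₁ v =
      fderiv ℝ (chartChange x₀ x₁) (extChartAt (𝓡 (n + 1)) x₀ x) (chartComp x₀ v) := by
  have hl := (extChartAt (𝓡 (n + 1)) x₀).left_inv hx
  rw [fderiv_chartChange ((extChartAt (𝓡 (n + 1)) x₀).map_source hx) (by rwa [hl])]
  refine Eq.trans ?_ (chartComp_congr_point x₁ hl _).symm
  rw [chartVec_chartComp hx v]

lemma fderiv_chartChange_surjective :
    Function.Surjective (fderiv ℝ (chartChange x₀ x₁) (extChartAt (𝓡 (n + 1)) x₀ x)) := fun w => by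
  obtain ⟨v, rfl⟩ := chartComp_surjective hx₁ w
  exact ⟨chartComp x₀ v, (chartComp_eq_fderiv_chartChange hx hx₁ v).symm⟩

lemma eventually_formOf_chartMetric_eq (g : Metric n M) :
    ∀ᶠ p in 𝓝 (extChartAt (𝓡 (n + 1)) x₀ x), ∀ v w, formOf (chartMetric g x₀) p v w =
      formOf (chartMetric g x₁) (chartChange x₀ x₁ p) (fderiv ℝ (chartChange x₀ x₁) p v)
        (fderiv ℝ (chartChange x₀ x₁) p w) := by
  have hy := (extChartAt (𝓡 (n + 1)) x₀).map_source hx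
  have hsource : ∀ᶠ p in 𝓝 (extChartAt (𝓡 (n + 1)) x₀ x),
      (extChartAt (𝓡 (n + 1)) x₀).symm p ∈ (extChartAt (𝓡 (n + 1)) x₁).source :=
    (continuousAt_extChartAt_symm'' hy).eventually_mem ((isOpen_extChartAt_source x₁).mem_nhds
      (by rwa [(extChartAt (𝓡 (n + 1)) x₀).left_inv hx]))
  filter_upwards [hsource, extChartAt_target_mem_nhds' hy] with p hp hpt v w
  rw [fderiv_chartChange hpt hp, fderiv_chartChange hpt hp, formOf_chartMetric,
    inner_eq_formOf g hp]
  rfl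

end ChartChange

lemma hasDerivAt_chart_comp {x₀ : M} {c : ℝ → M} {t : ℝ}
    (hc : MDifferentiableAt 𝓘(ℝ, ℝ) (𝓡 (n + 1)) c t)
    (hct : c t ∈ (extChartAt (𝓡 (n + 1)) x₀).source) :
    HasDerivAt (fun τ => extChartAt (𝓡 (n + 1)) x₀ (c τ)) (chartComp x₀ (velocity c t)) t := by
  have hder := (differentiableAt_chart_comp hc hct).hasDerivAt
  rw [← fderiv_apply_one_eq_deriv] at hder
  rwa [← chartComp_mfderiv hc hct (1 : ℝ)] at hder

lemma hasDerivAt_chartComp_of_chart (g : Metric n M) {x₀ x₁ : M} {c : ℝ → M}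
    {V : ∀ t, TangentSpace (𝓡 (n + 1)) (c t)} {t : ℝ}
    (hc : MDifferentiableAt 𝓘(ℝ, ℝ) (𝓡 (n + 1)) c t)
    (h₀ : c t ∈ (extChartAt (𝓡 (n + 1)) x₀).source)
    (h₁ : c t ∈ (extChartAt (𝓡 (n + 1)) x₁).source)
    (hV : HasDerivAt (fun τ => chartComp x₀ (V τ))
      (-connOf (chartMetric g x₀) (extChartAt (𝓡 (n + 1)) x₀ (c t))
        (chartComp x₀ (velocity c t)) (chartComp x₀ (V t))) t) :
    HasDerivAt (fun τ => chartComp x₁ (V τ))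
      (-connOf (chartMetric g x₁) (extChartAt (𝓡 (n + 1)) x₁ (c t))
        (chartComp x₁ (velocity c t)) (chartComp x₁ (V t))) t := by
  have hpush := (isLeviCivitaOn_chart g x₀).hasDerivAt_parallel_of_isometry
    (isLeviCivitaOn_chart g x₁) (ψ := chartChange x₀ x₁)
    (c := fun τ => extChartAt (𝓡 (n + 1)) x₀ (c τ)) (V := fun τ => chartComp x₀ (V τ)) (t := t)
    (c' := chartComp x₀ (velocity c t)) ((extChartAt (𝓡 (n + 1)) x₀).map_source h₀)
    (by rw [chartChange_extChartAt h₀]; exact (extChartAt (𝓡 (n + 1)) x₁).map_source h₁)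
    (contDiffAt_chartChange h₀ h₁) (fderiv_chartChange_surjective h₀ h₁)
    (eventually_formOf_chartMetric_eq h₀ h₁ g) (hasDerivAt_chart_comp hc h₀) hV
  rw [chartChange_extChartAt h₀, ← chartComp_eq_fderiv_chartChange h₀ h₁,
    ← chartComp_eq_fderiv_chartChange h₀ h₁] at hpush
  refine hpush.congr_of_eventuallyEq ?_
  filter_upwards [hc.continuousAt.eventually_mem ((isOpen_extChartAt_source x₀).mem_nhds h₀),
    hc.continuousAt.eventually_mem ((isOpen_extChartAt_source x₁).mem_nhds h₁)] with τ hτ₀ hτ₁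
  exact chartComp_eq_fderiv_chartChange hτ₀ hτ₁ _

lemma hasDerivAt_coord {f : ℝ → Coord n} {f' : Coord n} {t : ℝ} :
    HasDerivAt f f' t ↔ ∀ k, HasDerivAt (fun τ => f τ k) (f' k) t := by
  refine ⟨fun h k =>
    (EuclideanSpace.proj k : Coord n →L[ℝ] ℝ).hasFDerivAt.comp_hasDerivAt t h, fun h => ?_⟩
  have hpi : HasDerivAt (fun τ => WithLp.ofLp (f τ)) (WithLp.ofLp f') t := hasDerivAt_pi.2 h
  exact (PiLp.continuousLinearEquiv 2 ℝ
    (fun _ : Fin (n + 1) => ℝ)).symm.hasFDerivAt.comp_hasDerivAt t hpi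

lemma isParallelOn_iff (g : Metric n M) {c : ℝ → M} {V : ∀ t, TangentSpace (𝓡 (n + 1)) (c t)}
    {s : Set ℝ} : IsParallelOn g c V s ↔
      ∀ t ∈ s, ∀ x₀ : M, c t ∈ (extChartAt (𝓡 (n + 1)) x₀).source →
        HasDerivAt (fun τ => chartComp x₀ (V τ))
          (-connOf (chartMetric g x₀) (extChartAt (𝓡 (n + 1)) x₀ (c t))
            (chartComp x₀ (velocity c t)) (chartComp x₀ (V t))) t := by
  simp only [IsParallelOn, hasDerivAt_coord, PiLp.neg_apply, connOf_apply]

end Charts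

section Geodesics

open Topology Set

section ODE

variable {E : Type*} [NormedAddCommGroup E] [NormedSpace ℝ E]

lemma contDiffOn_of_hasDerivAt {s : Set ℝ} (hs : IsOpen s) {z : ℝ → E} {F : ℝ × E → E}
    (hF : ∀ t ∈ s, ContDiffAt ℝ ∞ F (t, z t)) (hz : ∀ t ∈ s, HasDerivAt z (F (t, z t)) t) :
    ContDiffOn ℝ ∞ z s := by
  refine contDiffOn_infty.2 fun k => ?_
  induction k with
  | zero =>
    exact contDiffOn_zero.2 fun t ht => (hz t ht).continuousAt.continuousWithinAt
  | succ k ih =>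
    have hderiv : ContDiffOn ℝ k (fun t => F (t, z t)) s := fun t ht =>
      ((hF t ht).of_le (by exact_mod_cast le_top)).comp_contDiffWithinAt t
        (contDiffWithinAt_id.prodMk (ih t ht))
    refine (contDiffOn_succ_iff_deriv_of_isOpen (n := k) hs).2
      ⟨fun t ht => (hz t ht).differentiableAt.differentiableWithinAt, by simp, ?_⟩
    exact hderiv.congr fun t ht => (hz t ht).deriv

/-- The vector field on `E × E` whose integral curves are the geodesics of the connection `Γ`,
paired with their velocities. -/
def geodesicField (Γ : E → E →L[ℝ] E →L[ℝ] E) (z : E × E) : E × E := (z.2, -Γ z.1 z.2 z.2)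

lemma contDiffAt_geodesicField {Γ : E → E →L[ℝ] E →L[ℝ] E} {z : E × E}
    (hΓ : ContDiffAt ℝ ∞ Γ z.1) : ContDiffAt ℝ ∞ (geodesicField Γ) z :=
  contDiffAt_snd.prodMk (contDiffAt_apply_apply_comp (Φ := Prod.fst) hΓ contDiffAt_fst
    contDiffAt_snd contDiffAt_snd).neg

end ODE

variable {n : ℕ} {M : Type*} [TopologicalSpace M] [ChartedSpace (Coord n) M]
  [IsManifold (𝓡 (n + 1)) ∞ M] {g : Metric n M} {x₀ : M} {s : Set ℝ} {t : ℝ}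

/-- `z` consists of the positions and velocities of a geodesic in the chart around `x₀`. -/
def IsChartGeodesicOn (g : Metric n M) (x₀ : M) (z : ℝ → Coord n × Coord n) (s : Set ℝ) : Prop :=
  ∀ t ∈ s, (z t).1 ∈ (extChartAt (𝓡 (n + 1)) x₀).target ∧
    HasDerivAt z (geodesicField (connOf (chartMetric g x₀)) (z t)) t

namespace IsChartGeodesicOn

variable {z : ℝ → Coord n × Coord n}

lemma hasDerivAt_fst (hz : IsChartGeodesicOn g x₀ z s) (ht : t ∈ s) :
    HasDerivAt (fun τ => (z τ).1) (z t).2 t :=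
  HasFDerivAt.comp_hasDerivAt (x := t) (f := z) (l := Prod.fst) hasFDerivAt_fst (hz t ht).2

lemma hasDerivAt_snd (hz : IsChartGeodesicOn g x₀ z s) (ht : t ∈ s) :
    HasDerivAt (fun τ => (z τ).2) (-connOf (chartMetric g x₀) (z t).1 (z t).2 (z t).2) t :=
  HasFDerivAt.comp_hasDerivAt (x := t) (f := z) (l := Prod.snd) hasFDerivAt_snd (hz t ht).2

lemma scale (hz : IsChartGeodesicOn g x₀ z s) (r : ℝ) :
    IsChartGeodesicOn g x₀ (fun t => ((z (r * t)).1, r • (z (r * t)).2)) {t | r * t ∈ s} := by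
  intro t ht
  refine ⟨(hz _ ht).1, ?_⟩
  have hr : HasDerivAt (fun t : ℝ => r * t) r t := by simpa using (hasDerivAt_id t).const_mul r
  have hfst : HasDerivAt (fun t => (z (r * t)).1) (r • (z (r * t)).2) t :=
    HasDerivAt.scomp t (hz.hasDerivAt_fst ht) hr
  have hsnd : HasDerivAt (fun t => (z (r * t)).2)
      (r • (-connOf (chartMetric g x₀) (z (r * t)).1 (z (r * t)).2 (z (r * t)).2)) t :=
    HasDerivAt.scomp t (hz.hasDerivAt_snd ht) hr
  refine (hfst.prodMk (hsnd.const_smul r)).congr_deriv ?_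
  simp [geodesicField, smul_smul]

lemma contDiffOn (hz : IsChartGeodesicOn g x₀ z s) (hs : IsOpen s) : ContDiffOn ℝ ∞ z s :=
  contDiffOn_of_hasDerivAt hs (F := fun p => geodesicField (connOf (chartMetric g x₀)) p.2)
    (fun t ht => ContDiffAt.comp (t, z t) (f := Prod.snd) (contDiffAt_geodesicField
      ((isMetricOn_chartMetric g x₀).contDiffAt_connOf (hz t ht).1)) contDiffAt_snd)
    fun t ht => (hz t ht).2

lemma contMDiffOn (hz : IsChartGeodesicOn g x₀ z s) (hs : IsOpen s) :
    ContMDiffOn 𝓘(ℝ, ℝ) (𝓡 (n + 1)) ∞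
      (fun t => (extChartAt (𝓡 (n + 1)) x₀).symm (z t).1) s := by
  intro t ht
  have hpos : ContMDiffAt 𝓘(ℝ, ℝ) 𝓘(ℝ, Coord n) ∞ (fun τ => (z τ).1) t :=
    (((hz.contDiffOn hs).contDiffAt (hs.mem_nhds ht)).fst).contMDiffAt
  exact (ContMDiffAt.comp t (g := (extChartAt (𝓡 (n + 1)) x₀).symm)
    (contMDiffAt_chart_symm (hz t ht).1) hpos).contMDiffWithinAt

lemma chartComp_velocity (hz : IsChartGeodesicOn g x₀ z s) (hs : IsOpen s) (ht : t ∈ s) :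
    chartComp x₀ (velocity (fun t => (extChartAt (𝓡 (n + 1)) x₀).symm (z t).1) t) = (z t).2 := by
  have hvel := hasDerivAt_chart_comp (x₀ := x₀)
    (((hz.contMDiffOn hs).contMDiffAt (hs.mem_nhds ht)).mdifferentiableAt (by simp))
    ((extChartAt (𝓡 (n + 1)) x₀).map_target (hz t ht).1)
  refine hvel.unique ((hz.hasDerivAt_fst ht).congr_of_eventuallyEq ?_)
  filter_upwards [hs.mem_nhds ht] with τ hτ
  exact (extChartAt (𝓡 (n + 1)) x₀).right_inv (hz τ hτ).1

lemma isGeodesicOn (hz : IsChartGeodesicOn g x₀ z s) (hs : IsOpen s) :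
    IsGeodesicOn g (fun t => (extChartAt (𝓡 (n + 1)) x₀).symm (z t).1) s := by
  refine ⟨hz.contMDiffOn hs, (isParallelOn_iff g).2 fun t ht x₁ hx₁ => ?_⟩
  refine hasDerivAt_chartComp_of_chart g
    (((hz.contMDiffOn hs).contMDiffAt (hs.mem_nhds ht)).mdifferentiableAt (by simp))
    ((extChartAt (𝓡 (n + 1)) x₀).map_target (hz t ht).1) hx₁ ?_
  rw [hz.chartComp_velocity hs ht, (extChartAt (𝓡 (n + 1)) x₀).right_inv (hz t ht).1]
  refine (hz.hasDerivAt_snd ht).congr_of_eventuallyEq ?_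
  filter_upwards [hs.mem_nhds ht] with τ hτ
  exact hz.chartComp_velocity hs hτ

lemma eventuallyEq {z₁ z₂ : ℝ → Coord n × Coord n} (hs : s ∈ 𝓝 t)
    (hz₁ : IsChartGeodesicOn g x₀ z₁ s) (hz₂ : IsChartGeodesicOn g x₀ z₂ s) (heq : z₁ t = z₂ t) :
    z₁ =ᶠ[𝓝 t] z₂ := by
  have ht := mem_of_mem_nhds hs
  have hfield : ContDiffAt ℝ ∞ (geodesicField (connOf (chartMetric g x₀))) (z₁ t) :=
    contDiffAt_geodesicField ((isMetricOn_chartMetric g x₀).contDiffAt_connOf (hz₁ t ht).1)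
  obtain ⟨K, u, hu, hK⟩ := (hfield.of_le (m := 1) ENat.LEInfty.out).exists_lipschitzOnWith
  refine ODE_solution_unique_of_eventually (s := fun _ => u)
    (v := fun _ => geodesicField (connOf (chartMetric g x₀))) (Filter.Eventually.of_forall
      fun _ => hK) ?_ ?_ heq
  · filter_upwards [hs, (hz₁ t ht).2.continuousAt.eventually_mem hu] with τ hτ hτu
    exact ⟨(hz₁ τ hτ).2, hτu⟩
  · filter_upwards [hs, (hz₂ t ht).2.continuousAt.eventually_mem (heq ▸ hu)] with τ hτ hτu
    exact ⟨(hz₂ τ hτ).2, hτu⟩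

end IsChartGeodesicOn

namespace IsGeodesicOn

variable {c c₁ c₂ : ℝ → M}

lemma mono {s' : Set ℝ} (hc : IsGeodesicOn g c s) (hss : s' ⊆ s) : IsGeodesicOn g c s' :=
  ⟨hc.1.mono hss, fun t ht => hc.2 t (hss ht)⟩

lemma mdifferentiableAt (hc : IsGeodesicOn g c s) (hs : IsOpen s) (ht : t ∈ s) :
    MDifferentiableAt 𝓘(ℝ, ℝ) (𝓡 (n + 1)) c t :=
  (hc.1.contMDiffAt (hs.mem_nhds ht)).mdifferentiableAt (by simp)

lemma eventually_mem_source (hc : IsGeodesicOn g c s) (hs : IsOpen s) (ht : t ∈ s)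
    (hct : c t ∈ (extChartAt (𝓡 (n + 1)) x₀).source) :
    ∀ᶠ τ in 𝓝 t, c τ ∈ (extChartAt (𝓡 (n + 1)) x₀).source :=
  (hc.mdifferentiableAt hs ht).continuousAt.eventually_mem
    ((isOpen_extChartAt_source x₀).mem_nhds hct)

lemma isChartGeodesicOn (hs : IsOpen s) (hc : IsGeodesicOn g c s) (x₀ : M) :
    IsChartGeodesicOn g x₀ (fun t => (extChartAt (𝓡 (n + 1)) x₀ (c t), chartComp x₀ (velocity c t)))
      (s ∩ c ⁻¹' (extChartAt (𝓡 (n + 1)) x₀).source) := fun t ht =>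
  ⟨(extChartAt (𝓡 (n + 1)) x₀).map_source ht.2,
    (hasDerivAt_chart_comp (hc.mdifferentiableAt hs ht.1) ht.2).prodMk
      ((isParallelOn_iff g).1 hc.2 t ht.1 x₀ ht.2)⟩

lemma eventuallyEq (hs : IsOpen s) (hc₁ : IsGeodesicOn g c₁ s) (hc₂ : IsGeodesicOn g c₂ s)
    (ht : t ∈ s) (hx₀ : c₁ t ∈ (extChartAt (𝓡 (n + 1)) x₀).source) (hpt : c₁ t = c₂ t)
    (hvel : chartComp x₀ (velocity (n := n) c₁ t) = chartComp x₀ (velocity (n := n) c₂ t)) :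
    c₁ =ᶠ[𝓝 t] c₂ := by
  have hmem := (hs.eventually_mem ht).and
    ((hc₁.eventually_mem_source hs ht hx₀).and (hc₂.eventually_mem_source hs ht (hpt ▸ hx₀)))
  have heq := IsChartGeodesicOn.eventuallyEq hmem
    (fun τ hτ => hc₁.isChartGeodesicOn hs x₀ τ ⟨hτ.1, hτ.2.1⟩)
    (fun τ hτ => hc₂.isChartGeodesicOn hs x₀ τ ⟨hτ.1, hτ.2.2⟩) (by simp only [hvel, hpt])
  filter_upwards [heq, hmem] with τ hτ hm
  exact (extChartAt (𝓡 (n + 1)) x₀).injOn hm.2.1 hm.2.2 (congrArg Prod.fst hτ)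

lemma eventuallyEq_of_frequently [T2Space M] (hs : IsOpen s) (hc₁ : IsGeodesicOn g c₁ s)
    (hc₂ : IsGeodesicOn g c₂ s) (ht : t ∈ s) (hfreq : ∃ᶠ τ in 𝓝 t, c₁ =ᶠ[𝓝 τ] c₂) :
    c₁ =ᶠ[𝓝 t] c₂ := by
  have hpt : c₁ t = c₂ t := tendsto_nhds_unique_of_frequently_eq
    (hc₁.mdifferentiableAt hs ht).continuousAt (hc₂.mdifferentiableAt hs ht).continuousAt
    (hfreq.mono fun τ hτ => hτ.eq_of_nhds)
  have hct := mem_extChartAt_source (I := 𝓡 (n + 1)) (c₁ t)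
  refine hc₁.eventuallyEq hs hc₂ ht hct hpt <| tendsto_nhds_unique_of_frequently_eq
    ((isParallelOn_iff g).1 hc₁.2 t ht (c₁ t) hct).continuousAt
    ((isParallelOn_iff g).1 hc₂.2 t ht (c₁ t) (hpt ▸ hct)).continuousAt ?_
  refine (hfreq.and_eventually ((hs.eventually_mem ht).and
    (hc₁.eventually_mem_source hs ht hct))).mono fun τ ⟨hτ, hτs, hτc⟩ => ?_
  have hvel₁ := hasDerivAt_chart_comp (hc₁.mdifferentiableAt hs hτs) hτc
  have hvel₂ := hasDerivAt_chart_comp (hc₂.mdifferentiableAt hs hτs) (hτ.eq_of_nhds ▸ hτc)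
  exact hvel₁.unique (hvel₂.congr_of_eventuallyEq (hτ.fun_comp _))

theorem eqOn [T2Space M] (hs : IsOpen s) (hconn : IsPreconnected s) (hc₁ : IsGeodesicOn g c₁ s)
    (hc₂ : IsGeodesicOn g c₂ s) {t₀ : ℝ} (ht₀ : t₀ ∈ s)
    (h₀ : (⟨c₁ t₀, velocity c₁ t₀⟩ : TangentBundle (𝓡 (n + 1)) M) = ⟨c₂ t₀, velocity c₂ t₀⟩) :
    EqOn c₁ c₂ s := by
  have hopen : IsOpen {t | c₁ =ᶠ[𝓝 t] c₂} :=
    isOpen_iff_mem_nhds.2 fun t (ht : c₁ =ᶠ[𝓝 t] c₂) => ht.eventually_nhds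
  have hstart : c₁ =ᶠ[𝓝 t₀] c₂ :=
    hc₁.eventuallyEq hs hc₂ ht₀ (x₀ := c₁ t₀) (mem_extChartAt_source _)
      (congrArg Bundle.TotalSpace.proj h₀)
      (congrArg (fun q : TangentBundle (𝓡 (n + 1)) M => chartComp (c₁ t₀) q.2) h₀)
  have hsub : s ⊆ {t | c₁ =ᶠ[𝓝 t] c₂} :=
    hconn.subset_of_closure_inter_subset hopen ⟨t₀, ht₀, hstart⟩ fun t ht =>
      hc₁.eventuallyEq_of_frequently hs hc₂ ht.2 (mem_closure_iff_frequently.1 ht.1)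
  exact fun t ht => (hsub ht).eq_of_nhds

end IsGeodesicOn

lemma geodesicExp_eq [T2Space M] {c : ℝ → M} {ε : ℝ} (hε : 0 < ε)
    (hc : IsGeodesicOn g c (Ioo (-ε) (1 + ε))) {p : M} {v : TangentSpace (𝓡 (n + 1)) p}
    (h₀ : (⟨c 0, velocity c 0⟩ : TangentBundle (𝓡 (n + 1)) M) = ⟨p, v⟩) :
    geodesicExp g p v = c 1 := by
  have hex : ∃ c : ℝ → M, (∃ ε > 0, IsGeodesicOn g c (Set.Ioo (-ε) (1 + ε))) ∧
      (⟨c 0, velocity c 0⟩ : TangentBundle (𝓡 (n + 1)) M) = ⟨p, v⟩ := ⟨c, ⟨ε, hε, hc⟩, h₀⟩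
  rw [geodesicExp, dif_pos hex]
  obtain ⟨⟨ε', hε', hc'⟩, h₀'⟩ := hex.choose_spec
  have hmin : 0 < min ε ε' := lt_min hε hε'
  have hsub : ∀ δ, min ε ε' ≤ δ → Ioo (-(min ε ε')) (1 + min ε ε') ⊆ Ioo (-δ) (1 + δ) :=
    fun δ hδ => Ioo_subset_Ioo (by linarith) (by linarith)
  exact (hc'.mono (hsub ε' (min_le_right _ _))).eqOn isOpen_Ioo isPreconnected_Ioo
    (hc.mono (hsub ε (min_le_left _ _))) (t₀ := 0) ⟨by linarith, by linarith⟩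
    (h₀'.trans h₀.symm) ⟨by linarith, by linarith⟩

lemma tangentBundle_ext {x p : M} (hp : p ∈ (extChartAt (𝓡 (n + 1)) x₀).source)
    {w : TangentSpace (𝓡 (n + 1)) x} {v : TangentSpace (𝓡 (n + 1)) p} (hx : x = p)
    (h : chartComp x₀ w = chartComp x₀ v) :
    (⟨x, w⟩ : TangentBundle (𝓡 (n + 1)) M) = ⟨p, v⟩ := by
  subst hx
  rw [chartComp_injective hp h]

lemma exists_Ioo_subset_mul_mem {r : ℝ} (hr : r ∈ Ioo (-1 : ℝ) 2) :
    ∃ ε > 0, Ioo (-ε) (1 + ε) ⊆ {t : ℝ | r * t ∈ Ioo (-1 : ℝ) 2} := by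
  have hpos : 0 < min (2 - r) (1 + r) := lt_min (by linarith [hr.2]) (by linarith [hr.1])
  have hle₁ := min_le_left (2 - r) (1 + r)
  have hle₂ := min_le_right (2 - r) (1 + r)
  refine ⟨min (2 - r) (1 + r) / 4, by linarith, fun t ht => ?_⟩
  rcases le_total 0 r with h | h
  · exact ⟨by nlinarith [ht.1, ht.2, hr.2], by nlinarith [ht.1, ht.2, hr.2]⟩
  · exact ⟨by nlinarith [ht.1, ht.2, hr.1], by nlinarith [ht.1, ht.2, hr.1]⟩

lemma IsChartGeodesicOn.geodesicExp_smul_eq [T2Space M] {z : ℝ → Coord n × Coord n}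
    (hz : IsChartGeodesicOn g x₀ z (Ioo (-1) 2)) {p : M}
    (hp : p ∈ (extChartAt (𝓡 (n + 1)) x₀).source) {v : TangentSpace (𝓡 (n + 1)) p}
    (hz₀ : z 0 = (extChartAt (𝓡 (n + 1)) x₀ p, chartComp x₀ v)) {r : ℝ}
    (hr : r ∈ Ioo (-1 : ℝ) 2) :
    geodesicExp g p (r • v) = (extChartAt (𝓡 (n + 1)) x₀).symm (z r).1 := by
  have hopen : IsOpen {t : ℝ | r * t ∈ Ioo (-1 : ℝ) 2} :=
    isOpen_Ioo.preimage (continuous_const.mul continuous_id)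
  obtain ⟨ε, hε, hsub⟩ := exists_Ioo_subset_mul_mem hr
  have hexp := geodesicExp_eq hε (((hz.scale r).isGeodesicOn hopen).mono hsub) (p := p)
    (v := r • v) <| tangentBundle_ext hp
      (by simpa only [mul_zero, hz₀] using (extChartAt (𝓡 (n + 1)) x₀).left_inv hp) (by
        rw [(hz.scale r).chartComp_velocity hopen (by simp), chartComp_smul]
        simp [hz₀])
  rwa [mul_one] at hexp

end Geodesics

section FermiChart

open Topology Set

variable {n : ℕ}

/-- The multiple `r ξ` of `ξ` in the coordinates normal to the axis; the first coordinate is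
kept. -/
def radial (r : ℝ) (ξ : Coord n) : Coord n := ξ 0 • basisVec 0 + r • (ξ - ξ 0 • basisVec 0)

@[simp] lemma radial_zero_coord (r : ℝ) (ξ : Coord n) : radial r ξ 0 = ξ 0 := by
  simp [radial, basisVec_apply]

@[simp] lemma radial_succ_coord (r : ℝ) (ξ : Coord n) (m : Fin n) :
    radial r ξ m.succ = r * ξ m.succ := by
  simp [radial, basisVec_apply]

@[simp] lemma radial_one (ξ : Coord n) : radial 1 ξ = ξ := by simp [radial]

lemma radial_zero (ξ : Coord n) : radial 0 ξ = axis n (ξ 0) := by simp [radial, axis]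

@[simp] lemma axis_zero_coord (s : ℝ) : axis n s 0 = s := by simp [axis, basisVec_apply]

@[simp] lemma axis_succ_coord (s : ℝ) (m : Fin n) : axis n s m.succ = 0 := by
  simp [axis, basisVec_apply]

lemma contDiff_coord (i : Fin (n + 1)) : ContDiff ℝ ∞ (fun ξ : Coord n => ξ i) :=
  (EuclideanSpace.proj i : Coord n →L[ℝ] ℝ).contDiff

lemma contDiff_radial : ContDiff ℝ ∞ (fun p : ℝ × Coord n => radial p.1 p.2) := by
  have hbase : ContDiff ℝ ∞ (fun p : ℝ × Coord n => p.2 0 • (basisVec 0 : Coord n)) :=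
    ((contDiff_coord 0).comp contDiff_snd).smul contDiff_const
  exact hbase.add (contDiff_fst.smul (contDiff_snd.sub hbase))

variable {M : Type*} [TopologicalSpace M] [ChartedSpace (Coord n) M]

/-- Initial velocity, in the chart around `x₀`, of the geodesics normal to `γ`. -/
def normalVec {γ : ℝ → M} (e : Fin (n + 1) → ∀ t, TangentSpace (𝓡 (n + 1)) (γ t)) (x₀ : M)
    (ξ : Coord n) : Coord n := ∑ m : Fin n, ξ m.succ • chartComp x₀ (e m.succ (ξ 0))

lemma chartComp_sum_smul {γ : ℝ → M} {e : Fin (n + 1) → ∀ t, TangentSpace (𝓡 (n + 1)) (γ t)}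
    (x₀ : M) (ξ : Coord n) :
    chartComp x₀ (∑ m : Fin n, ξ m.succ • e m.succ (ξ 0)) = normalVec e x₀ ξ := by
  simp only [normalVec, chartComp, map_sum, map_smul]
  rfl

variable [IsManifold (𝓡 (n + 1)) ∞ M]

theorem exists_chart_geodesic_flow (g : Metric n M) (x₀ : M) :
    ∃ S : Coord n × Coord n → ℝ → Coord n × Coord n,
      ∀ᶠ z in 𝓝 (extChartAt (𝓡 (n + 1)) x₀ x₀, (0 : Coord n)), S z 0 = z ∧
        IsChartGeodesicOn g x₀ (S z) (Ioo (-1) 2) ∧ ContDiffAt ℝ ∞ (fun w => S w 1) z := by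
  have hU : {z : Coord n × Coord n | z.1 ∈ (extChartAt (𝓡 (n + 1)) x₀).target} ∈
      𝓝 (extChartAt (𝓡 (n + 1)) x₀ x₀, (0 : Coord n)) :=
    continuous_fst.continuousAt.preimage_mem_nhds
      ((isMetricOn_chartMetric g x₀).isOpen.mem_nhds (mem_extChartAt_target x₀))
  obtain ⟨S, hS⟩ := exists_smooth_flow_near_zero (a := -1) (b := 2)
    (f := geodesicField (connOf (chartMetric g x₀))) (by simp [geodesicField]) hU
    (fun z hz => contDiffAt_geodesicField ((isMetricOn_chartMetric g x₀).contDiffAt_connOf hz))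
    ⟨0, by norm_num⟩
  exact ⟨S, hS.mono fun z hz =>
    ⟨hz.1, fun t ht => ⟨(hz.2 t ht).1, (hz.2 t ht).2.1⟩, (hz.2 1 (by norm_num)).2.2⟩⟩

variable {g : Metric n M} {γ : ℝ → M} {e : Fin (n + 1) → ∀ t, TangentSpace (𝓡 (n + 1)) (γ t)}

lemma fermiMap_radial (r : ℝ) (ξ : Coord n) :
    fermiMap g γ e (radial r ξ) =
      geodesicExp g (γ (ξ 0)) (r • ∑ m : Fin n, ξ m.succ • e m.succ (ξ 0)) := by
  have hgen : ∀ s, s = ξ 0 → geodesicExp g (γ s) (∑ m : Fin n, radial r ξ m.succ • e m.succ s) =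
      geodesicExp g (γ (ξ 0)) (r • ∑ m : Fin n, ξ m.succ • e m.succ (ξ 0)) := by
    rintro s rfl
    simp only [radial_succ_coord, Finset.smul_sum, smul_smul]
  exact hgen _ (radial_zero_coord r ξ)

section Frame

variable {x₀ : M} {t : ℝ}

lemma hasDerivAt_frame (he : IsParallelFrame g γ e)
    (ht : γ t ∈ (extChartAt (𝓡 (n + 1)) x₀).source) (i : Fin (n + 1)) :
    HasDerivAt (fun τ => chartComp x₀ (e i τ))
      (-connOf (chartMetric g x₀) (extChartAt (𝓡 (n + 1)) x₀ (γ t)) (chartComp x₀ (e 0 t))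
        (chartComp x₀ (e i t))) t := by
  rw [he.first]
  exact (isParallelOn_iff g).1 (he.parallel i) t (mem_univ t) x₀ ht

variable (hγ : IsGeodesicOn g γ univ)
include hγ

lemma isOpen_preimage_chart (x₀ : M) : IsOpen (γ ⁻¹' (extChartAt (𝓡 (n + 1)) x₀).source) :=
  (isOpen_extChartAt_source x₀).preimage (contMDiffOn_univ.1 hγ.1).continuous

variable (he : IsParallelFrame g γ e)
include he

lemma hasDerivAt_base (ht : γ t ∈ (extChartAt (𝓡 (n + 1)) x₀).source) :
    HasDerivAt (fun τ => extChartAt (𝓡 (n + 1)) x₀ (γ τ)) (chartComp x₀ (e 0 t)) t := by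
  rw [he.first]
  exact hasDerivAt_chart_comp (hγ.mdifferentiableAt isOpen_univ (mem_univ t)) ht

lemma contDiffAt_base_frame (ht : γ t ∈ (extChartAt (𝓡 (n + 1)) x₀).source) (i : Fin (n + 1)) :
    ContDiffAt ℝ ∞ (fun τ => (extChartAt (𝓡 (n + 1)) x₀ (γ τ), chartComp x₀ (e 0 τ),
      chartComp x₀ (e i τ))) t := by
  have hopen := isOpen_preimage_chart hγ x₀
  refine (contDiffOn_of_hasDerivAt hopen (F := fun p => (p.2.2.1,
    -connOf (chartMetric g x₀) p.2.1 p.2.2.1 p.2.2.1,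
    -connOf (chartMetric g x₀) p.2.1 p.2.2.1 p.2.2.2)) (fun τ hτ => ?_) fun τ hτ =>
      (hasDerivAt_base hγ he hτ).prodMk ((hasDerivAt_frame he hτ 0).prodMk
        (hasDerivAt_frame he hτ i))).contDiffAt (hopen.mem_nhds ht)
  have hconn := (isMetricOn_chartMetric g x₀).contDiffAt_connOf
    ((extChartAt (𝓡 (n + 1)) x₀).map_source hτ)
  have hbilin {X Y : ℝ × Coord n × Coord n × Coord n → Coord n} (hX : ContDiff ℝ ∞ X)
      (hY : ContDiff ℝ ∞ Y) := contDiffAt_apply_apply_comp (Φ := fun p => p.2.1)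
    (q := (τ, extChartAt (𝓡 (n + 1)) x₀ (γ τ), chartComp x₀ (e 0 τ), chartComp x₀ (e i τ)))
    hconn (by fun_prop) hX.contDiffAt hY.contDiffAt
  exact ContDiffAt.prodMk (by fun_prop) ((hbilin (by fun_prop) (by fun_prop)).neg.prodMk
    (hbilin (by fun_prop) (by fun_prop)).neg)

omit he in
lemma frame_orthonormal (he : IsParallelFrame g γ e) (t : ℝ) (i j : Fin (n + 1)) :
    g.inner (γ t) (e i t) (e j t) = if i = j then 1 else 0 := by
  rw [← he.orthonormal i j]
  suffices hd : ∀ t, HasDerivAt (fun τ => g.inner (γ τ) (e i τ) (e j τ)) 0 t from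
    is_const_of_deriv_eq_zero (fun t => (hd t).differentiableAt) (fun t => (hd t).deriv) t 0
  intro t
  have ht := mem_extChartAt_source (I := 𝓡 (n + 1)) (γ t)
  have htarget := (extChartAt (𝓡 (n + 1)) (γ t)).map_source ht
  have hL := isLeviCivitaOn_chart g (γ t)
  have hform : HasDerivAt
      (fun τ => formOf (chartMetric g (γ t)) (extChartAt (𝓡 (n + 1)) (γ t) (γ τ)))
      (fderiv ℝ (formOf (chartMetric g (γ t))) (extChartAt (𝓡 (n + 1)) (γ t) (γ t))
        (chartComp (γ t) (e 0 t))) t :=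
    HasFDerivAt.comp_hasDerivAt (l := formOf (chartMetric g (γ t))) t
      ((hL.metric_contDiffAt _ htarget).differentiableAt (by simp)).hasFDerivAt
      (hasDerivAt_base hγ he ht)
  have hinner := (hform.clm_apply (hasDerivAt_frame he ht i)).clm_apply (hasDerivAt_frame he ht j)
  refine (hinner.congr_deriv ?_).congr_of_eventuallyEq ?_
  · simp only [add_apply, map_neg, neg_apply]
    rw [hL.compat _ htarget]
    ring
  · filter_upwards [(isOpen_preimage_chart hγ (γ t)).mem_nhds ht] with τ hτ
    exact inner_eq_formOf g hτ _ _

lemma formOf_frame (ht : γ t ∈ (extChartAt (𝓡 (n + 1)) x₀).source) (i j : Fin (n + 1)) :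
    formOf (chartMetric g x₀) (extChartAt (𝓡 (n + 1)) x₀ (γ t)) (chartComp x₀ (e i t))
      (chartComp x₀ (e j t)) = if i = j then 1 else 0 := by
  rw [← inner_eq_formOf g ht, frame_orthonormal hγ he]

lemma contDiffAt_base_normalVec {ξ : Coord n}
    (hξ : γ (ξ 0) ∈ (extChartAt (𝓡 (n + 1)) x₀).source) :
    ContDiffAt ℝ ∞ (fun η : Coord n => (extChartAt (𝓡 (n + 1)) x₀ (γ (η 0)), normalVec e x₀ η))
      ξ := by
  have hcomp (i : Fin (n + 1)) := ContDiffAt.comp ξ (f := fun η : Coord n => η 0)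
    (contDiffAt_base_frame hγ he hξ i) (contDiff_coord 0).contDiffAt
  exact (hcomp 0).fst.prodMk (ContDiffAt.sum fun m _ =>
    (contDiff_coord m.succ).contDiffAt.smul (hcomp m.succ).snd.snd)

end Frame

/-- On the ball of radius `ε` around `(s₀, 0)` the normal exponential map stays in the chart
around `γ s₀`, where `Z ξ` consists of the positions and velocities of the normal geodesic with
initial velocity given by `ξ`. -/
structure IsFermiBall (g : Metric n M) (γ : ℝ → M)
    (e : Fin (n + 1) → ∀ t, TangentSpace (𝓡 (n + 1)) (γ t)) (s₀ ε : ℝ)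
    (Z : Coord n → ℝ → Coord n × Coord n) : Prop where
  pos : 0 < ε
  isGeodesicOn : IsGeodesicOn g γ univ
  isParallelFrame : IsParallelFrame g γ e
  base_mem : ∀ ξ ∈ Metric.ball (axis n s₀) ε, γ (ξ 0) ∈ (extChartAt (𝓡 (n + 1)) (γ s₀)).source
  contMDiffAt : ∀ ξ ∈ Metric.ball (axis n s₀) ε,
    ContMDiffAt 𝓘(ℝ, Coord n) (𝓡 (n + 1)) ∞ (fermiMap g γ e) ξ
  geodesic : ∀ ξ ∈ Metric.ball (axis n s₀) ε, IsChartGeodesicOn g (γ s₀) (Z ξ) (Ioo (-1) 2)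
  init : ∀ ξ ∈ Metric.ball (axis n s₀) ε,
    Z ξ 0 = (extChartAt (𝓡 (n + 1)) (γ s₀) (γ (ξ 0)), normalVec e (γ s₀) ξ)
  eq_symm : ∀ ξ ∈ Metric.ball (axis n s₀) ε, ∀ r ∈ Ioo (-1 : ℝ) 2, fermiMap g γ e (radial r ξ) =
    (extChartAt (𝓡 (n + 1)) (γ s₀)).symm (Z ξ r).1

theorem exists_isFermiBall [T2Space M] (hγ : IsGeodesicOn g γ univ) (he : IsParallelFrame g γ e)
    (s₀ : ℝ) : ∃ ε Z, IsFermiBall g γ e s₀ ε Z := by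
  obtain ⟨S, hS⟩ := exists_chart_geodesic_flow g (γ s₀)
  let z₀ : Coord n → Coord n × Coord n := fun ξ =>
    (extChartAt (𝓡 (n + 1)) (γ s₀) (γ (ξ 0)), normalVec e (γ s₀) ξ)
  have hbase : ∀ᶠ ξ in 𝓝 (axis n s₀), γ (ξ 0) ∈ (extChartAt (𝓡 (n + 1)) (γ s₀)).source :=
    (contDiff_coord 0).continuous.continuousAt.eventually_mem
      ((isOpen_preimage_chart hγ (γ s₀)).mem_nhds (by simp))
  have hz₀ : z₀ (axis n s₀) = (extChartAt (𝓡 (n + 1)) (γ s₀) (γ s₀), 0) := by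
    simp [z₀, normalVec]
  have hflow := (contDiffAt_base_normalVec hγ he hbase.self_of_nhds).continuousAt.eventually
    (hz₀ ▸ hS)
  have hexp : ∀ᶠ ξ in 𝓝 (axis n s₀), ∀ r ∈ Ioo (-1 : ℝ) 2, fermiMap g γ e (radial r ξ) =
      (extChartAt (𝓡 (n + 1)) (γ s₀)).symm (S (z₀ ξ) r).1 := by
    filter_upwards [hbase, hflow] with ξ hξ ⟨hinit, hgeo, _⟩ r hr
    rw [fermiMap_radial]
    exact hgeo.geodesicExp_smul_eq hξ (by rw [hinit, chartComp_sum_smul]) hr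
  have hone : (1 : ℝ) ∈ Ioo (-1 : ℝ) 2 := by norm_num
  have hsmooth : ∀ᶠ ξ in 𝓝 (axis n s₀),
      ContMDiffAt 𝓘(ℝ, Coord n) (𝓡 (n + 1)) ∞ (fermiMap g γ e) ξ := by
    filter_upwards [hbase, hflow, hexp.eventually_nhds] with ξ hξ ⟨_, hgeo, hS₁⟩ hexpξ
    have hpos : ContDiffAt ℝ ∞ (fun η => (S (z₀ η) 1).1) ξ :=
      (ContDiffAt.comp ξ (g := fun w => S w 1) (f := z₀) hS₁
        (contDiffAt_base_normalVec hγ he hξ)).fst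
    refine (ContMDiffAt.comp ξ (g := (extChartAt (𝓡 (n + 1)) (γ s₀)).symm)
      (contMDiffAt_chart_symm (hgeo 1 hone).1) hpos.contMDiffAt).congr_of_eventuallyEq ?_
    filter_upwards [hexpξ] with η hη
    rw [Function.comp_apply, ← hη 1 hone, radial_one]
  obtain ⟨ε, hε, hball⟩ := Metric.eventually_nhds_iff_ball.1
    (hbase.and (hsmooth.and (hflow.and hexp)))
  exact ⟨ε, fun ξ => S (z₀ ξ), hε, hγ, he, fun ξ hξ => (hball ξ hξ).1,
    fun ξ hξ => (hball ξ hξ).2.1, fun ξ hξ => (hball ξ hξ).2.2.1.2.1,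
    fun ξ hξ => (hball ξ hξ).2.2.1.1, fun ξ hξ => (hball ξ hξ).2.2.2⟩

end FermiChart

section FermiMetric

open Topology Set

variable {n : ℕ}

lemma dist_axis_sq (ξ : Coord n) (s : ℝ) :
    dist ξ (axis n s) ^ 2 = (ξ 0 - s) ^ 2 + ∑ m : Fin n, ξ m.succ ^ 2 := by
  rw [EuclideanSpace.dist_eq, Real.sq_sqrt (Finset.sum_nonneg fun _ _ => sq_nonneg _),
    Fin.sum_univ_succ]
  simp [Real.dist_eq, sq_abs]

lemma radial_mem_ball {s ε r : ℝ} (hr : r ^ 2 ≤ 1) {ξ : Coord n}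
    (hξ : ξ ∈ Metric.ball (axis n s) ε) : radial r ξ ∈ Metric.ball (axis n s) ε := by
  refine lt_of_le_of_lt ((sq_le_sq₀ dist_nonneg dist_nonneg).1 ?_) hξ
  simp only [dist_axis_sq, radial_zero_coord, radial_succ_coord, mul_pow]
  gcongr with m
  exact mul_le_of_le_one_left (sq_nonneg _) hr

lemma hasDerivAt_axis (s : ℝ) : HasDerivAt (axis n) (basisVec 0) s :=
  ((hasDerivAt_id s).smul_const (basisVec 0 : Coord n)).congr_deriv (one_smul _ _)

lemma hasDerivAt_radial (ξ : Coord n) (r : ℝ) :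
    HasDerivAt (fun τ => radial τ ξ) (ξ - ξ 0 • basisVec 0) r :=
  (((hasDerivAt_id r).smul_const _).const_add _).congr_deriv (one_smul _ _)

lemma fderiv_prodMk_right {F H : Type*} [NormedAddCommGroup F] [NormedSpace ℝ F]
    [NormedAddCommGroup H] [NormedSpace ℝ H] {f : ℝ × F → H} {t : ℝ} {ξ : F}
    (hf : DifferentiableAt ℝ f (t, ξ)) (a : F) :
    fderiv ℝ f (t, ξ) (0, a) = fderiv ℝ (fun η => f (t, η)) ξ a := by
  have hslice : HasFDerivAt (fun η => f (t, η)) _ ξ :=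
    HasFDerivAt.comp ξ (g := f) hf.hasFDerivAt (hasFDerivAt_prodMk_right t ξ)
  rw [hslice.fderiv]
  simp

variable {M : Type*} [TopologicalSpace M] [ChartedSpace (Coord n) M]

lemma normalVec_axis_add_smul {γ : ℝ → M}
    (e : Fin (n + 1) → ∀ t, TangentSpace (𝓡 (n + 1)) (γ t)) (x₀ : M) (s c : ℝ) (m : Fin n) :
    normalVec e x₀ (axis n s + c • basisVec m.succ) = c • chartComp x₀ (e m.succ s) := by
  have hgen : ∀ τ, τ = s → ∑ k : Fin n, (axis n s + c • basisVec m.succ) k.succ •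
      chartComp x₀ (e k.succ τ) = c • chartComp x₀ (e m.succ s) := by
    rintro _ rfl
    simp [basisVec_apply]
  exact hgen _ (by simp [basisVec_apply, (Fin.succ_ne_zero m).symm])

variable [IsManifold (𝓡 (n + 1)) ∞ M]

/-- The normal exponential map in the chart around `x₀`. -/
def fermiChart (g : Metric n M) (γ : ℝ → M) (e : Fin (n + 1) → ∀ t, TangentSpace (𝓡 (n + 1)) (γ t))
    (x₀ : M) (ξ : Coord n) : Coord n := extChartAt (𝓡 (n + 1)) x₀ (fermiMap g γ e ξ)

/-- The family of geodesics normal to `γ`, in the chart around `x₀`: for fixed `p.2` it is a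
geodesic with parameter `p.1`, and at time `1` it is the normal exponential map. -/
def normalFamily (g : Metric n M) (γ : ℝ → M)
    (e : Fin (n + 1) → ∀ t, TangentSpace (𝓡 (n + 1)) (γ t)) (x₀ : M) (p : ℝ × Coord n) : Coord n :=
  fermiChart g γ e x₀ (radial p.1 p.2)

namespace IsFermiBall

/-- The parameters `(t, ξ)` for which both `ξ` and `radial t ξ` lie in the ball around
`(s₀, 0)`. -/
def domain (n : ℕ) (s₀ ε : ℝ) : Set (ℝ × Coord n) :=
  {p | p.1 ∈ Ioo (-1 : ℝ) 2 ∧ p.2 ∈ Metric.ball (axis n s₀) ε ∧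
    radial p.1 p.2 ∈ Metric.ball (axis n s₀) ε}

lemma isOpen_domain (n : ℕ) (s₀ ε : ℝ) : IsOpen (domain n s₀ ε) :=
  (isOpen_Ioo.preimage continuous_fst).inter ((Metric.isOpen_ball.preimage continuous_snd).inter
    (Metric.isOpen_ball.preimage contDiff_radial.continuous))

lemma mem_domain {s₀ ε : ℝ} {ξ : Coord n} (hξ : ξ ∈ Metric.ball (axis n s₀) ε) {t : ℝ}
    (ht : t ∈ Icc (0 : ℝ) 1) : (t, ξ) ∈ domain n s₀ ε :=
  ⟨⟨by linarith [ht.1], by linarith [ht.2]⟩, hξ, radial_mem_ball (by nlinarith [ht.1, ht.2]) hξ⟩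

variable {g : Metric n M} {γ : ℝ → M} {e : Fin (n + 1) → ∀ t, TangentSpace (𝓡 (n + 1)) (γ t)}
  {s₀ ε : ℝ} {Z : Coord n → ℝ → Coord n × Coord n} {ξ : Coord n}
  (h : IsFermiBall g γ e s₀ ε Z)
include h

lemma axis_mem : axis n s₀ ∈ Metric.ball (axis n s₀) ε := Metric.mem_ball_self h.pos

lemma normalFamily_eq (hξ : ξ ∈ Metric.ball (axis n s₀) ε) {t : ℝ} (ht : t ∈ Ioo (-1 : ℝ) 2) :
    normalFamily g γ e (γ s₀) (t, ξ) = (Z ξ t).1 := by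
  rw [normalFamily, fermiChart, h.eq_symm ξ hξ t ht]
  exact (extChartAt (𝓡 (n + 1)) (γ s₀)).right_inv (h.geodesic ξ hξ t ht).1

lemma mem_source (hξ : ξ ∈ Metric.ball (axis n s₀) ε) :
    fermiMap g γ e ξ ∈ (extChartAt (𝓡 (n + 1)) (γ s₀)).source := by
  have hone : (1 : ℝ) ∈ Ioo (-1 : ℝ) 2 := by norm_num
  rw [← radial_one ξ, h.eq_symm ξ hξ 1 hone]
  exact (extChartAt (𝓡 (n + 1)) (γ s₀)).map_target (h.geodesic ξ hξ 1 hone).1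

lemma mdifferentiableAt (hξ : ξ ∈ Metric.ball (axis n s₀) ε) :
    MDifferentiableAt 𝓘(ℝ, Coord n) (𝓡 (n + 1)) (fermiMap g γ e) ξ :=
  (h.contMDiffAt ξ hξ).mdifferentiableAt (by simp)

lemma contDiffAt_fermiChart (hξ : ξ ∈ Metric.ball (axis n s₀) ε) :
    ContDiffAt ℝ ∞ (fermiChart g γ e (γ s₀)) ξ :=
  contDiffAt_chart_comp (h.contMDiffAt ξ hξ) (h.mem_source hξ)

lemma differentiableAt_fermiChart (hξ : ξ ∈ Metric.ball (axis n s₀) ε) :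
    DifferentiableAt ℝ (fermiChart g γ e (γ s₀)) ξ :=
  (h.contDiffAt_fermiChart hξ).differentiableAt (by simp)

lemma contDiffAt_normalFamily {p : ℝ × Coord n} (hp : p ∈ domain n s₀ ε) :
    ContDiffAt ℝ ∞ (normalFamily g γ e (γ s₀)) p :=
  ContDiffAt.comp p (g := fermiChart g γ e (γ s₀)) (f := fun p : ℝ × Coord n => radial p.1 p.2)
    (h.contDiffAt_fermiChart hp.2.2) contDiff_radial.contDiffAt

lemma differentiableAt_normalFamily {p : ℝ × Coord n} (hp : p ∈ domain n s₀ ε) :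
    DifferentiableAt ℝ (normalFamily g γ e (γ s₀)) p :=
  (h.contDiffAt_normalFamily hp).differentiableAt (by simp)

lemma velocityField_eq {p : ℝ × Coord n} (hp : p ∈ domain n s₀ ε) :
    velocityField (normalFamily g γ e (γ s₀)) p = (Z p.2 p.1).2 := by
  refine (hasDerivAt_slice (h.differentiableAt_normalFamily hp)).unique
    (((h.geodesic p.2 hp.2.1).hasDerivAt_fst hp.1).congr_of_eventuallyEq ?_)
  filter_upwards [isOpen_Ioo.mem_nhds hp.1] with τ hτ
  exact h.normalFamily_eq hp.2.1 hτ

lemma differentiableAt_velocityField {p : ℝ × Coord n} (hp : p ∈ domain n s₀ ε) :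
    DifferentiableAt ℝ (velocityField (normalFamily g γ e (γ s₀))) p :=
  (contDiffAt_fderiv_apply (h.contDiffAt_normalFamily hp) _).differentiableAt (by simp)

lemma cov_velocityField_eq_zero {p : ℝ × Coord n} (hp : p ∈ domain n s₀ ε) :
    cov (connOf (chartMetric g (γ s₀))) (normalFamily g γ e (γ s₀)) (1, 0)
      (velocityField (normalFamily g γ e (γ s₀))) p = 0 := by
  have hvel : (fun τ => velocityField (normalFamily g γ e (γ s₀)) (τ, p.2)) =ᶠ[𝓝 p.1]
      fun τ => (Z p.2 τ).2 := by
    have hcont : ContinuousAt (fun τ : ℝ => (τ, p.2)) p.1 := by fun_prop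
    filter_upwards [hcont.eventually_mem ((isOpen_domain n s₀ ε).mem_nhds hp)] with τ hτ
    exact h.velocityField_eq hτ
  have hacc := (hasDerivAt_slice (h.differentiableAt_velocityField hp)).unique
    (((h.geodesic p.2 hp.2.1).hasDerivAt_snd hp.1).congr_of_eventuallyEq hvel)
  have hdir : fderiv ℝ (normalFamily g γ e (γ s₀)) p (1, 0) = (Z p.2 p.1).2 := h.velocityField_eq hp
  rw [cov, hacc, hdir, h.velocityField_eq hp, h.normalFamily_eq hp.2.1 hp.1]
  exact neg_add_cancel _

lemma isGeodesicFamilyAt (hξ : ξ ∈ Metric.ball (axis n s₀) ε) :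
    IsGeodesicFamilyAt (connOf (chartMetric g (γ s₀))) (extChartAt (𝓡 (n + 1)) (γ s₀)).target
      (normalFamily g γ e (γ s₀)) ξ := by
  intro t ht
  have hnhds := (isOpen_domain n s₀ ε).mem_nhds (mem_domain hξ ht)
  refine ⟨?_, Filter.mem_of_superset hnhds fun p hp => h.contDiffAt_normalFamily hp,
    Filter.mem_of_superset hnhds fun p hp => h.cov_velocityField_eq_zero hp⟩
  rw [h.normalFamily_eq hξ (mem_domain hξ ht).1]
  exact (h.geodesic ξ hξ t (mem_domain hξ ht).1).1

lemma normalFamily_zero (hξ : ξ ∈ Metric.ball (axis n s₀) ε) :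
    normalFamily g γ e (γ s₀) (0, ξ) = extChartAt (𝓡 (n + 1)) (γ s₀) (γ (ξ 0)) := by
  rw [h.normalFamily_eq hξ (by norm_num), h.init ξ hξ]

lemma velocityField_zero (hξ : ξ ∈ Metric.ball (axis n s₀) ε) :
    velocityField (normalFamily g γ e (γ s₀)) (0, ξ) = normalVec e (γ s₀) ξ := by
  rw [h.velocityField_eq (mem_domain hξ (by simp)), h.init ξ hξ]

lemma jacobiField_zero (hξ : ξ ∈ Metric.ball (axis n s₀) ε) (a : Coord n) :
    jacobiField (normalFamily g γ e (γ s₀)) a (0, ξ) = a 0 • chartComp (γ s₀) (e 0 (ξ 0)) := by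
  have hbase : (fun η => normalFamily g γ e (γ s₀) (0, η)) =ᶠ[𝓝 ξ]
      fun η => extChartAt (𝓡 (n + 1)) (γ s₀) (γ (η 0)) := by
    filter_upwards [Metric.isOpen_ball.mem_nhds hξ] with η hη using h.normalFamily_zero hη
  have hderiv := HasFDerivAt.comp ξ (g := fun τ => extChartAt (𝓡 (n + 1)) (γ s₀) (γ τ))
    (hasDerivAt_base h.isGeodesicOn h.isParallelFrame (h.base_mem ξ hξ)).hasFDerivAt
    (EuclideanSpace.proj 0 : Coord n →L[ℝ] ℝ).hasFDerivAt
  rw [jacobiField, fderiv_prodMk_right (h.differentiableAt_normalFamily (mem_domain hξ (by simp))),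
    (hderiv.congr_of_eventuallyEq hbase).fderiv]
  simp

lemma fderiv_normalVec (hξ : ξ ∈ Metric.ball (axis n s₀) ε) (a : Coord n) :
    fderiv ℝ (normalVec e (γ s₀)) ξ a =
      ∑ m : Fin n, a m.succ • chartComp (γ s₀) (e m.succ (ξ 0)) -
        connOf (chartMetric g (γ s₀)) (extChartAt (𝓡 (n + 1)) (γ s₀) (γ (ξ 0)))
          (a 0 • chartComp (γ s₀) (e 0 (ξ 0))) (normalVec e (γ s₀) ξ) := by
  have hsummand (m : Fin n) :
      HasFDerivAt (fun η : Coord n => η m.succ • chartComp (γ s₀) (e m.succ (η 0))) _ ξ :=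
    HasFDerivAt.smul (EuclideanSpace.proj m.succ : Coord n →L[ℝ] ℝ).hasFDerivAt
      (HasFDerivAt.comp ξ (g := fun τ => chartComp (γ s₀) (e m.succ τ))
        (hasDerivAt_frame h.isParallelFrame (h.base_mem ξ hξ) m.succ).hasFDerivAt
        (EuclideanSpace.proj 0 : Coord n →L[ℝ] ℝ).hasFDerivAt)
  have hsum : fderiv ℝ (normalVec e (γ s₀)) ξ = _ :=
    (HasFDerivAt.fun_sum (u := Finset.univ) fun m _ => hsummand m).fderiv
  rw [hsum]
  simp only [normalVec, sum_apply, map_sum, map_smul]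
  rw [← Finset.sum_sub_distrib]
  refine Finset.sum_congr rfl fun m _ => ?_
  simp only [smul_apply, add_apply, ContinuousLinearMap.comp_apply,
    ContinuousLinearMap.toSpanSingleton_apply, ContinuousLinearMap.smulRight_apply,
    PiLp.proj_apply, smul_neg]
  abel

lemma jacobiFieldDeriv_zero (hξ : ξ ∈ Metric.ball (axis n s₀) ε) (a : Coord n) :
    jacobiFieldDeriv (connOf (chartMetric g (γ s₀))) (normalFamily g γ e (γ s₀)) a (0, ξ) =
      ∑ m : Fin n, a m.succ • chartComp (γ s₀) (e m.succ (ξ 0)) := by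
  have hdom := mem_domain hξ (t := 0) (by simp)
  have hvel : (fun η => velocityField (normalFamily g γ e (γ s₀)) (0, η)) =ᶠ[𝓝 ξ]
      normalVec e (γ s₀) := by
    filter_upwards [Metric.isOpen_ball.mem_nhds hξ] with η hη using h.velocityField_zero hη
  have hdir : fderiv ℝ (normalFamily g γ e (γ s₀)) (0, ξ) (0, a) = _ := h.jacobiField_zero hξ a
  calc
    _ = cov (connOf (chartMetric g (γ s₀))) (normalFamily g γ e (γ s₀)) (0, a)
        (velocityField (normalFamily g γ e (γ s₀))) (0, ξ) :=
      cov_fderiv_comm ((isLeviCivitaOn_chart g (γ s₀)).conn_symm _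
        (h.isGeodesicFamilyAt hξ 0 (by simp)).1) (h.contDiffAt_normalFamily hdom) _ _
    _ = _ := by
      rw [cov, hdir, fderiv_prodMk_right (h.differentiableAt_velocityField hdom), hvel.fderiv_eq,
        h.velocityField_zero hξ, h.normalFamily_zero hξ, h.fderiv_normalVec hξ, sub_add_cancel]

lemma jacobiField_one (hξ : ξ ∈ Metric.ball (axis n s₀) ε) (a : Coord n) :
    jacobiField (normalFamily g γ e (γ s₀)) a (1, ξ) = fderiv ℝ (fermiChart g γ e (γ s₀)) ξ a := by
  rw [jacobiField, fderiv_prodMk_right (h.differentiableAt_normalFamily (mem_domain hξ (by simp)))]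
  simp only [normalFamily, radial_one]

lemma formOf_sum_sum (hξ : ξ ∈ Metric.ball (axis n s₀) ε) (a b : Coord n) :
    formOf (chartMetric g (γ s₀)) (extChartAt (𝓡 (n + 1)) (γ s₀) (γ (ξ 0)))
      (∑ m : Fin n, a m.succ • chartComp (γ s₀) (e m.succ (ξ 0)))
      (∑ m : Fin n, b m.succ • chartComp (γ s₀) (e m.succ (ξ 0))) =
      ∑ m : Fin n, a m.succ * b m.succ := by
  simp only [map_sum, map_smul, sum_apply, smul_apply,
    formOf_frame h.isGeodesicOn h.isParallelFrame (h.base_mem ξ hξ), Fin.succ_inj, smul_eq_mul,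
    mul_ite, mul_one, mul_zero, Finset.sum_ite_eq', Finset.mem_univ, if_true]
  exact Finset.sum_congr rfl fun m _ => mul_comm _ _

lemma formOf_first_sum (hξ : ξ ∈ Metric.ball (axis n s₀) ε) (c : ℝ) (b : Coord n) :
    formOf (chartMetric g (γ s₀)) (extChartAt (𝓡 (n + 1)) (γ s₀) (γ (ξ 0)))
      (c • chartComp (γ s₀) (e 0 (ξ 0)))
      (∑ m : Fin n, b m.succ • chartComp (γ s₀) (e m.succ (ξ 0))) = 0 := by
  simp only [map_sum, map_smul, smul_apply,
    formOf_frame h.isGeodesicOn h.isParallelFrame (h.base_mem ξ hξ), (Fin.succ_ne_zero _).symm,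
    if_false, smul_zero, Finset.sum_const_zero]

lemma innerAlong_jacobiField_velocityField_zero (hξ : ξ ∈ Metric.ball (axis n s₀) ε)
    (a : Coord n) :
    innerAlong (formOf (chartMetric g (γ s₀))) (normalFamily g γ e (γ s₀)) ξ
      (jacobiField (normalFamily g γ e (γ s₀)) a)
      (velocityField (normalFamily g γ e (γ s₀))) 0 = 0 := by
  rw [innerAlong, h.normalFamily_zero hξ, h.jacobiField_zero hξ, h.velocityField_zero hξ]
  exact h.formOf_first_sum hξ _ _

lemma jacobiData_eq (hξ : ξ ∈ Metric.ball (axis n s₀) ε) (a b : Coord n) :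
    jacobiData (formOf (chartMetric g (γ s₀))) (connOf (chartMetric g (γ s₀)))
      (normalFamily g γ e (γ s₀)) a b ξ =
      (∑ m : Fin n, ξ m.succ * ξ m.succ,
        (∑ m : Fin n, a m.succ * ξ m.succ) * ∑ m : Fin n, b m.succ * ξ m.succ,
        a 0 * b 0, 0, ∑ m : Fin n, a m.succ * b m.succ) := by
  have hsymm := (isLeviCivitaOn_chart g (γ s₀)).metric_symm _
    ((extChartAt (𝓡 (n + 1)) (γ s₀)).map_source (h.base_mem ξ hξ))
  simp only [jacobiData, innerAlong, h.normalFamily_zero hξ, h.velocityField_zero hξ,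
    h.jacobiField_zero hξ, h.jacobiFieldDeriv_zero hξ, normalVec, h.formOf_sum_sum hξ]
  rw [hsymm (∑ m, _), h.formOf_first_sum hξ, h.formOf_first_sum hξ, add_zero, map_smul, map_smul,
    smul_apply, formOf_frame h.isGeodesicOn h.isParallelFrame (h.base_mem ξ hξ), if_pos rfl,
    smul_eq_mul, smul_eq_mul, mul_one, mul_comm (b 0)]

lemma pullbackMetric_apply (hξ : ξ ∈ Metric.ball (axis n s₀) ε) (i j : Fin (n + 1)) :
    pullbackMetric g (fermiMap g γ e) ξ i j =
      formOf (chartMetric g (γ s₀)) (fermiChart g γ e (γ s₀) ξ)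
        (fderiv ℝ (fermiChart g γ e (γ s₀)) ξ (basisVec i))
        (fderiv ℝ (fermiChart g γ e (γ s₀)) ξ (basisVec j)) :=
  pullbackMetric_eq_formOf g (h.mdifferentiableAt hξ) (h.mem_source hξ) i j

theorem pullbackMetric_eq {κ : ℝ} (hκ : HasConstantCurvature g κ) {η : Coord n}
    (hξ : ξ ∈ Metric.ball (axis n s₀) ε) (hη : η ∈ Metric.ball (axis n s₀) ε) {σ : ℝ}
    (hσ : σ ^ 2 = 1) (hξη : ∀ m : Fin n, η m.succ = σ * ξ m.succ) :
    pullbackMetric g (fermiMap g γ e) ξ = pullbackMetric g (fermiMap g γ e) η := by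
  have hmem : ∀ ζ ∈ ({ξ, η} : Set (Coord n)), ζ ∈ Metric.ball (axis n s₀) ε := by
    rintro ζ (rfl | rfl) <;> assumption
  have hsum (c : Coord n) :
      ∑ m : Fin n, c m.succ * η m.succ = σ * ∑ m : Fin n, c m.succ * ξ m.succ := by
    simp only [hξη, Finset.mul_sum, mul_left_comm]
  ext i j
  have horth (k : Fin (n + 1)) : ∀ ζ ∈ ({ξ, η} : Set (Coord n)), innerAlong
      (formOf (chartMetric g (γ s₀))) (normalFamily g γ e (γ s₀)) ζ
      (jacobiField (normalFamily g γ e (γ s₀)) (basisVec k))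
      (velocityField (normalFamily g γ e (γ s₀))) 0 = 0 := fun ζ hζ =>
    h.innerAlong_jacobiField_velocityField_zero (hmem ζ hζ) _
  have hdata : jacobiData (formOf (chartMetric g (γ s₀))) (connOf (chartMetric g (γ s₀)))
      (normalFamily g γ e (γ s₀)) (basisVec i) (basisVec j) ξ = jacobiData
        (formOf (chartMetric g (γ s₀))) (connOf (chartMetric g (γ s₀)))
        (normalFamily g γ e (γ s₀)) (basisVec i) (basisVec j) η := by
    have hsq : ∑ m : Fin n, η m.succ * η m.succ = ∑ m : Fin n, ξ m.succ * ξ m.succ :=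
      Finset.sum_congr rfl fun m _ => by rw [hξη]; linear_combination (ξ m.succ * ξ m.succ) * hσ
    rw [h.jacobiData_eq hξ, h.jacobiData_eq hη, hsq, hsum, hsum, mul_mul_mul_comm σ, ← sq σ, hσ,
      one_mul]
  have hJ := (isLeviCivitaOn_chart g (γ s₀)).innerAlong_jacobiField_eq
    (hκ.hasConstantCurvatureOn (γ s₀)) (fun ζ hζ => h.isGeodesicFamilyAt (hmem ζ hζ))
    (horth i) (horth j) hdata
  simpa only [h.pullbackMetric_apply hξ, h.pullbackMetric_apply hη, innerAlong,
    h.jacobiField_one hξ, h.jacobiField_one hη, normalFamily, radial_one] using hJ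

lemma fermiMap_axis (hξ : ξ ∈ Metric.ball (axis n s₀) ε) :
    fermiMap g γ e (axis n (ξ 0)) = γ (ξ 0) := by
  rw [← radial_zero, h.eq_symm ξ hξ 0 (by norm_num), h.init ξ hξ]
  exact (extChartAt (𝓡 (n + 1)) (γ s₀)).left_inv (h.base_mem ξ hξ)

lemma fermiMap_axis_center : fermiMap g γ e (axis n s₀) = γ s₀ := by
  simpa using h.fermiMap_axis h.axis_mem

lemma fderiv_fermiChart_first :
    fderiv ℝ (fermiChart g γ e (γ s₀)) (axis n s₀) (basisVec 0) = chartComp (γ s₀) (e 0 s₀) := by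
  refine ((h.differentiableAt_fermiChart h.axis_mem).hasFDerivAt.comp_hasDerivAt s₀
    (hasDerivAt_axis s₀)).unique ((hasDerivAt_base h.isGeodesicOn h.isParallelFrame
      (mem_extChartAt_source _)).congr_of_eventuallyEq ?_)
  filter_upwards [(hasDerivAt_axis (n := n) s₀).continuousAt.eventually_mem
    (Metric.isOpen_ball.mem_nhds h.axis_mem)] with s hs
  have hs' := h.fermiMap_axis hs
  rw [axis_zero_coord] at hs'
  rw [Function.comp_apply, fermiChart, hs']

lemma fderiv_fermiChart_normal (hξ : ξ ∈ Metric.ball (axis n s₀) ε) :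
    fderiv ℝ (fermiChart g γ e (γ s₀)) (axis n (ξ 0)) (ξ - ξ 0 • basisVec 0) =
      normalVec e (γ s₀) ξ := by
  have hdom := mem_domain hξ (t := 0) (by simp)
  have hslice := hasDerivAt_slice (h.differentiableAt_normalFamily hdom)
  rw [← radial_zero, ← h.velocityField_zero hξ]
  exact ((h.differentiableAt_fermiChart hdom.2.2).hasFDerivAt.comp_hasDerivAt (0 : ℝ)
    (hasDerivAt_radial ξ 0)).unique hslice

lemma fderiv_fermiChart_axis (i : Fin (n + 1)) :
    fderiv ℝ (fermiChart g γ e (γ s₀)) (axis n s₀) (basisVec i) = chartComp (γ s₀) (e i s₀) := by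
  induction i using Fin.cases with
  | zero => exact h.fderiv_fermiChart_first
  | succ m =>
    have hmem : axis n s₀ + (ε / 2) • basisVec m.succ ∈ Metric.ball (axis n s₀) ε := by
      simp [basisVec, norm_smul, abs_of_pos h.pos, h.pos]
    have hnormal := h.fderiv_fermiChart_normal hmem
    rw [normalVec_axis_add_smul] at hnormal
    refine smul_right_injective _ (half_pos h.pos).ne' ?_
    simpa [basisVec_apply, (Fin.succ_ne_zero m).symm, axis] using hnormal

lemma pullbackMetric_axis : pullbackMetric g (fermiMap g γ e) (axis n s₀) = 1 := by
  ext i j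
  rw [h.pullbackMetric_apply h.axis_mem, h.fderiv_fermiChart_axis, h.fderiv_fermiChart_axis,
    fermiChart, h.fermiMap_axis_center,
    formOf_frame h.isGeodesicOn h.isParallelFrame (mem_extChartAt_source _), Matrix.one_apply]

lemma contDiffAt_pullbackMetric (hξ : ξ ∈ Metric.ball (axis n s₀) ε) (i j : Fin (n + 1)) :
    ContDiffAt ℝ ∞ (fun η => pullbackMetric g (fermiMap g γ e) η i j) ξ := by
  have hchart := h.contDiffAt_fermiChart hξ
  refine (contDiffAt_apply_apply_comp (Φ := fermiChart g γ e (γ s₀))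
    ((isMetricOn_chartMetric g (γ s₀)).contDiffAt_formOf
      ((extChartAt (𝓡 (n + 1)) (γ s₀)).map_source (h.mem_source hξ))) hchart
    (contDiffAt_fderiv_apply hchart (basisVec i))
    (contDiffAt_fderiv_apply hchart (basisVec j))).congr_of_eventuallyEq ?_
  filter_upwards [Metric.isOpen_ball.mem_nhds hξ] with η hη using h.pullbackMetric_apply hη i j

lemma pairing_pullbackMetric (hξ : ξ ∈ Metric.ball (axis n s₀) ε) (v w : Coord n) :
    pairing (pullbackMetric g (fermiMap g γ e)) ξ v w =
      formOf (chartMetric g (γ s₀)) (fermiChart g γ e (γ s₀) ξ)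
        (fderiv ℝ (fermiChart g γ e (γ s₀)) ξ v) (fderiv ℝ (fermiChart g γ e (γ s₀)) ξ w) :=
  pairing_eq_of_apply_basisVec (h.pullbackMetric_apply hξ) v w

lemma eq_zero_of_fderiv_fermiChart_eq_zero (hξ : ξ ∈ Metric.ball (axis n s₀) ε)
    (hdet : (pullbackMetric g (fermiMap g γ e) ξ).det ≠ 0) {v : Coord n}
    (hv : fderiv ℝ (fermiChart g γ e (γ s₀)) ξ v = 0) : v = 0 := by
  refine (WithLp.ofLp_eq_zero 2).1 (Matrix.eq_zero_of_vecMul_eq_zero hdet (funext fun j => ?_))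
  have hpair := h.pairing_pullbackMetric hξ v (basisVec j)
  rw [hv, map_zero, zero_apply] at hpair
  simpa [pairing, Matrix.vecMul, dotProduct, basisVec_apply, mul_comm] using hpair

lemma exists_isMetricOn : ∃ r > 0, r ≤ ε ∧
    IsMetricOn (pullbackMetric g (fermiMap g γ e)) (Metric.ball (axis n s₀) r) := by
  have hdet : ∀ᶠ ξ in 𝓝 (axis n s₀), (pullbackMetric g (fermiMap g γ e) ξ).det ≠ 0 := by
    refine (contDiffAt_det (m := ∞)
      (h.contDiffAt_pullbackMetric h.axis_mem)).continuousAt.eventually_ne ?_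
    simp [h.pullbackMetric_axis]
  obtain ⟨r, hr, hball⟩ := Metric.eventually_nhds_iff_ball.1 hdet
  have hsub : Metric.ball (axis n s₀) (min r ε) ⊆ Metric.ball (axis n s₀) ε :=
    Metric.ball_subset_ball (min_le_right _ _)
  refine ⟨min r ε, lt_min hr h.pos, min_le_right _ _, Metric.isOpen_ball,
    fun ξ hξ => h.contDiffAt_pullbackMetric (hsub hξ), fun ξ _ i j => g.symm _ _ _,
    fun ξ hξ v hv => ?_⟩
  rw [h.pairing_pullbackMetric (hsub hξ)]
  exact (isLeviCivitaOn_chart g (γ s₀)).metric_pos _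
    ((extChartAt (𝓡 (n + 1)) (γ s₀)).map_source (h.mem_source (hsub hξ))) _
    (mt (h.eq_zero_of_fderiv_fermiChart_eq_zero (hsub hξ)
      (hball ξ (Metric.ball_subset_ball (min_le_left _ _) hξ))) hv)

lemma bijective_mfderiv :
    Function.Bijective (mfderiv 𝓘(ℝ, Coord n) (𝓡 (n + 1)) (fermiMap g γ e) (axis n s₀)) := by
  let L : Coord n →L[ℝ] Coord n :=
    mfderiv 𝓘(ℝ, Coord n) (𝓡 (n + 1)) (fermiMap g γ e) (axis n s₀)
  have hinj : Function.Injective L := by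
    refine (injective_iff_map_eq_zero L).2 fun v hv =>
      h.eq_zero_of_fderiv_fermiChart_eq_zero h.axis_mem (by simp [h.pullbackMetric_axis]) ?_
    refine (chartComp_mfderiv (h.mdifferentiableAt h.axis_mem) (h.mem_source h.axis_mem)
      v).symm.trans ?_
    exact (congrArg _ hv).trans (map_zero _)
  exact ⟨hinj, (LinearMap.injective_iff_surjective (f := L.toLinearMap)).1 hinj⟩

end IsFermiBall

end FermiMetric

section FermiFunctions

open Topology

variable {n : ℕ}

/-- On the ball around `(s₀, 0)`, `f` is smooth, does not depend on the first coordinate, and is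
multiplied by `τ` when the signs of the other coordinates are reversed. -/
structure IsFermiFun (f : Coord n → ℝ) (τ s₀ r : ℝ) : Prop where
  contDiffAt : ∀ ξ ∈ Metric.ball (axis n s₀) r, ContDiffAt ℝ ∞ f ξ
  translate : ∀ ξ ∈ Metric.ball (axis n s₀) r, ∀ η ∈ Metric.ball (axis n s₀) r,
    (∀ m : Fin n, η m.succ = ξ m.succ) → f η = f ξ
  reflect : ∀ ξ ∈ Metric.ball (axis n s₀) r, f (radial (-1) ξ) = τ * f ξ

lemma coord_ext {ξ η : Coord n} (hzero : ξ 0 = η 0) (hsucc : ∀ m : Fin n, ξ m.succ = η m.succ) :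
    ξ = η := by
  ext i
  exact Fin.cases hzero hsucc i

lemma radial_axis (r s : ℝ) : radial r (axis n s) = axis n s := coord_ext (by simp) (by simp)

/-- The reversal of the signs of all coordinates but the first, as a linear map. -/
def reflection (n : ℕ) : Coord n →L[ℝ] Coord n :=
  (2 : ℝ) • (EuclideanSpace.proj 0 : Coord n →L[ℝ] ℝ).smulRight (basisVec 0) -
    ContinuousLinearMap.id ℝ (Coord n)

lemma reflection_apply (ξ : Coord n) : reflection n ξ = radial (-1) ξ := by
  simp only [reflection, radial, sub_apply, smul_apply, ContinuousLinearMap.smulRight_apply,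
    PiLp.proj_apply, ContinuousLinearMap.id_apply]
  module

lemma reflection_basisVec_succ (m : Fin n) :
    reflection n (basisVec m.succ) = -basisVec m.succ := by
  rw [reflection_apply]
  refine coord_ext ?_ fun p => ?_
  · simp [basisVec_apply, (Fin.succ_ne_zero _).symm]
  · simp only [radial_succ_coord, PiLp.neg_apply, neg_one_mul]

lemma fderiv_eq_sum_pd (f : Coord n → ℝ) (x v : Coord n) :
    fderiv ℝ f x v = ∑ i, v i * pd i f x := by
  conv_lhs => rw [← sum_smul_basisVec v]
  simp [pd]

namespace IsFermiFun

variable {f h : Coord n → ℝ} {τ τ' s₀ r : ℝ}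

lemma differentiableAt (hf : IsFermiFun f τ s₀ r) {ξ : Coord n}
    (hξ : ξ ∈ Metric.ball (axis n s₀) r) : DifferentiableAt ℝ f ξ :=
  (hf.contDiffAt ξ hξ).differentiableAt (by simp)

lemma pd_zero (hf : IsFermiFun f τ s₀ r) {ξ : Coord n} (hξ : ξ ∈ Metric.ball (axis n s₀) r) :
    pd 0 f ξ = 0 := by
  have hline : HasDerivAt (fun c : ℝ => ξ + c • (basisVec 0 : Coord n)) (basisVec 0) 0 := by
    simpa using ((hasDerivAt_id (0 : ℝ)).smul_const (basisVec 0 : Coord n)).const_add ξ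
  have hcomp := HasFDerivAt.comp_hasDerivAt (l := f) (l' := fderiv ℝ f ξ) (0 : ℝ)
    (by simpa using (hf.differentiableAt hξ).hasFDerivAt) hline
  refine hcomp.unique ((hasDerivAt_const (0 : ℝ) (f ξ)).congr_of_eventuallyEq ?_)
  filter_upwards [hline.continuousAt.eventually_mem
    (Metric.isOpen_ball.mem_nhds (by simpa using hξ))] with c hc
  exact hf.translate ξ hξ _ hc fun m => by simp [basisVec_apply]

lemma pd_translate (hf : IsFermiFun f τ s₀ r) (i : Fin (n + 1)) {ξ η : Coord n}
    (hξ : ξ ∈ Metric.ball (axis n s₀) r) (hη : η ∈ Metric.ball (axis n s₀) r)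
    (hξη : ∀ m : Fin n, η m.succ = ξ m.succ) : pd i f η = pd i f ξ := by
  have hshift : (fun ζ => f (ζ + (η - ξ))) =ᶠ[𝓝 ξ] f := by
    have hcont : ContinuousAt (fun ζ : Coord n => ζ + (η - ξ)) ξ := by fun_prop
    filter_upwards [Metric.isOpen_ball.mem_nhds hξ, hcont.eventually_mem
      (Metric.isOpen_ball.mem_nhds (by simpa using hη))] with ζ hζ hζ'
    exact hf.translate ζ hζ _ hζ' fun m => by simp [hξη]
  simp only [FermiWaveMap.pd, ← hshift.fderiv_eq (𝕜 := ℝ), fderiv_comp_add_right, add_sub_cancel]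

lemma pd_succ_reflect (hf : IsFermiFun f τ s₀ r) (m : Fin n) {ξ : Coord n}
    (hξ : ξ ∈ Metric.ball (axis n s₀) r) :
    pd m.succ f (radial (-1) ξ) = -τ * pd m.succ f ξ := by
  have hreflect : (fun ζ => f (reflection n ζ)) =ᶠ[𝓝 ξ] fun ζ => τ * f ζ := by
    filter_upwards [Metric.isOpen_ball.mem_nhds hξ] with ζ hζ
    rw [reflection_apply, hf.reflect ζ hζ]
  have hcomp : HasFDerivAt (fun ζ => f (reflection n ζ))
      ((fderiv ℝ f (radial (-1) ξ)).comp (reflection n)) ξ := by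
    have hdiff := (hf.differentiableAt (radial_mem_ball (r := -1) (by norm_num) hξ)).hasFDerivAt
    rw [← reflection_apply] at hdiff ⊢
    exact hdiff.comp ξ (reflection n).hasFDerivAt
  have hderiv := DFunLike.congr_fun (hcomp.unique
    (((hf.differentiableAt hξ).hasFDerivAt.const_mul τ).congr_of_eventuallyEq hreflect))
    (basisVec m.succ)
  rw [ContinuousLinearMap.comp_apply, reflection_basisVec_succ, map_neg, smul_apply,
    smul_eq_mul] at hderiv
  simp only [FermiWaveMap.pd]
  linarith

lemma pd (hf : IsFermiFun f τ s₀ r) (i : Fin (n + 1)) : IsFermiFun (pd i f) (-τ) s₀ r where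
  contDiffAt ξ hξ := contDiffAt_pd (hf.contDiffAt ξ hξ) i
  translate _ hξ _ hη hξη := hf.pd_translate i hξ hη hξη
  reflect ξ hξ := by
    induction i using Fin.cases with
    | zero => rw [hf.pd_zero hξ, hf.pd_zero (radial_mem_ball (by norm_num) hξ), mul_zero]
    | succ m => exact hf.pd_succ_reflect m hξ

lemma add (hf : IsFermiFun f τ s₀ r) (hh : IsFermiFun h τ s₀ r) :
    IsFermiFun (fun ξ => f ξ + h ξ) τ s₀ r where
  contDiffAt ξ hξ := (hf.contDiffAt ξ hξ).add (hh.contDiffAt ξ hξ)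
  translate ξ hξ η hη hξη := by simp only [hf.translate ξ hξ η hη hξη, hh.translate ξ hξ η hη hξη]
  reflect ξ hξ := by simp only [hf.reflect ξ hξ, hh.reflect ξ hξ]; ring

lemma const_mul (hf : IsFermiFun f τ s₀ r) (c : ℝ) : IsFermiFun (fun ξ => c * f ξ) τ s₀ r where
  contDiffAt ξ hξ := contDiffAt_const.mul (hf.contDiffAt ξ hξ)
  translate ξ hξ η hη hξη := by simp only [hf.translate ξ hξ η hη hξη]
  reflect ξ hξ := by simp only [hf.reflect ξ hξ]; ring

lemma sub (hf : IsFermiFun f τ s₀ r) (hh : IsFermiFun h τ s₀ r) :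
    IsFermiFun (fun ξ => f ξ - h ξ) τ s₀ r where
  contDiffAt ξ hξ := (hf.contDiffAt ξ hξ).sub (hh.contDiffAt ξ hξ)
  translate ξ hξ η hη hξη := by simp only [hf.translate ξ hξ η hη hξη, hh.translate ξ hξ η hη hξη]
  reflect ξ hξ := by simp only [hf.reflect ξ hξ, hh.reflect ξ hξ]; ring

lemma mul (hf : IsFermiFun f τ s₀ r) (hh : IsFermiFun h τ' s₀ r) :
    IsFermiFun (fun ξ => f ξ * h ξ) (τ * τ') s₀ r where
  contDiffAt ξ hξ := (hf.contDiffAt ξ hξ).mul (hh.contDiffAt ξ hξ)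
  translate ξ hξ η hη hξη := by simp only [hf.translate ξ hξ η hη hξη, hh.translate ξ hξ η hη hξη]
  reflect ξ hξ := by simp only [hf.reflect ξ hξ, hh.reflect ξ hξ]; ring

lemma sum {ι : Type*} [Fintype ι] {F : ι → Coord n → ℝ} (hF : ∀ i, IsFermiFun (F i) τ s₀ r) :
    IsFermiFun (fun ξ => ∑ i, F i ξ) τ s₀ r where
  contDiffAt ξ hξ := ContDiffAt.sum fun i _ => (hF i).contDiffAt ξ hξ
  translate ξ hξ η hη hξη := Finset.sum_congr rfl fun i _ => (hF i).translate ξ hξ η hη hξη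
  reflect ξ hξ := by simp only [(hF _).reflect ξ hξ, Finset.mul_sum]

lemma apply_axis (hf : IsFermiFun f (-1) s₀ r) {s : ℝ}
    (hs : axis n s ∈ Metric.ball (axis n s₀) r) : f (axis n s) = 0 := by
  have hreflect := hf.reflect _ hs
  rw [radial_axis] at hreflect
  linarith

lemma pd_pd_axis (hf : IsFermiFun f (-1) s₀ r) (p m : Fin (n + 1)) {s : ℝ}
    (hs : axis n s ∈ Metric.ball (axis n s₀) r) :
    FermiWaveMap.pd p (FermiWaveMap.pd m f) (axis n s) = 0 := by
  have hodd := (hf.pd m).pd p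
  rw [neg_neg] at hodd
  exact hodd.apply_axis hs

end IsFermiFun

/-- A Riemannian metric near `(s₀, 0)` that does not depend on the first coordinate and is even in
the others. -/
structure IsFermiMetric (G : Coord n → Matrix (Fin (n + 1)) (Fin (n + 1)) ℝ) (s₀ r : ℝ) :
    Prop where
  pos : 0 < r
  isMetricOn : IsMetricOn G (Metric.ball (axis n s₀) r)
  symmetric : ∀ ξ ∈ Metric.ball (axis n s₀) r, ∀ η ∈ Metric.ball (axis n s₀) r, ∀ σ : ℝ,
    σ ^ 2 = 1 → (∀ m : Fin n, η m.succ = σ * ξ m.succ) → G ξ = G η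

namespace IsFermiMetric

variable {G : Coord n → Matrix (Fin (n + 1)) (Fin (n + 1)) ℝ} {s₀ r : ℝ}

lemma translate (h : IsFermiMetric G s₀ r) {ξ η : Coord n} (hξ : ξ ∈ Metric.ball (axis n s₀) r)
    (hη : η ∈ Metric.ball (axis n s₀) r) (hξη : ∀ m : Fin n, η m.succ = ξ m.succ) : G η = G ξ :=
  (h.symmetric ξ hξ η hη 1 (by norm_num) fun m => by rw [hξη, one_mul]).symm

lemma reflect (h : IsFermiMetric G s₀ r) {ξ : Coord n} (hξ : ξ ∈ Metric.ball (axis n s₀) r) :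
    G (radial (-1) ξ) = G ξ :=
  (h.symmetric ξ hξ _ (radial_mem_ball (by norm_num) hξ) (-1) (by norm_num) fun m => by simp).symm

lemma isFermiFun (h : IsFermiMetric G s₀ r) (i j : Fin (n + 1)) :
    IsFermiFun (fun ξ => G ξ i j) 1 s₀ r where
  contDiffAt ξ hξ := h.isMetricOn.contDiffAt ξ hξ i j
  translate ξ hξ η hη hξη := by simp only [h.translate hξ hη hξη]
  reflect ξ hξ := by simp only [h.reflect hξ, one_mul]

lemma isFermiFun_inv (h : IsFermiMetric G s₀ r) (i j : Fin (n + 1)) :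
    IsFermiFun (fun ξ => (G ξ)⁻¹ i j) 1 s₀ r where
  contDiffAt ξ hξ := contDiffAt_matrix_inv (h.isMetricOn.contDiffAt ξ hξ)
    (h.isMetricOn.det_ne_zero hξ) i j
  translate ξ hξ η hη hξη := by simp only [h.translate hξ hη hξη]
  reflect ξ hξ := by simp only [h.reflect hξ, one_mul]

lemma isFermiFun_christoffel (h : IsFermiMetric G s₀ r) (k i j : Fin (n + 1)) :
    IsFermiFun (christoffel G k i j) (-1) s₀ r := by
  have hsum := (IsFermiFun.sum fun l : Fin (n + 1) => (h.isFermiFun_inv k l).mul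
    ((((h.isFermiFun j l).pd i).add ((h.isFermiFun i l).pd j)).sub
      ((h.isFermiFun i j).pd l))).const_mul (1 / 2)
  rwa [one_mul] at hsum

end IsFermiMetric

theorem exists_isFermiMetric {M : Type*} [TopologicalSpace M] [T2Space M] [ChartedSpace (Coord n) M]
    [IsManifold (𝓡 (n + 1)) ∞ M] {g : Metric n M} {κ : ℝ} (hκ : HasConstantCurvature g κ)
    {γ : ℝ → M} (hγ : IsGeodesicOn g γ Set.univ)
    {e : Fin (n + 1) → ∀ t, TangentSpace (𝓡 (n + 1)) (γ t)} (he : IsParallelFrame g γ e) (s₀ : ℝ) :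
    ∃ r, IsFermiMetric (pullbackMetric g (fermiMap g γ e)) s₀ r := by
  obtain ⟨ε, Z, h⟩ := exists_isFermiBall hγ he s₀
  obtain ⟨r, hr, hrε, hmet⟩ := h.exists_isMetricOn
  have hsub : Metric.ball (axis n s₀) r ⊆ Metric.ball (axis n s₀) ε := Metric.ball_subset_ball hrε
  exact ⟨r, hr, hmet, fun ξ hξ η hη σ hσ hξη =>
    h.pullbackMetric_eq hκ (hsub hξ) (hsub hη) hσ hξη⟩

end FermiFunctions

section Taylor

open Set

lemma abs_sub_taylor_le {k : ℕ} {h : ℕ → ℝ → ℝ} {A : ℝ}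
    (hderiv : ∀ j < k, ∀ t ∈ Icc (0 : ℝ) 1, HasDerivAt (h j) (h (j + 1) t) t)
    (hbound : ∀ t ∈ Icc (0 : ℝ) 1, |h k t| ≤ A) {t : ℝ} (ht : t ∈ Icc (0 : ℝ) 1) :
    |h 0 t - ∑ j ∈ Finset.range k, t ^ j / (j.factorial : ℝ) * h j 0| ≤ A := by
  induction k generalizing h t with
  | zero => simpa using hbound t ht
  | succ k ih =>
    have hremainder : ∀ s ∈ Icc (0 : ℝ) 1, HasDerivAt
        (fun s => h 0 s - ∑ j ∈ Finset.range (k + 1), s ^ j / (j.factorial : ℝ) * h j 0)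
        (h 1 s - ∑ j ∈ Finset.range k, s ^ j / (j.factorial : ℝ) * h (j + 1) 0) s := by
      intro s hs
      refine (hderiv 0 (by omega) s hs).sub ?_
      simp only [Finset.sum_range_succ' _ k, pow_zero]
      refine ((HasDerivAt.fun_sum fun j _ => (((hasDerivAt_pow (j + 1) s).div_const
        ((j + 1).factorial : ℝ)).mul_const (h (j + 1) 0))).add_const _).congr_deriv
          (Finset.sum_congr rfl fun j _ => ?_)
      rw [Nat.factorial_succ, Nat.add_sub_cancel]
      push_cast
      field_simp
    have hremainder_le := (convex_Icc (0 : ℝ) 1).norm_image_sub_le_of_norm_hasDerivWithin_le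
      (fun s hs => (hremainder s hs).hasDerivWithinAt) (fun s hs => ih (h := fun j => h (j + 1))
        (fun j hj => hderiv (j + 1) (by omega)) hbound hs) (left_mem_Icc.2 zero_le_one) ht
    have hinit :
        h 0 0 - ∑ j ∈ Finset.range (k + 1), (0 : ℝ) ^ j / (j.factorial : ℝ) * h j 0 = 0 := by
      simp [Finset.sum_range_succ']
    rw [hinit, sub_zero, sub_zero, Real.norm_eq_abs, Real.norm_eq_abs, abs_of_nonneg ht.1]
      at hremainder_le
    exact hremainder_le.trans (mul_le_of_le_one_right ((abs_nonneg _).trans (hbound t ht)) ht.2)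

variable {n : ℕ}

lemma dist_axis (s s' : ℝ) : dist (axis n s) (axis n s') = dist s s' := by
  refine (sq_eq_sq₀ dist_nonneg dist_nonneg).1 ?_
  simp [dist_axis_sq, Real.dist_eq, sq_abs]

lemma axis_mem_ball {s s₀ r : ℝ} :
    axis n s ∈ Metric.ball (axis n s₀) r ↔ s ∈ Metric.ball s₀ r := by
  rw [Metric.mem_ball, dist_axis, Metric.mem_ball]

/-- The `k`-th derivative in the direction of the components of `u` normal to the axis. -/
def normalDeriv (u : Coord n) : ℕ → (Coord n → ℝ) → Coord n → ℝ
  | 0, f, x => f x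
  | k + 1, f, x => ∑ m : Fin n, u m.succ * normalDeriv u k (pd m.succ f) x

namespace IsFermiFun

variable {f : Coord n → ℝ} {τ s₀ r : ℝ}

lemma hasDerivAt_normalDeriv (hf : IsFermiFun f τ s₀ r) (u a : Coord n) (k : ℕ) {t : ℝ}
    (ht : a + t • u ∈ Metric.ball (axis n s₀) r) :
    HasDerivAt (fun t : ℝ => normalDeriv u k f (a + t • u)) (normalDeriv u (k + 1) f (a + t • u))
      t := by
  induction k generalizing f τ with
  | zero =>
    have hline : HasDerivAt (fun t : ℝ => a + t • u) u t := by
      simpa using ((hasDerivAt_id t).smul_const u).const_add a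
    refine (HasFDerivAt.comp_hasDerivAt (l := f) t
      (hf.differentiableAt ht).hasFDerivAt hline).congr_deriv ?_
    rw [fderiv_eq_sum_pd, Fin.sum_univ_succ, hf.pd_zero ht, mul_zero, zero_add]
    rfl
  | succ k ih => exact HasDerivAt.fun_sum fun m _ => (ih (hf.pd m.succ)).const_mul _

lemma exists_normalDeriv_le (hf : IsFermiFun f τ s₀ r) {ρ : ℝ} (hρ : ρ < r) (k : ℕ) :
    ∃ C, ∀ u, ∀ x ∈ Metric.closedBall (axis n s₀) ρ,
      |normalDeriv u k f x| ≤ C * ‖u‖ ^ k := by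
  induction k generalizing f τ with
  | zero =>
    have hcont : ContinuousOn f (Metric.closedBall (axis n s₀) ρ) := fun x hx =>
      (hf.differentiableAt (Metric.closedBall_subset_ball hρ hx)).continuousAt.continuousWithinAt
    obtain ⟨C, hC⟩ := (isCompact_closedBall (axis n s₀) ρ).exists_bound_of_continuousOn hcont
    exact ⟨C, fun u x hx => by simpa [normalDeriv] using hC x hx⟩
  | succ k ih =>
    choose C hC using fun m : Fin n => ih (hf.pd m.succ)
    refine ⟨∑ m, C m, fun u x hx => ?_⟩
    rw [Finset.sum_mul]
    refine (Finset.abs_sum_le_sum_abs _ _).trans (Finset.sum_le_sum fun m _ => ?_)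
    rw [abs_mul, pow_succ', mul_left_comm]
    exact mul_le_mul (PiLp.norm_apply_le u m.succ) (hC m u x hx) (abs_nonneg _) (norm_nonneg u)

lemma exists_taylor_le (hf : IsFermiFun f τ s₀ r) (hr : 0 < r) (k : ℕ) :
    ∃ C, ∀ s ∈ Metric.ball s₀ (r / 4), ∀ u : Coord n, ‖u‖ ≤ r / 4 →
      |f (axis n s + u) - ∑ j ∈ Finset.range k,
        1 / (j.factorial : ℝ) * normalDeriv u j f (axis n s)| ≤ C * ‖u‖ ^ k := by
  obtain ⟨C, hC⟩ := hf.exists_normalDeriv_le (ρ := r / 2) (by linarith) k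
  refine ⟨C, fun s hs u hu => ?_⟩
  have hmem : ∀ t ∈ Icc (0 : ℝ) 1, axis n s + t • u ∈ Metric.closedBall (axis n s₀) (r / 2) := by
    intro t ht
    calc
      dist (axis n s + t • u) (axis n s₀)
      _ ≤ dist (axis n s + t • u) (axis n s) + dist (axis n s) (axis n s₀) := dist_triangle _ _ _
      _ = t * ‖u‖ + dist s s₀ := by
        rw [dist_axis, dist_self_add_left, norm_smul, Real.norm_of_nonneg ht.1]
      _ ≤ r / 2 := by
        linarith [mul_le_of_le_one_left (norm_nonneg u) ht.2, Metric.mem_ball.1 hs]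
  have htaylor := abs_sub_taylor_le (k := k)
    (h := fun j t => normalDeriv u j f (axis n s + t • u))
    (fun j _ t ht => hf.hasDerivAt_normalDeriv u _ j
      (Metric.closedBall_subset_ball (by linarith) (hmem t ht)))
    (fun t ht => hC u _ (hmem t ht)) (right_mem_Icc.2 zero_le_one)
  simpa [normalDeriv] using htaylor

lemma normalDeriv_two_axis (hf : IsFermiFun f (-1) s₀ r) {s : ℝ}
    (hs : axis n s ∈ Metric.ball (axis n s₀) r) (u : Coord n) :
    normalDeriv u 2 f (axis n s) = 0 :=
  Finset.sum_eq_zero fun m _ => mul_eq_zero_of_right _ (Finset.sum_eq_zero fun p _ =>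
    mul_eq_zero_of_right _ (hf.pd_pd_axis p.succ m.succ hs))

lemma exists_odd_taylor_le (hf : IsFermiFun f (-1) s₀ r) (hr : 0 < r) :
    ∃ C, ∀ s ∈ Metric.ball s₀ (r / 4), ∀ u : Coord n, ‖u‖ ≤ r / 4 →
      |f (axis n s + u) - normalDeriv u 1 f (axis n s)| ≤ C * ‖u‖ ^ 3 ∧
      |f (axis n s + u) - normalDeriv u 1 f (axis n s) - 1 / 6 * normalDeriv u 3 f (axis n s)|
        ≤ C * ‖u‖ ^ 4 := by
  obtain ⟨C₃, hcubic⟩ := hf.exists_taylor_le hr 3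
  obtain ⟨C₄, hquartic⟩ := hf.exists_taylor_le hr 4
  refine ⟨max C₃ C₄, fun s hs u hu => ?_⟩
  have haxis : axis n s ∈ Metric.ball (axis n s₀) r :=
    axis_mem_ball.2 (Metric.ball_subset_ball (by linarith) hs)
  have hzero : normalDeriv u 0 f (axis n s) = 0 := hf.apply_axis haxis
  have htwo := hf.normalDeriv_two_axis haxis u
  have hcubic := hcubic s hs u hu
  have hquartic := hquartic s hs u hu
  norm_num [Finset.sum_range_succ, hzero, htwo, Nat.factorial, ← sub_sub] at hcubic hquartic ⊢
  exact ⟨hcubic.trans (by gcongr; exact le_max_left _ _),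
    hquartic.trans (by gcongr; exact le_max_right _ _)⟩

end IsFermiFun

end Taylor

section WaveMap

open Topology

variable {n d : ℕ}

/-- The regularity of `Γ` on which the wave map expansion rests: at `(s, 0)` with `s ∈ S`, the
functions `Γ^i_{jk}` have Taylor expansions in the normal directions without terms of even order,
with remainders uniform in `s`, and they are symmetric in `j, k` nearby. -/
def HasOddExpansion (Γ : Fin (n + 1) → Fin (n + 1) → Fin (n + 1) → Coord n → ℝ) (S : Set ℝ) :
    Prop :=
  ∃ C > 0, ∃ δ > 0, ∀ s ∈ S, ∀ u : Coord n, ‖u‖ ≤ δ → ∀ i j k,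
    Γ i j k (axis n s + u) = Γ i k j (axis n s + u) ∧
    |Γ i j k (axis n s + u) - normalDeriv u 1 (Γ i j k) (axis n s)| ≤ C * ‖u‖ ^ 3 ∧
    |Γ i j k (axis n s + u) - normalDeriv u 1 (Γ i j k) (axis n s)
      - 1 / 6 * normalDeriv u 3 (Γ i j k) (axis n s)| ≤ C * ‖u‖ ^ 4

namespace HasOddExpansion

variable {Γ : Fin (n + 1) → Fin (n + 1) → Fin (n + 1) → Coord n → ℝ} {S T : Set ℝ}

lemma mono (hT : HasOddExpansion Γ T) (hST : S ⊆ T) : HasOddExpansion Γ S := by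
  obtain ⟨C, hC, δ, hδ, hΓ⟩ := hT
  exact ⟨C, hC, δ, hδ, fun s hs => hΓ s (hST hs)⟩

lemma union (hS : HasOddExpansion Γ S) (hT : HasOddExpansion Γ T) :
    HasOddExpansion Γ (S ∪ T) := by
  obtain ⟨C, hC, δ, hδ, hΓ⟩ := hS
  obtain ⟨C', -, δ', hδ', hΓ'⟩ := hT
  refine ⟨max C C', lt_max_of_lt_left hC, min δ δ', lt_min hδ hδ', fun s hs u hu i j k => ?_⟩
  rcases hs with hs | hs
  · obtain ⟨hsymm, hcubic, hquartic⟩ := hΓ s hs u (hu.trans (min_le_left _ _)) i j k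
    exact ⟨hsymm, hcubic.trans (by gcongr; exact le_max_left _ _),
      hquartic.trans (by gcongr; exact le_max_left _ _)⟩
  · obtain ⟨hsymm, hcubic, hquartic⟩ := hΓ' s hs u (hu.trans (min_le_right _ _)) i j k
    exact ⟨hsymm, hcubic.trans (by gcongr; exact le_max_right _ _),
      hquartic.trans (by gcongr; exact le_max_right _ _)⟩

lemma of_isCompact (hloc : ∀ s, ∃ T ∈ 𝓝 s, HasOddExpansion Γ T) (hS : IsCompact S) :
    HasOddExpansion Γ S := by
  refine hS.induction_on ⟨1, one_pos, 1, one_pos, by simp⟩ (fun _ _ hST hT => hT.mono hST)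
    (fun _ _ => union) fun s _ => ?_
  obtain ⟨T, hT, hΓ⟩ := hloc s
  exact ⟨T, mem_nhdsWithin_of_mem_nhds hT, hΓ⟩

end HasOddExpansion

lemma IsFermiMetric.hasOddExpansion {G : Coord n → Matrix (Fin (n + 1)) (Fin (n + 1)) ℝ} {s₀ r : ℝ}
    (h : IsFermiMetric G s₀ r) : HasOddExpansion (christoffel G) (Metric.ball s₀ (r / 4)) := by
  have hr := h.pos
  choose C hC using fun i j k : Fin (n + 1) =>
    (h.isFermiFun_christoffel i j k).exists_odd_taylor_le hr
  obtain ⟨B, hB⟩ := (Set.finite_range fun t : Fin (n + 1) × Fin (n + 1) × Fin (n + 1) =>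
    C t.1 t.2.1 t.2.2).bddAbove
  have hCB : ∀ i j k, C i j k ≤ max B 1 := fun i j k => le_max_of_le_left (hB ⟨(i, j, k), rfl⟩)
  refine ⟨max B 1, lt_max_of_lt_right one_pos, r / 4, by linarith, fun s hs u hu i j k => ?_⟩
  obtain ⟨hcubic, hquartic⟩ := hC i j k s hs u hu
  have hmem : axis n s + u ∈ Metric.ball (axis n s₀) r := by
    have htriangle := dist_triangle (axis n s + u) (axis n s) (axis n s₀)
    rw [dist_axis, dist_self_add_left] at htriangle
    rw [Metric.mem_ball] at hs ⊢
    linarith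
  exact ⟨h.isMetricOn.christoffel_symm hmem i j k, hcubic.trans (by gcongr; exact hCB i j k),
    hquartic.trans (by gcongr; exact hCB i j k)⟩

lemma abs_sum_le_card_mul {ι : Type*} [Fintype ι] {f : ι → ℝ} {A : ℝ} (hf : ∀ i, |f i| ≤ A) :
    |∑ i, f i| ≤ Fintype.card ι * A :=
  calc |∑ i, f i| ≤ ∑ i, |f i| := Finset.abs_sum_le_sum_abs _ _
    _ ≤ Finset.univ.card • A := Finset.sum_le_card_nsmul _ _ A fun i _ => hf i
    _ = Fintype.card ι * A := nsmul_eq_mul _ _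

section Minkowski

lemma abs_pd_le (f : Coord d → ℝ) (a : Fin (d + 1)) (x : Coord d) : |pd a f x| ≤ ‖fderiv ℝ f x‖ :=
  (fderiv ℝ f x).unit_le_opNorm _ (by simp [basisVec])

lemma abs_minkD_le (f h : Coord d → ℝ) (x : Coord d) :
    |minkD f h x| ≤ (d + 1) * (‖fderiv ℝ f x‖ * ‖fderiv ℝ h x‖) := by
  have hterm : ∀ a, |pd a f x * pd a h x| ≤ ‖fderiv ℝ f x‖ * ‖fderiv ℝ h x‖ := fun a => by
    rw [abs_mul]
    exact mul_le_mul (abs_pd_le f a x) (abs_pd_le h a x) (abs_nonneg _) (norm_nonneg _)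
  have hspace := abs_sum_le_card_mul fun a : Fin d => hterm a.succ
  have htriangle := abs_add_le (-(pd 0 f x * pd 0 h x)) (∑ a : Fin d, pd a.succ f x * pd a.succ h x)
  rw [abs_neg] at htriangle
  rw [Fintype.card_fin] at hspace
  rw [minkD]
  linarith [hterm 0]

variable {u : Coord d → Coord n} {x : Coord d}

lemma norm_fderiv_coord_le (hu : DifferentiableAt ℝ u x) (j : Fin (n + 1)) :
    ‖fderiv ℝ (fun z => u z j) x‖ ≤ ‖fderiv ℝ u x‖ := by
  have hcoord : HasFDerivAt (fun z => u z j)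
      ((EuclideanSpace.proj j : Coord n →L[ℝ] ℝ).comp (fderiv ℝ u x)) x :=
    (EuclideanSpace.proj j : Coord n →L[ℝ] ℝ).hasFDerivAt.comp x hu.hasFDerivAt
  rw [hcoord.fderiv]
  exact ContinuousLinearMap.opNorm_le_bound _ (norm_nonneg _) fun v =>
    (PiLp.norm_apply_le (fderiv ℝ u x v) j).trans ((fderiv ℝ u x).le_opNorm v)

lemma abs_minkD_coord_clm_le (ℓ : Coord d →L[ℝ] ℝ) (hu : DifferentiableAt ℝ u x)
    (j : Fin (n + 1)) :
    |minkD (fun z => u z j) ℓ x| ≤ (d + 1) * (‖fderiv ℝ u x‖ * ‖ℓ‖) := by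
  refine (abs_minkD_le _ _ x).trans ?_
  rw [ℓ.fderiv]
  gcongr
  exact norm_fderiv_coord_le hu j

lemma abs_minkD_coord_coord_le (hu : DifferentiableAt ℝ u x) (j k : Fin (n + 1)) :
    |minkD (fun z => u z j) (fun z => u z k) x| ≤
      (d + 1) * (‖fderiv ℝ u x‖ * ‖fderiv ℝ u x‖) :=
  (abs_minkD_le _ _ x).trans (by gcongr <;> apply norm_fderiv_coord_le hu)

lemma pd_axis_add (ℓ : Coord d →L[ℝ] ℝ) (hu : DifferentiableAt ℝ u x) (j : Fin (n + 1))
    (a : Fin (d + 1)) :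
    pd a (fun z => (axis n (ℓ z) + u z) j) x =
      (basisVec 0 : Coord n) j * ℓ (basisVec a) + pd a (fun z => u z j) x := by
  have hcoord : DifferentiableAt ℝ (fun z => u z j) x :=
    (EuclideanSpace.proj j : Coord n →L[ℝ] ℝ).differentiableAt.comp x hu
  have hsum : (fun z => (axis n (ℓ z) + u z) j) =
      fun z => (basisVec 0 : Coord n) j * ℓ z + u z j := by
    funext z
    simp [axis, mul_comm]
  rw [hsum, pd, ((ℓ.hasFDerivAt.const_mul _).fun_add hcoord.hasFDerivAt).fderiv]
  rfl

lemma minkD_axis_add (ℓ : Coord d →L[ℝ] ℝ) (hu : DifferentiableAt ℝ u x) (j k : Fin (n + 1)) :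
    minkD (fun z => (axis n (ℓ z) + u z) j) (fun z => (axis n (ℓ z) + u z) k) x =
      (basisVec 0 : Coord n) j * (basisVec 0 : Coord n) k * minkD ℓ ℓ x
        + (basisVec 0 : Coord n) j * minkD (fun z => u z k) ℓ x
        + (basisVec 0 : Coord n) k * minkD (fun z => u z j) ℓ x
        + minkD (fun z => u z j) (fun z => u z k) x := by
  have hterm : ∀ a, pd a (fun z => (axis n (ℓ z) + u z) j) x *
        pd a (fun z => (axis n (ℓ z) + u z) k) x =
      (basisVec 0 : Coord n) j * (basisVec 0 : Coord n) k * (pd a ℓ x * pd a ℓ x)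
        + (basisVec 0 : Coord n) j * (pd a (fun z => u z k) x * pd a ℓ x)
        + (basisVec 0 : Coord n) k * (pd a (fun z => u z j) x * pd a ℓ x)
        + pd a (fun z => u z j) x * pd a (fun z => u z k) x := fun a => by
    have hℓ : pd a ℓ x = ℓ (basisVec a) := by rw [pd, ℓ.fderiv]
    rw [pd_axis_add ℓ hu, pd_axis_add ℓ hu, hℓ]
    ring
  simp only [minkD, hterm, Finset.sum_add_distrib, ← Finset.mul_sum]
  ring

lemma box_axis_add (ℓ : Coord d →L[ℝ] ℝ) (hu : ContDiffAt ℝ 2 u x) (j : Fin (n + 1)) :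
    box (fun z => (axis n (ℓ z) + u z) j) x = box (fun z => u z j) x := by
  have hpd_pd : ∀ a, pd a (pd a (fun z => (axis n (ℓ z) + u z) j)) x =
      pd a (pd a (fun z => u z j)) x := by
    intro a
    have hpd : pd a (fun z => (axis n (ℓ z) + u z) j) =ᶠ[𝓝 x]
        fun z => (basisVec 0 : Coord n) j * ℓ (basisVec a) + pd a (fun z => u z j) z := by
      filter_upwards [hu.eventually (by simp)] with z hz
      exact pd_axis_add ℓ (hz.differentiableAt (by simp)) j a
    rw [pd, hpd.fderiv_eq, fderiv_const_add]
    rfl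
  simp only [box, hpd_pd]

end Minkowski

section Expansion

variable {Γ : Fin (n + 1) → Fin (n + 1) → Fin (n + 1) → Coord n → ℝ} {u : Coord d → Coord n}
  {x : Coord d}

lemma sum_sum_mul_basisVec_zero (A b : Fin (n + 1) → Fin (n + 1) → ℝ) (c : Fin (n + 1) → ℝ) (σ : ℝ)
    (hA : ∀ j k, A j k = A k j) :
    ∑ j, ∑ k, A j k * ((basisVec 0 : Coord n) j * (basisVec 0 : Coord n) k * σ
      + (basisVec 0 : Coord n) j * c k + (basisVec 0 : Coord n) k * c j + b j k) =
      A 0 0 * σ + 2 * ∑ j, A j 0 * c j + ∑ j, ∑ k, A j k * b j k := by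
  simp only [basisVec_apply, mul_add, Finset.sum_add_distrib, mul_ite, ite_mul, one_mul, zero_mul,
    mul_one, mul_zero, Finset.sum_ite_irrel, Finset.sum_const_zero, Finset.sum_ite_eq',
    Finset.mem_univ, if_true, hA 0]
  ring

lemma waveMapOp_axis_add (ℓ : Coord d →L[ℝ] ℝ) (hu : ContDiffAt ℝ 2 u x) (i : Fin (n + 1))
    (hsymm : ∀ j k, Γ i j k (axis n (ℓ x) + u x) = Γ i k j (axis n (ℓ x) + u x)) :
    waveMapOp Γ (fun z => axis n (ℓ z) + u z) i x = box (fun z => u z i) x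
      + (Γ i 0 0 (axis n (ℓ x) + u x) * minkD ℓ ℓ x
        + 2 * ∑ j, Γ i j 0 (axis n (ℓ x) + u x) * minkD (fun z => u z j) ℓ x
        + ∑ j, ∑ k, Γ i j k (axis n (ℓ x) + u x) *
          minkD (fun z => u z j) (fun z => u z k) x) := by
  rw [waveMapOp, box_axis_add ℓ hu, ← sum_sum_mul_basisVec_zero _ _ _ _ hsymm]
  simp only [minkD_axis_add ℓ (hu.differentiableAt (by simp))]

lemma linearPart_eq (ℓ : Coord d →L[ℝ] ℝ) (i : Fin (n + 1)) :
    linearPart Γ ℓ u i x = normalDeriv (u x) 1 (Γ i 0 0) (axis n (ℓ x)) * minkD ℓ ℓ x := by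
  rw [linearPart, ← Finset.sum_mul]
  simp only [normalDeriv, mul_comm]

lemma quadraticPart_eq (ℓ : Coord d →L[ℝ] ℝ) (i : Fin (n + 1)) :
    quadraticPart Γ ℓ u i x =
      2 * ∑ j, normalDeriv (u x) 1 (Γ i j 0) (axis n (ℓ x)) * minkD (fun z => u z j) ℓ x := by
  rw [quadraticPart, Fin.sum_univ_succ, mul_add, Finset.sum_comm]
  simp only [normalDeriv, Finset.sum_mul, mul_comm]

lemma cubicPart_eq (ℓ : Coord d →L[ℝ] ℝ) (i : Fin (n + 1))
    (heven : ∀ (m p : Fin n) j, pd m.succ (pd p.succ (Γ i j 0)) (axis n (ℓ x)) = 0) :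
    cubicPart Γ ℓ u i x =
      ∑ j, ∑ k, normalDeriv (u x) 1 (Γ i j k) (axis n (ℓ x)) *
          minkD (fun z => u z j) (fun z => u z k) x
        + 1 / 6 * normalDeriv (u x) 3 (Γ i 0 0) (axis n (ℓ x)) * minkD ℓ ℓ x := by
  have hquadratic : ∑ m : Fin n, ∑ j, ∑ k, pd m.succ (Γ i j k) (axis n (ℓ x)) * u x m.succ
        * minkD (fun z => u z j) (fun z => u z k) x =
      ∑ j, ∑ k, normalDeriv (u x) 1 (Γ i j k) (axis n (ℓ x)) *
          minkD (fun z => u z j) (fun z => u z k) x := by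
    rw [Finset.sum_comm]
    refine Finset.sum_congr rfl fun j _ => ?_
    rw [Finset.sum_comm]
    simp only [normalDeriv, Finset.sum_mul, mul_comm]
  have hcubic : ∑ m : Fin n, ∑ p : Fin n, ∑ q : Fin n,
        pd m.succ (pd p.succ (pd q.succ (Γ i 0 0))) (axis n (ℓ x))
          * u x m.succ * u x p.succ * u x q.succ * minkD ℓ ℓ x =
      normalDeriv (u x) 3 (Γ i 0 0) (axis n (ℓ x)) * minkD ℓ ℓ x := by
    simp only [normalDeriv, Finset.mul_sum, Finset.sum_mul]
    rw [Finset.sum_comm_cycle]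
    refine Finset.sum_congr rfl fun q _ => ?_
    rw [Finset.sum_comm]
    exact Finset.sum_congr rfl fun p _ => Finset.sum_congr rfl fun m _ => by ring
  simp only [cubicPart, hquadratic, hcubic, heven, zero_mul, Finset.sum_const_zero]
  ring

lemma waveMapOp_sub_expansion (ℓ : Coord d →L[ℝ] ℝ) (hu : ContDiffAt ℝ 2 u x) (i : Fin (n + 1))
    (hsymm : ∀ j k, Γ i j k (axis n (ℓ x) + u x) = Γ i k j (axis n (ℓ x) + u x))
    (heven : ∀ (m p : Fin n) j, pd m.succ (pd p.succ (Γ i j 0)) (axis n (ℓ x)) = 0) :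
    waveMapOp Γ (fun z => axis n (ℓ z) + u z) i x
        - (box (fun z => u z i) x + linearPart Γ ℓ u i x + quadraticPart Γ ℓ u i x
          + cubicPart Γ ℓ u i x) =
      (Γ i 0 0 (axis n (ℓ x) + u x) - normalDeriv (u x) 1 (Γ i 0 0) (axis n (ℓ x))
        - 1 / 6 * normalDeriv (u x) 3 (Γ i 0 0) (axis n (ℓ x))) * minkD ℓ ℓ x
      + 2 * ∑ j, (Γ i j 0 (axis n (ℓ x) + u x) - normalDeriv (u x) 1 (Γ i j 0) (axis n (ℓ x))) *
          minkD (fun z => u z j) ℓ x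
      + ∑ jk : Fin (n + 1) × Fin (n + 1), (Γ i jk.1 jk.2 (axis n (ℓ x) + u x)
          - normalDeriv (u x) 1 (Γ i jk.1 jk.2) (axis n (ℓ x))) *
          minkD (fun z => u z jk.1) (fun z => u z jk.2) x := by
  rw [waveMapOp_axis_add ℓ hu i hsymm, linearPart_eq, quadraticPart_eq, cubicPart_eq ℓ i heven]
  simp only [Fintype.sum_prod_type, sub_mul, Finset.sum_sub_distrib]
  ring

lemma pow_three_mul_le {a b : ℝ} (ha : 0 ≤ a) (hb : 0 ≤ b) : a ^ 3 * b ≤ a ^ 4 + b ^ 4 := by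
  rcases le_total a b with hab | hba
  · calc a ^ 3 * b ≤ b ^ 3 * b := by gcongr
      _ ≤ a ^ 4 + b ^ 4 := by linarith [pow_nonneg ha 4, pow_succ b 3]
  · calc a ^ 3 * b ≤ a ^ 3 * a := by gcongr
      _ ≤ a ^ 4 + b ^ 4 := by linarith [pow_nonneg hb 4, pow_succ a 3]

lemma pow_three_mul_sq_le {a b : ℝ} (ha : 0 ≤ a) (ha' : a ≤ 1) :
    a ^ 3 * b ^ 2 ≤ a ^ 4 + b ^ 4 := by
  calc a ^ 3 * b ^ 2 ≤ a ^ 2 * b ^ 2 :=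
        mul_le_mul_of_nonneg_right (pow_le_pow_of_le_one ha ha' (by norm_num)) (sq_nonneg b)
    _ ≤ a ^ 4 + b ^ 4 := by nlinarith [sq_nonneg (a ^ 2 - b ^ 2), sq_nonneg (a ^ 2 + b ^ 2)]

theorem HasOddExpansion.waveMapOp_expansion {S : Set ℝ} (hΓ : HasOddExpansion Γ S)
    (ℓ : Coord d →L[ℝ] ℝ)
    (heven : ∀ (m p : Fin n) i j s, pd m.succ (pd p.succ (Γ i j 0)) (axis n s) = 0) :
    ∃ C > 0, ∃ δ > 0, ∀ (u : Coord d → Coord n) (x : Coord d), ℓ x ∈ S → ContDiffAt ℝ 2 u x →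
      ‖u x‖ ≤ δ → ∀ i : Fin (n + 1),
        |waveMapOp Γ (fun z => axis n (ℓ z) + u z) i x
          - (box (fun z => u z i) x + linearPart Γ ℓ u i x + quadraticPart Γ ℓ u i x
            + cubicPart Γ ℓ u i x)| ≤ C * (‖u x‖ ^ 4 + ‖fderiv ℝ u x‖ ^ 4) := by
  obtain ⟨C, hC, δ, hδ, hΓ⟩ := hΓ
  refine ⟨C * (d + 1) * (‖ℓ‖ + (n + 1)) ^ 2, by positivity, min δ 1, lt_min hδ one_pos,
    fun u x hx hu hux i => ?_⟩
  have hdiff : DifferentiableAt ℝ u x := hu.differentiableAt (by simp)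
  have hΓ := hΓ (ℓ x) hx (u x) (hux.trans (min_le_left _ _)) i
  rw [waveMapOp_sub_expansion ℓ hu i (fun j k => (hΓ j k).1) fun m p j => heven m p i j _]
  set U := ‖u x‖
  set V := ‖fderiv ℝ u x‖
  have hσ : |minkD ℓ ℓ x| ≤ (d + 1) * (‖ℓ‖ * ‖ℓ‖) := by simpa using abs_minkD_le ℓ ℓ x
  refine (abs_add_three _ _ _).trans ?_
  rw [abs_mul 2, abs_two, abs_mul]
  calc
    _ ≤ C * U ^ 4 * ((d + 1) * (‖ℓ‖ * ‖ℓ‖))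
        + 2 * (Fintype.card (Fin (n + 1)) * (C * U ^ 3 * ((d + 1) * (V * ‖ℓ‖))))
        + Fintype.card (Fin (n + 1) × Fin (n + 1)) * (C * U ^ 3 * ((d + 1) * (V * V))) := by
      gcongr
      · exact (hΓ 0 0).2.2
      · refine abs_sum_le_card_mul fun j => ?_
        rw [abs_mul]
        gcongr
        exacts [(hΓ j 0).2.1, abs_minkD_coord_clm_le ℓ hdiff j]
      · refine abs_sum_le_card_mul fun jk => ?_
        rw [abs_mul]
        gcongr
        exacts [(hΓ jk.1 jk.2).2.1, abs_minkD_coord_coord_le hdiff jk.1 jk.2]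
    _ = C * (d + 1) * (‖ℓ‖ ^ 2 * U ^ 4 + 2 * (‖ℓ‖ * (n + 1)) * (U ^ 3 * V)
        + (n + 1) ^ 2 * (U ^ 3 * V ^ 2)) := by
      simp only [Fintype.card_prod, Fintype.card_fin]
      push_cast
      ring
    _ ≤ C * (d + 1) * (‖ℓ‖ ^ 2 * (U ^ 4 + V ^ 4) + 2 * (‖ℓ‖ * (n + 1)) * (U ^ 4 + V ^ 4)
        + (n + 1) ^ 2 * (U ^ 4 + V ^ 4)) := by
      gcongr
      · exact le_add_of_nonneg_right (by positivity)
      · exact pow_three_mul_le (norm_nonneg _) (norm_nonneg _)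
      · exact pow_three_mul_sq_le (norm_nonneg _) (hux.trans (min_le_right _ _))
    _ = _ := by ring

end Expansion

end WaveMap

end FermiWaveMap

end

open FermiWaveMap in
theorem lemma3p3 {n : ℕ} {M : Type*} [TopologicalSpace M] [T2Space M]
    [ChartedSpace (Coord n) M] [IsManifold (𝓡 (n + 1)) ∞ M]
    (g : Metric n M) (κ : ℝ) (hκ : HasConstantCurvature g κ)
    (γ : ℝ → M) (hγ : IsGeodesicOn g γ Set.univ)
    (e : Fin (n + 1) → ∀ t, TangentSpace (𝓡 (n + 1)) (γ t)) (he : IsParallelFrame g γ e) :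
    -- the Fermi coordinates and their Christoffel symbols are regular near the geodesic
    (∀ s : ℝ, fermiMap g γ e (axis n s) = γ s ∧
      ContMDiffAt 𝓘(ℝ, Coord n) (𝓡 (n + 1)) ∞ (fermiMap g γ e) (axis n s) ∧
      Function.Bijective (mfderiv 𝓘(ℝ, Coord n) (𝓡 (n + 1)) (fermiMap g γ e) (axis n s)) ∧
      ∀ k i j, ContDiffAt ℝ ∞ (fermiChristoffel g γ e k i j) (axis n s)) ∧
    -- the vanishing identities along the geodesic
    (∀ s : ℝ,
      (∀ (m : Fin n) (i j : Fin (n + 1)),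
        pd 0 (pd m.succ (fermiChristoffel g γ e i j 0)) (axis n s) = 0) ∧
      (∀ (p m : Fin n) (i : Fin (n + 1)),
        pd p.succ (pd m.succ (fermiChristoffel g γ e i 0 0)) (axis n s) = 0) ∧
      (∀ a b i : Fin (n + 1),
        pd 0 (pd a (pd b (fermiChristoffel g γ e i 0 0))) (axis n s) = 0)) ∧
    -- the resulting structure of the wave map equations for `φ = (ℓ + u¹, u², …)`
    (∀ (d : ℕ) (ℓ : Coord d →L[ℝ] ℝ) (K : ℝ), ∃ C > 0, ∃ δ > 0,
      ∀ (u : Coord d → Coord n) (x : Coord d), |ℓ x| ≤ K → ContDiffAt ℝ 2 u x → ‖u x‖ ≤ δ →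
      ∀ i : Fin (n + 1),
        |waveMapOp (fermiChristoffel g γ e) (fun z => axis n (ℓ z) + u z) i x
          - (box (fun z => u z i) x
            + linearPart (fermiChristoffel g γ e) ℓ u i x
            + quadraticPart (fermiChristoffel g γ e) ℓ u i x
            + cubicPart (fermiChristoffel g γ e) ℓ u i x)|
          ≤ C * (‖u x‖ ^ 4 + ‖fderiv ℝ u x‖ ^ 4)) := by
  have hfermi := fun s => exists_isFermiMetric hκ hγ he s
  have hodd : ∀ p m i j k s, pd p (pd m (fermiChristoffel g γ e i j k)) (axis n s) = 0 := by
    intro p m i j k s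
    obtain ⟨r, h⟩ := hfermi s
    exact (h.isFermiFun_christoffel i j k).pd_pd_axis p m (Metric.mem_ball_self h.pos)
  refine ⟨fun s => ?_, fun s => ?_, fun d ℓ K => ?_⟩
  · obtain ⟨ε, Z, hball⟩ := exists_isFermiBall hγ he s
    obtain ⟨r, h⟩ := hfermi s
    exact ⟨hball.fermiMap_axis_center, hball.contMDiffAt _ hball.axis_mem,
      hball.bijective_mfderiv, fun k i j =>
        (h.isFermiFun_christoffel k i j).contDiffAt _ (Metric.mem_ball_self h.pos)⟩
  · obtain ⟨r, h⟩ := hfermi s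
    exact ⟨fun m i j => hodd 0 m.succ i j 0 s, fun p m i => hodd p.succ m.succ i 0 0 s,
      fun a b i => (((h.isFermiFun_christoffel i 0 0).pd b).pd a).pd_zero
        (Metric.mem_ball_self h.pos)⟩
  · have hexp : HasOddExpansion (fermiChristoffel g γ e) (Set.Icc (-K) K) := by
      refine .of_isCompact (fun s => ?_) isCompact_Icc
      obtain ⟨r, h⟩ := hfermi s
      exact ⟨_, Metric.ball_mem_nhds s (by linarith [h.pos]), h.hasOddExpansion⟩
    obtain ⟨C, hC, δ, hδ, hbound⟩ :=
      hexp.waveMapOp_expansion ℓ fun m p i j s => hodd m.succ p.succ i j 0 s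
    exact ⟨C, hC, δ, hδ, fun u x hx => hbound u x (abs_le.1 hx)⟩
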